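/- **Proposition 3.2.** Let $G$ be a (real, finite-dimensional) semisimple Lie group, $\sigma$ an involutive automorphism of $G$, and $H$ a subgroup with $(\mathrm{Fix}\,\sigma)_0\subset H\subset \mathrm{Fix}\,\sigma$. Let $\mathfrak g=\mathfrak h\oplus\mathfrak q$ be the decomposition of the Lie algebra of $G$ into the $(+1)$- and $(-1)$-eigenspaces of the differential of $\sigma$, identify $\mathfrak q$ with $T_{eH}(G/H)$, and equip $G/H$ with the $G$-invariant pseudo-Riemannian metric induced by the Killing form of $\mathfrak g$. Let $\mathfrak a\subset\mathfrak q$ be a Cartan subspace, i.e. a maximal abelian subspace of $\mathfrak q$ such that $\mathrm{ad}(a)$ is semisimple for every $a\in\mathfrak a$. Write $(\cdot)^{\bf c}$ for complexification; for a complex linear form $\alpha$ on $\mathfrak a^{\bf c}$ put $$\mathfrak q^{\bf c}_\alpha=\{X\in\mathfrak q^{\bf c}\mid \mathrm{ad}(a)^2X=\alpha(a)^2X\ \text{ for all } a\in\mathfrak a^{\bf c}\},\qquad \triangle=\{\alpha\neq 0\mid \mathfrak q^{\bf c}_\alpha\ne\{0\}\},$$ and let $\triangle_+\subset\triangle$ contain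 exactly one element of each pair $\pm\alpha$ (for instance the positive roots for a lexicographical ordering). Let $w\in\mathfrak a$, $g=\exp_G(w)$, $x=gH$, let $M=H\cdot x$ be the orbit of $x$ under the isotropy action of $H$ on $G/H$, and let $A$ be its shape tensor, $\langle A_vX,Y\rangle=\langle\widetilde\nabla_XY,v\rangle$, where $\widetilde\nabla$ is the Levi-Civita connection of $G/H$. (i) One has $$g_*^{-1}(T_xM)^{\bf c}=\sum_{\alpha\in\triangle_+,\ \alpha(w)\notin\sqrt{-1}\pi\mathbf Z}\mathfrak q^{\bf c}_\alpha,\qquad g_*^{-1}(T^\perp_xM)^{\bf c}=\mathfrak a^{\bf c}+\sum_{\alpha\in\triangle_+,\ \alpha(w)\in\sqrt{-1}\pi\mathbf Z}\mathfrak q^{\bf c}_\alpha .$$ In particular, if $M$ is a principal orbit (the isotropy group $H_x$ is, up to conjugation in $H$, contained in $H_y$ for every $y$ near $x$), then $g_*^{-1}(T_xM)^{\bf c}=\sum_{\alpha\in\triangle_+}\mathfrak q^{\bf c}_\alpha$ and $g_*^{-1}(T^\perp_xM)^{\bf c}=\mathfrak a^{\bf c}$. (ii) Let $H_x$ be the isotropy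 group of $H$ at $x$, let $H_x(g_*\mathfrak a)=\{h_{*x}g_*a\mid h\in H_x,\ a\in\mathfrak a\}$, and let $\mathfrak a_{\rm reg}$ be the set of all $a\in\mathfrak a$ with $\beta(a)\neq0$ for every $\beta\in\triangle_+$ such that $\beta(w)\in\sqrt{-1}\pi\mathbf Z$. Then $H_x(g_*\mathfrak a)\subset T_x^\perp M$, and the set $\{h_{*x}g_*a\mid h\in H_x,\ a\in\mathfrak a_{\rm reg}\}$ is open in $T_x^\perp M$ and dense in $H_x(g_*\mathfrak a)$. Moreover, for all $h\in H_x$ and $a\in\mathfrak a$, the shape operator $A_v$ of $M$ for $v=h_{*x}g_*a$ exists and is unique, and its complexification satisfies, for every $\alpha\in\triangle_+$ with $\alpha(w)\notin\sqrt{-1}\pi\mathbf Z$, $$h_{*x}g_*\mathfrak q^{\bf c}_\alpha\subset (T_xM)^{\bf c},\qquad A^{\bf c}_v\big|_{h_{*x}g_*\mathfrak q^{\bf c}_\alpha}=-\frac{\sqrt{-1}\,\alpha(a)}{\tan(\sqrt{-1}\,\alpha(w))}\,\mathrm{id},$$ where $1/\tan=\cos/\sin$ (so it is $0$ at the poles of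 $\tan$). -/

import Mathlib

open scoped Manifold ContDiff TensorProduct Topology

noncomputable section

/-- A smooth Lie group has a Lie algebra in the sense of Mathlib. -/
instance instLieGroupMinSmoothness {n : ℕ} {G : Type*} [TopologicalSpace G]
    [ChartedSpace (EuclideanSpace ℝ (Fin n)) G] [Group G] [h : LieGroup (𝓡 n) ∞ G] :
    LieGroup (𝓡 n) (minSmoothness ℝ 3) G :=
  LieGroup.of_le (n := ∞) (by
    rw [minSmoothness_of_isRCLikeNormedField]
    exact ENat.LEInfty.out)

namespace SymSpace

/-! ### Cartan subspaces and restricted roots in a real Lie algebra -/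

section Roots

variable {L : Type*} [LieRing L] [LieAlgebra ℝ L]

/-- `𝔞` is a maximal abelian subspace of `𝔮` all of whose elements are (ad-)semisimple. -/
structure IsCartanSubspace (𝔮 𝔞 : Submodule ℝ L) : Prop where
  le : 𝔞 ≤ 𝔮
  abelian : ∀ X ∈ 𝔞, ∀ Y ∈ 𝔞, ⁅X, Y⁆ = 0
  maximal : ∀ 𝔟 : Submodule ℝ L, 𝔟 ≤ 𝔮 → (∀ X ∈ 𝔟, ∀ Y ∈ 𝔟, ⁅X, Y⁆ = 0) → 𝔞 ≤ 𝔟 → 𝔟 = 𝔞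
  semisimple : ∀ X ∈ 𝔞, (LieAlgebra.ad ℝ L X).IsSemisimple

/-- `{X ∈ 𝔮ᶜ | ad(a)² X = α(a)² X for all a ∈ 𝔞ᶜ}`, for a complex linear form `α` on `𝔞ᶜ`. -/
def rootSpace (𝔮 𝔞 : Submodule ℝ L) (α : Module.Dual ℂ (𝔞.baseChange ℂ)) :
    Submodule ℂ (ℂ ⊗[ℝ] L) where
  carrier := {X | X ∈ 𝔮.baseChange ℂ ∧
    ∀ a : 𝔞.baseChange ℂ, ⁅(a : ℂ ⊗[ℝ] L), ⁅(a : ℂ ⊗[ℝ] L), X⁆⁆ = (α a) ^ 2 • X}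
  add_mem' := fun hX hY => ⟨add_mem hX.1 hY.1, fun a => by
    rw [lie_add, lie_add, hX.2 a, hY.2 a, smul_add]⟩
  zero_mem' := ⟨zero_mem _, fun a => by simp⟩
  smul_mem' := fun c X hX => ⟨Submodule.smul_mem _ c hX.1, fun a => by
    rw [lie_smul, lie_smul, hX.2 a, smul_comm]⟩

/-- The restricted roots: nonzero `α` with nonzero root space in `𝔮ᶜ`. -/
def roots (𝔮 𝔞 : Submodule ℝ L) : Set (Module.Dual ℂ (𝔞.baseChange ℂ)) :=
  {α | α ≠ 0 ∧ rootSpace 𝔮 𝔞 α ≠ ⊥}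

/-- `P` contains exactly one root of each pair `{α, -α}` (and nothing else). The positive roots for
any lexicographical ordering form such a set. -/
structure IsPositiveSystem (𝔮 𝔞 : Submodule ℝ L)
    (P : Set (Module.Dual ℂ (𝔞.baseChange ℂ))) : Prop where
  mem_roots_iff : ∀ α, α ∈ roots 𝔮 𝔞 ↔ α ∈ P ∨ -α ∈ P
  neg_notMem : ∀ α ∈ P, -α ∉ P

/-- The value `α(a)` at a real vector `a ∈ 𝔞 ⊆ 𝔞ᶜ`. -/
def realEval {𝔞 : Submodule ℝ L} (α : Module.Dual ℂ (𝔞.baseChange ℂ)) (a : 𝔞) : ℂ :=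
  α ⟨(1 : ℂ) ⊗ₜ[ℝ] (a : L), Submodule.tmul_mem_baseChange_of_mem 1 a.2⟩

/-- The condition `α(w) ∈ √-1 π ℤ`. -/
def IsSingularAt {𝔞 : Submodule ℝ L} (w : 𝔞) (α : Module.Dual ℂ (𝔞.baseChange ℂ)) : Prop :=
  ∃ k : ℤ, realEval α w = Complex.I * Real.pi * k

end Roots

/-! ### Lie groups with an involution -/

section Group

variable {n : ℕ} {G : Type*} [TopologicalSpace G] [ChartedSpace (EuclideanSpace ℝ (Fin n)) G]
  [Group G]

/-- `σ` is a smooth involutive automorphism of `G`, and `(Fix σ)₀ ⊆ H ⊆ Fix σ`. -/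
structure IsSymmetricPair (n : ℕ) {G : Type*} [TopologicalSpace G]
    [ChartedSpace (EuclideanSpace ℝ (Fin n)) G] [Group G] (σ : G →* G) (H : Subgroup G) :
    Prop where
  smooth : ContMDiff (𝓡 n) (𝓡 n) ∞ σ
  involutive : ∀ g, σ (σ g) = g
  component_le : connectedComponentIn {g : G | σ g = g} 1 ⊆ (H : Set G)
  le_fixed : ∀ g ∈ H, σ g = g

/-- The differential of `σ` at the identity, as an endomorphism of the Lie algebra. -/
def dInv (n : ℕ) {G : Type*} [TopologicalSpace G] [ChartedSpace (EuclideanSpace ℝ (Fin n)) G]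
    [Group G] (σ : G →* G) : GroupLieAlgebra (𝓡 n) G →ₗ[ℝ] GroupLieAlgebra (𝓡 n) G :=
  (show EuclideanSpace ℝ (Fin n) →L[ℝ] EuclideanSpace ℝ (Fin n) from
    mfderiv (𝓡 n) (𝓡 n) σ (1 : G)).toLinearMap

/-- `𝔥 = Ker(σ - id)`, the Lie algebra of `H`. -/
def hSub (n : ℕ) {G : Type*} [TopologicalSpace G] [ChartedSpace (EuclideanSpace ℝ (Fin n)) G]
    [Group G] (σ : G →* G) : Submodule ℝ (GroupLieAlgebra (𝓡 n) G) :=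
  LinearMap.ker (dInv n σ - LinearMap.id)

/-- `𝔮 = Ker(σ + id)`. -/
def qSub (n : ℕ) {G : Type*} [TopologicalSpace G] [ChartedSpace (EuclideanSpace ℝ (Fin n)) G]
    [Group G] (σ : G →* G) : Submodule ℝ (GroupLieAlgebra (𝓡 n) G) :=
  LinearMap.ker (dInv n σ + LinearMap.id)

/-- `γ` is a smooth one-parameter subgroup of `G` with initial velocity `X`. -/
structure IsOneParameterSubgroup (γ : ℝ → G) (X : GroupLieAlgebra (𝓡 n) G) : Prop where
  map_add : ∀ s t, γ (s + t) = γ s * γ t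
  smooth : ContMDiff 𝓘(ℝ, ℝ) (𝓡 n) ∞ γ
  velocity : mfderiv 𝓘(ℝ, ℝ) (𝓡 n) γ 0 (1 : ℝ) = X

open Classical in
/-- The exponential map: `exp X = γ(1)` for the one-parameter subgroup `γ` with velocity `X`
(which always exists and is unique; the value `1` of the other branch is never used). -/
def lieExp (X : GroupLieAlgebra (𝓡 n) G) : G :=
  if h : ∃ γ : ℝ → G, IsOneParameterSubgroup γ X then h.choose 1 else 1

end Group

/-- The orbit `H • x` is principal: its isotropy group is, up to conjugation in `H`, contained in
the isotropy group of every point near `x`. -/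
def IsPrincipalOrbit {G : Type*} [TopologicalSpace G] [Group G] (H : Subgroup G) (x : G ⧸ H) : Prop :=
  ∀ᶠ y in 𝓝 x, ∃ h ∈ H, ∀ k ∈ H, k • x = x → (h * k * h⁻¹) • y = y

/-! ### The homogeneous space `G ⧸ H` and its metric -/

section Space

variable (n d : ℕ) {G : Type*} [TopologicalSpace G] [ChartedSpace (EuclideanSpace ℝ (Fin n)) G]
  [Group G] {H : Subgroup G} [ChartedSpace (EuclideanSpace ℝ (Fin d)) (G ⧸ H)]

/-- The base point `eH`. -/
def base (H : Subgroup G) : G ⧸ H := ((1 : G) : G ⧸ H)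

/-- The differential at `y` of the action of `g` on `G ⧸ H`. -/
def dAct (g : G) (y : G ⧸ H) : TangentSpace (𝓡 d) y →L[ℝ] TangentSpace (𝓡 d) (g • y) :=
  mfderiv (𝓡 d) (𝓡 d) (fun z : G ⧸ H => g • z) y

/-- The differential at `x` of the action of an element `k` of `G` that fixes `x`, as an
endomorphism of `T_x (G ⧸ H)` (only used when `k • x = x`). -/
def dIso (k : G) (x : G ⧸ H) : TangentSpace (𝓡 d) x →L[ℝ] TangentSpace (𝓡 d) x :=
  (show EuclideanSpace ℝ (Fin d) →L[ℝ] EuclideanSpace ℝ (Fin d) from dAct d k x)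

/-- The differential of the projection `G → G ⧸ H` at `e`; it restricts to the identification of
`𝔮` with `T_{eH} (G ⧸ H)`. -/
def dProj (H : Subgroup G) [ChartedSpace (EuclideanSpace ℝ (Fin d)) (G ⧸ H)] :
    GroupLieAlgebra (𝓡 n) G →L[ℝ] TangentSpace (𝓡 d) (base H) :=
  mfderiv (𝓡 n) (𝓡 d) (fun k : G => (k : G ⧸ H)) (1 : G)

/-- `g_*`, on `𝔮 ≅ T_{eH} (G ⧸ H)`. -/
def gStar (H : Subgroup G) [ChartedSpace (EuclideanSpace ℝ (Fin d)) (G ⧸ H)] (g : G) :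
    GroupLieAlgebra (𝓡 n) G →L[ℝ] TangentSpace (𝓡 d) (g • base H) :=
  (dAct d g (base H)).comp (dProj n d H)

/-- `g_*⁻¹ : T_{gH} (G ⧸ H) → 𝔮`, the inverse of the isomorphism `g_* : 𝔮 → T_{gH} (G ⧸ H)`. -/
def gStarInv (σ : G →* G) (H : Subgroup G) [ChartedSpace (EuclideanSpace ℝ (Fin d)) (G ⧸ H)]
    (g : G) : TangentSpace (𝓡 d) (g • base H) →ₗ[ℝ] GroupLieAlgebra (𝓡 n) G :=
  (qSub n σ).subtype ∘ₗ
    (((gStar n d H g).comp (qSub n σ).subtypeL).inverse).toLinearMap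

/-- The tangent space at `x` of the orbit `H • x`: the image of `𝔥` under the differential at `e`
of the orbit map `k ↦ k • x`. -/
def orbitTangent (σ : G →* G) (x : G ⧸ H) : Submodule ℝ (TangentSpace (𝓡 d) x) :=
  (hSub n σ).map (show GroupLieAlgebra (𝓡 n) G →ₗ[ℝ] TangentSpace (𝓡 d) x from
    (show EuclideanSpace ℝ (Fin n) →L[ℝ] EuclideanSpace ℝ (Fin d) from
      mfderiv (𝓡 n) (𝓡 d) (fun k : G => k • x) (1 : G)).toLinearMap)

variable [LieGroup (𝓡 n) ∞ G]

/-- The pseudo-Riemannian metric of `G ⧸ H` induced from the Killing form `B`: at `y = gH` it is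
`⟨u, v⟩ = B(g_*⁻¹ u, g_*⁻¹ v)`. The representative `g` of `y` does not matter, as `Ad(H)` preserves
`𝔮` and `B`. -/
def metric (σ : G →* G) (y : G ⧸ H) : LinearMap.BilinForm ℝ (TangentSpace (𝓡 d) y) :=
  (killingForm ℝ (GroupLieAlgebra (𝓡 n) G)).compl₁₂
    (show TangentSpace (𝓡 d) y →ₗ[ℝ] GroupLieAlgebra (𝓡 n) G from gStarInv n d σ H y.out)
    (show TangentSpace (𝓡 d) y →ₗ[ℝ] GroupLieAlgebra (𝓡 n) G from gStarInv n d σ H y.out)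

/-- The derivative of the function `⟨Y, Z⟩` at `x` in the direction `u`. -/
def dMetric (σ : G →* G) (Y Z : (y : G ⧸ H) → TangentSpace (𝓡 d) y) (x : G ⧸ H)
    (u : TangentSpace (𝓡 d) x) : ℝ :=
  mfderiv (𝓡 d) 𝓘(ℝ, ℝ) (fun y => metric n d σ y (Y y) (Z y)) x u

/-- `⟨∇_X Y, Z⟩` at `x`, where `∇` is the Levi-Civita connection of `G ⧸ H`, given by the Koszul
formula. -/
def leviCivita (σ : G →* G) (X Y Z : (y : G ⧸ H) → TangentSpace (𝓡 d) y) (x : G ⧸ H) : ℝ :=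
  (1 / 2) * (dMetric n d σ Y Z x (X x) + dMetric n d σ X Z x (Y x) - dMetric n d σ X Y x (Z x)
    + metric n d σ x (VectorField.mlieBracket (𝓡 d) X Y x) (Z x)
    - metric n d σ x (VectorField.mlieBracket (𝓡 d) X Z x) (Y x)
    - metric n d σ x (VectorField.mlieBracket (𝓡 d) Y Z x) (X x))

/-- The normal space at `x` of the orbit `H • x`. -/
def orbitNormal (σ : G →* G) (x : G ⧸ H) : Submodule ℝ (TangentSpace (𝓡 d) x) :=
  (metric n d σ x).orthogonal (orbitTangent n d σ x)

/-- `A` is the shape operator at `x` of the orbit `M = H • x` for the normal vector `v`: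
`⟨A X, Y⟩ = ⟨∇_X Y, v⟩` at `x` (equivalently, `A X` is the tangential part of `-∇_X ξ` for a normal
field `ξ` with `ξ_x = v`). Here `X`, `Y` run over the vector fields that are smooth near `x` and
tangent to `M` along `M`, and `V` over the smooth extensions of `v`. -/
def IsShapeOperator [IsManifold (𝓡 d) ∞ (G ⧸ H)] (σ : G →* G) (x : G ⧸ H) (v : TangentSpace (𝓡 d) x)
    (A : orbitTangent n d σ x →ₗ[ℝ] orbitTangent n d σ x) : Prop :=
  ∀ X Y V : (y : G ⧸ H) → TangentSpace (𝓡 d) y,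
    ContMDiffAt (𝓡 d) (𝓡 d).tangent ∞ (fun y => (⟨y, X y⟩ : TangentBundle (𝓡 d) (G ⧸ H))) x →
    ContMDiffAt (𝓡 d) (𝓡 d).tangent ∞ (fun y => (⟨y, Y y⟩ : TangentBundle (𝓡 d) (G ⧸ H))) x →
    ContMDiffAt (𝓡 d) (𝓡 d).tangent ∞ (fun y => (⟨y, V y⟩ : TangentBundle (𝓡 d) (G ⧸ H))) x →
    (∀ᶠ y in 𝓝 x, y ∈ MulAction.orbit H x →
      X y ∈ orbitTangent n d σ y ∧ Y y ∈ orbitTangent n d σ y) →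
    V x = v →
    ∀ u w : orbitTangent n d σ x, X x = u → Y x = w →
      metric n d σ x (A u : TangentSpace (𝓡 d) x) (w : TangentSpace (𝓡 d) x)
        = leviCivita n d σ X Y V x

end Space

end SymSpace

end

/-! Write θ for the differential of σ and use g_* to move everything to 𝔮. Since kgH = g(g⁻¹kg)H,
the tangent space of M becomes the 𝔮-component of Ad(g⁻¹)𝔥 (`tangentPart`), and Ad(g) = exp(ad w)
(`AdE_lieExp`). The operators ad(a), a ∈ 𝔞, commute and are semisimple, so 𝔮ᶜ is the sum of 𝔞ᶜ and
the root spaces (`antiSub_baseChange_eq`). Let X ∈ 𝔮ᶜ_α and μ = α(w). If sinh μ ≠ 0, then [w,X] lies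
in 𝔥ᶜ and Ad(g⁻¹)[w,X] has 𝔮-component −μ sinh μ · X, so X is tangent
(`IsExpPair.rootSpace_le_tangentPart`). If sinh μ = 0, then Ad(g)X = cosh μ · X is orthogonal to 𝔥ᶜ,
so X is normal; likewise for 𝔞ᶜ, which Ad(g) fixes (`IsExpPair.orth_singular`). Nondegeneracy of the
Killing form B on 𝔮 turns these inclusions into the equalities of (i).

For a principal orbit, compare w with a nearby w + ta at which no root is singular. The isotropy
algebra at x embeds into the one at the nearby point, so the tangent space at x is at least as large
as the sum of all root spaces, which contains it (`tangentPart_of_isPrincipalOrbit`).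

In (ii), openness is a slice argument: at a regular a, the isotropy algebra moves a in every normal
direction transversal to 𝔞 (`IsExpPair.exists_eq_lie_add`), so the map (X,b) ↦ exp(ad X)(a+b) is
open onto the normal space (`eventually_mem_slice`). Density holds because regularity removes only
finitely many hyperplanes of 𝔞.

For the shape operator, tangent vectors extend to fundamental fields of the action. They are Killing
fields, so for E, F ∈ 𝔥 and z = g_*⁻¹v the Koszul formula collapses to B((Ad(g⁻¹)E)_𝔮,
[z,(Ad(g⁻¹)F)_𝔥]) (`leviCivita_eq`). For z = a, paired with root vectors, the cosh/sinh formula for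
Ad(g) gives the factor −α(a) coth α(w) (`IsExpPair.killC_lie_fixPart`). The case z = Ad(k)a, with k
= g⁻¹hg, reduces to this one by invariance under Ad(k). -/

noncomputable section

namespace SymSpace

/-! ### Real and imaginary parts in a complexification -/

section Complexification

variable {V W : Type*} [AddCommGroup V] [Module ℝ V] [AddCommGroup W] [Module ℝ W]

/-- The real part of an element of `ℂ ⊗ V`. -/
def tensorRe (V : Type*) [AddCommGroup V] [Module ℝ V] : ℂ ⊗[ℝ] V →ₗ[ℝ] V :=
  (TensorProduct.lid ℝ V).toLinearMap ∘ₗ (Complex.reLm.rTensor V)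

/-- The imaginary part of an element of `ℂ ⊗ V`. -/
def tensorIm (V : Type*) [AddCommGroup V] [Module ℝ V] : ℂ ⊗[ℝ] V →ₗ[ℝ] V :=
  (TensorProduct.lid ℝ V).toLinearMap ∘ₗ (Complex.imLm.rTensor V)

@[simp] lemma tensorRe_tmul (z : ℂ) (v : V) : tensorRe V (z ⊗ₜ v) = z.re • v := by
  simp [tensorRe]

@[simp] lemma tensorIm_tmul (z : ℂ) (v : V) : tensorIm V (z ⊗ₜ v) = z.im • v := by
  simp [tensorIm]

lemma eq_re_add_im (ξ : ℂ ⊗[ℝ] V) :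
    ξ = (1 : ℂ) ⊗ₜ[ℝ] tensorRe V ξ + Complex.I ⊗ₜ[ℝ] tensorIm V ξ := by
  induction ξ with
  | zero => simp
  | tmul z v =>
    simp only [tensorRe_tmul, tensorIm_tmul]
    rw [TensorProduct.tmul_smul, TensorProduct.tmul_smul, TensorProduct.smul_tmul',
      TensorProduct.smul_tmul', ← TensorProduct.add_tmul]
    congr 1
    apply Complex.ext <;> simp
  | add x y hx hy =>
    rw [map_add, map_add, TensorProduct.tmul_add, TensorProduct.tmul_add]
    nth_rewrite 1 [hx, hy]
    abel

lemma tensor_ext {ξ η : ℂ ⊗[ℝ] V} (h₁ : tensorRe V ξ = tensorRe V η)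
    (h₂ : tensorIm V ξ = tensorIm V η) : ξ = η := by
  rw [eq_re_add_im ξ, eq_re_add_im η, h₁, h₂]

@[simp] lemma tensorRe_baseChange (f : V →ₗ[ℝ] W) (ξ : ℂ ⊗[ℝ] V) :
    tensorRe W (f.baseChange ℂ ξ) = f (tensorRe V ξ) := by
  induction ξ with
  | zero => simp
  | tmul z v => simp
  | add x y hx hy => simp [hx, hy]

@[simp] lemma tensorIm_baseChange (f : V →ₗ[ℝ] W) (ξ : ℂ ⊗[ℝ] V) :
    tensorIm W (f.baseChange ℂ ξ) = f (tensorIm V ξ) := by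
  induction ξ with
  | zero => simp
  | tmul z v => simp
  | add x y hx hy => simp [hx, hy]

/-- Since ℂ = ℝ ⊕ iℝ, membership in a complexified real subspace is tested on real and imaginary
parts. This is the passage from root spaces, which are only complex, back to real subspaces. -/
lemma mem_baseChange_iff {N : Submodule ℝ V} {ξ : ℂ ⊗[ℝ] V} :
    ξ ∈ N.baseChange ℂ ↔ tensorRe V ξ ∈ N ∧ tensorIm V ξ ∈ N := by
  constructor
  · rintro ⟨η, rfl⟩
    exact ⟨by simp, by simp⟩
  · rintro ⟨h₁, h₂⟩
    rw [eq_re_add_im ξ]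
    exact add_mem (Submodule.tmul_mem_baseChange_of_mem _ h₁)
      (Submodule.tmul_mem_baseChange_of_mem _ h₂)

lemma one_tmul_mem_baseChange {N : Submodule ℝ V} {v : V} :
    (1 : ℂ) ⊗ₜ[ℝ] v ∈ N.baseChange ℂ ↔ v ∈ N := by
  simp [mem_baseChange_iff]

lemma baseChange_le_iff {N N' : Submodule ℝ V} :
    N.baseChange ℂ ≤ N'.baseChange ℂ ↔ N ≤ N' :=
  ⟨fun h _ hv => one_tmul_mem_baseChange.1 (h (one_tmul_mem_baseChange.2 hv)),
    fun h _ hξ => mem_baseChange_iff.2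
      ⟨h (mem_baseChange_iff.1 hξ).1, h (mem_baseChange_iff.1 hξ).2⟩⟩

lemma map_baseChange (f : V →ₗ[ℝ] W) (N : Submodule ℝ V) :
    (N.map f).baseChange ℂ = (N.baseChange ℂ).map (f.baseChange ℂ) := by
  ext ξ
  rw [mem_baseChange_iff]
  constructor
  · rintro ⟨⟨u, hu, hu'⟩, v, hv, hv'⟩
    refine ⟨(1 : ℂ) ⊗ₜ[ℝ] u + Complex.I ⊗ₜ[ℝ] v, ?_, ?_⟩
    · exact add_mem (Submodule.tmul_mem_baseChange_of_mem _ hu)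
        (Submodule.tmul_mem_baseChange_of_mem _ hv)
    · rw [eq_re_add_im ξ, ← hu', ← hv']
      simp
  · rintro ⟨η, hη, rfl⟩
    have := mem_baseChange_iff.1 hη
    exact ⟨⟨_, this.1, (tensorRe_baseChange f η).symm⟩, ⟨_, this.2, (tensorIm_baseChange f η).symm⟩⟩

lemma mem_ker_baseChange_iff (f : V →ₗ[ℝ] W) (ξ : ℂ ⊗[ℝ] V) :
    ξ ∈ (LinearMap.ker f).baseChange ℂ ↔ f.baseChange ℂ ξ = 0 := by
  rw [mem_baseChange_iff, LinearMap.mem_ker, LinearMap.mem_ker]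
  constructor
  · rintro ⟨h₁, h₂⟩
    apply tensor_ext <;> simp [h₁, h₂]
  · intro h
    rw [← tensorRe_baseChange, ← tensorIm_baseChange, h]
    simp

/-- Semisimplicity of an endomorphism is preserved by complexification. -/
lemma isSemisimple_baseChange [FiniteDimensional ℝ V] {f : Module.End ℝ V}
    (hf : f.IsSemisimple) : Module.End.IsSemisimple (R := ℂ) (LinearMap.baseChange ℂ f) := by
  -- Squarefreeness may be lost under field extension, separability is not. The minimal polynomial
  -- therefore stays squarefree over ℂ, and it annihilates the complexified map.
  have hsep : (minpoly ℝ f).Separable :=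
    PerfectField.separable_iff_squarefree.2 hf.minpoly_squarefree
  have hsep' := (hsep.map (f := algebraMap ℝ ℂ)).squarefree
  apply Module.End.isSemisimple_of_squarefree_aeval_eq_zero hsep'
  rw [Polynomial.aeval_map_algebraMap]
  have := Polynomial.aeval_algHom_apply (Module.End.baseChangeHom ℝ ℂ V) f (minpoly ℝ f)
  rw [minpoly.aeval, map_zero] at this
  exact this

end Complexification

/-! ### The restricted root decomposition -/

/-- `θ` is an involutive endomorphism of the Lie algebra `L`. -/
structure IsLieInvolution {L : Type*} [LieRing L] [LieAlgebra ℝ L] (θ : L →ₗ[ℝ] L) : Prop where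
  lie : ∀ x y, θ ⁅x, y⁆ = ⁅θ x, θ y⁆
  invol : ∀ x, θ (θ x) = x

section RootDecomposition

variable {L : Type*} [LieRing L] [LieAlgebra ℝ L]

lemma tensor_lie_add (x y z : ℂ ⊗[ℝ] L) : ⁅x, y + z⁆ = ⁅x, y⁆ + ⁅x, z⁆ := lie_add x y z

lemma tensor_add_lie (x y z : ℂ ⊗[ℝ] L) : ⁅x + y, z⁆ = ⁅x, z⁆ + ⁅y, z⁆ := add_lie x y z

lemma tensor_lie_smul (c : ℂ) (x y : ℂ ⊗[ℝ] L) : ⁅x, c • y⁆ = c • ⁅x, y⁆ := lie_smul c x y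

lemma tensor_smul_lie (c : ℂ) (x y : ℂ ⊗[ℝ] L) : ⁅c • x, y⁆ = c • ⁅x, y⁆ := smul_lie c x y

lemma tensor_leibniz (x y z : ℂ ⊗[ℝ] L) : ⁅x, ⁅y, z⁆⁆ = ⁅⁅x, y⁆, z⁆ + ⁅y, ⁅x, z⁆⁆ :=
  leibniz_lie x y z

/-- The adjoint representation of `ℂ ⊗ L`. -/
def adC : ℂ ⊗[ℝ] L →ₗ[ℂ] Module.End ℂ (ℂ ⊗[ℝ] L) :=
  LinearMap.mk₂ ℂ (fun x y => ⁅x, y⁆) tensor_add_lie tensor_smul_lie tensor_lie_add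
    (fun c x y => tensor_lie_smul c x y)

lemma adC_apply (x y : ℂ ⊗[ℝ] L) : adC x y = ⁅x, y⁆ := rfl

lemma tensor_lie_zero (x : ℂ ⊗[ℝ] L) : ⁅x, (0 : ℂ ⊗[ℝ] L)⁆ = 0 := map_zero (adC x)

lemma tensor_zero_lie (x : ℂ ⊗[ℝ] L) : ⁅(0 : ℂ ⊗[ℝ] L), x⁆ = 0 := by
  rw [← adC_apply, map_zero, LinearMap.zero_apply]

lemma tensor_lie_neg (x y : ℂ ⊗[ℝ] L) : ⁅x, -y⁆ = -⁅x, y⁆ := map_neg (adC x) y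

lemma tensor_neg_lie (x y : ℂ ⊗[ℝ] L) : ⁅-x, y⁆ = -⁅x, y⁆ := by
  rw [← adC_apply, map_neg, LinearMap.neg_apply, adC_apply]

lemma tensor_lie_sub (x y z : ℂ ⊗[ℝ] L) : ⁅x, y - z⁆ = ⁅x, y⁆ - ⁅x, z⁆ := map_sub (adC x) y z

lemma one_tmul_lie (a : L) (ξ : ℂ ⊗[ℝ] L) :
    ⁅(1 : ℂ) ⊗ₜ[ℝ] a, ξ⁆ = (LieAlgebra.ad ℝ L a).baseChange ℂ ξ := by
  induction ξ with
  | zero => rw [tensor_lie_zero, map_zero]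
  | tmul z v => simp [LieAlgebra.ExtendScalars.bracket_tmul]
  | add x y hx hy => rw [tensor_lie_add, hx, hy, map_add]

lemma tensorRe_one_tmul_lie (a : L) (ξ : ℂ ⊗[ℝ] L) :
    tensorRe L ⁅(1 : ℂ) ⊗ₜ[ℝ] a, ξ⁆ = ⁅a, tensorRe L ξ⁆ := by
  rw [one_tmul_lie, tensorRe_baseChange, LieAlgebra.ad_apply]

lemma tensorIm_one_tmul_lie (a : L) (ξ : ℂ ⊗[ℝ] L) :
    tensorIm L ⁅(1 : ℂ) ⊗ₜ[ℝ] a, ξ⁆ = ⁅a, tensorIm L ξ⁆ := by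
  rw [one_tmul_lie, tensorIm_baseChange, LieAlgebra.ad_apply]

lemma baseChange_lie {θ : L →ₗ[ℝ] L} (hθ : ∀ x y, θ ⁅x, y⁆ = ⁅θ x, θ y⁆) (ξ η : ℂ ⊗[ℝ] L) :
    θ.baseChange ℂ ⁅ξ, η⁆ = ⁅θ.baseChange ℂ ξ, θ.baseChange ℂ η⁆ := by
  induction ξ with
  | zero => rw [tensor_zero_lie, map_zero, tensor_zero_lie]
  | add x y hx hy => rw [tensor_add_lie, map_add, hx, hy, map_add, tensor_add_lie]
  | tmul z v =>
    induction η with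
    | zero => rw [tensor_lie_zero, map_zero, tensor_lie_zero]
    | add x y hx hy => rw [tensor_lie_add, map_add, hx, hy, map_add, tensor_lie_add]
    | tmul z' v' => simp [LieAlgebra.ExtendScalars.bracket_tmul, hθ]

variable {θ : L →ₗ[ℝ] L} {𝔞 : Submodule ℝ L}

lemma mem_antiSub {x : L} : x ∈ LinearMap.ker (θ + LinearMap.id) ↔ θ x = -x := by
  rw [LinearMap.mem_ker, LinearMap.add_apply, LinearMap.id_apply, add_eq_zero_iff_eq_neg]

lemma mem_fixSub {x : L} : x ∈ LinearMap.ker (θ - LinearMap.id) ↔ θ x = x := by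
  rw [LinearMap.mem_ker, LinearMap.sub_apply, LinearMap.id_apply, sub_eq_zero]

lemma mem_antiSub_baseChange {ξ : ℂ ⊗[ℝ] L} :
    ξ ∈ (LinearMap.ker (θ + LinearMap.id)).baseChange ℂ ↔ θ.baseChange ℂ ξ = -ξ := by
  rw [mem_ker_baseChange_iff, LinearMap.baseChange_add, LinearMap.baseChange_id,
    LinearMap.add_apply, LinearMap.id_apply, add_eq_zero_iff_eq_neg]

lemma mem_fixSub_baseChange {ξ : ℂ ⊗[ℝ] L} :
    ξ ∈ (LinearMap.ker (θ - LinearMap.id)).baseChange ℂ ↔ θ.baseChange ℂ ξ = ξ := by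
  rw [mem_ker_baseChange_iff, LinearMap.baseChange_sub, LinearMap.baseChange_id,
    LinearMap.sub_apply, LinearMap.id_apply, sub_eq_zero]

lemma IsLieInvolution.baseChange_invol (hθ : IsLieInvolution θ) (ξ : ℂ ⊗[ℝ] L) :
    θ.baseChange ℂ (θ.baseChange ℂ ξ) = ξ := by
  apply tensor_ext <;> simp [hθ.invol]

/-- A semisimple endomorphism has no generalized eigenvectors beyond its eigenvectors, here for the
eigenvalue 0. -/
lemma lie_eq_zero_of_semisimple [FiniteDimensional ℝ L] {a x : L}
    (ha : (LieAlgebra.ad ℝ L a).IsSemisimple) (hx : ⁅a, ⁅a, x⁆⁆ = 0) : ⁅a, x⁆ = 0 := by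
  have h1 : x ∈ (LieAlgebra.ad ℝ L a).genEigenspace 0 2 := by
    rw [show (2 : ℕ∞) = ((2 : ℕ) : ℕ∞) from rfl, Module.End.mem_genEigenspace_nat]
    simp [pow_two, hx]
  rw [ha.isFinitelySemisimple.genEigenspace_eq_eigenspace 0 (by norm_num)] at h1
  simpa [Module.End.mem_eigenspace_iff] using h1

lemma one_tmul_lie_eq_zero_of_semisimple [FiniteDimensional ℝ L] {a : L} {ξ : ℂ ⊗[ℝ] L}
    (ha : (LieAlgebra.ad ℝ L a).IsSemisimple)
    (hx : ⁅(1 : ℂ) ⊗ₜ[ℝ] a, ⁅(1 : ℂ) ⊗ₜ[ℝ] a, ξ⁆⁆ = 0) : ⁅(1 : ℂ) ⊗ₜ[ℝ] a, ξ⁆ = 0 := by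
  apply tensor_ext
  · rw [tensorRe_one_tmul_lie, map_zero]
    apply lie_eq_zero_of_semisimple ha
    rw [← tensorRe_one_tmul_lie, ← tensorRe_one_tmul_lie, hx, map_zero]
  · rw [tensorIm_one_tmul_lie, map_zero]
    apply lie_eq_zero_of_semisimple ha
    rw [← tensorIm_one_tmul_lie, ← tensorIm_one_tmul_lie, hx, map_zero]

/-- A real vector of `𝔞` as an element of `𝔞ᶜ`. -/
def toC (a : 𝔞) : 𝔞.baseChange ℂ :=
  ⟨(1 : ℂ) ⊗ₜ[ℝ] (a : L), Submodule.tmul_mem_baseChange_of_mem 1 a.2⟩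

lemma realEval_eq (α : Module.Dual ℂ (𝔞.baseChange ℂ)) (a : 𝔞) : realEval α a = α (toC a) := rfl

lemma exists_toC (a : 𝔞.baseChange ℂ) : ∃ u v : 𝔞, a = toC u + Complex.I • toC v := by
  obtain ⟨h₁, h₂⟩ := mem_baseChange_iff.1 a.2
  refine ⟨⟨_, h₁⟩, ⟨_, h₂⟩, Subtype.ext ?_⟩
  conv_lhs => rw [eq_re_add_im (a : ℂ ⊗[ℝ] L)]
  simp [toC, TensorProduct.smul_tmul']

lemma toC_add_smul (a b : 𝔞) (t : ℝ) : toC (a + t • b) = toC a + (t : ℂ) • toC b := by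
  apply Subtype.ext
  apply tensor_ext <;> simp [toC, TensorProduct.smul_tmul']

lemma realEval_add_smul (α : Module.Dual ℂ (𝔞.baseChange ℂ)) (a b : 𝔞) (t : ℝ) :
    realEval α (a + t • b) = realEval α a + t * realEval α b := by
  simp only [realEval_eq, toC_add_smul, map_add, map_smul, smul_eq_mul]

lemma realEval_zero (α : Module.Dual ℂ (𝔞.baseChange ℂ)) : realEval α 0 = 0 := by
  have := realEval_add_smul α 0 0 1
  simpa using this

lemma dual_ext {α β : Module.Dual ℂ (𝔞.baseChange ℂ)}
    (h : ∀ a : 𝔞, realEval α a = realEval β a) : α = β := by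
  ext a
  obtain ⟨u, v, rfl⟩ := exists_toC a
  simp only [map_add, map_smul, ← realEval_eq, h]

variable {𝔮 : Submodule ℝ L}

lemma rootSpace_le (α : Module.Dual ℂ (𝔞.baseChange ℂ)) :
    rootSpace 𝔮 𝔞 α ≤ 𝔮.baseChange ℂ := fun _ h => h.1

lemma rootSpace_neg (α : Module.Dual ℂ (𝔞.baseChange ℂ)) :
    rootSpace 𝔮 𝔞 (-α) = rootSpace 𝔮 𝔞 α := by
  ext X
  show _ ∧ _ ↔ _ ∧ _
  simp

lemma lie_lie_of_mem_rootSpace {α : Module.Dual ℂ (𝔞.baseChange ℂ)} {X : ℂ ⊗[ℝ] L}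
    (hX : X ∈ rootSpace 𝔮 𝔞 α) (a : 𝔞) :
    ⁅(1 : ℂ) ⊗ₜ[ℝ] (a : L), ⁅(1 : ℂ) ⊗ₜ[ℝ] (a : L), X⁆⁆ = (realEval α a) ^ 2 • X :=
  hX.2 (toC a)

lemma IsCartanSubspace.lie_eq_zero (h𝔞 : IsCartanSubspace 𝔮 𝔞) (a b : 𝔞.baseChange ℂ) :
    ⁅(a : ℂ ⊗[ℝ] L), (b : ℂ ⊗[ℝ] L)⁆ = 0 := by
  obtain ⟨u, v, rfl⟩ := exists_toC a
  obtain ⟨u', v', rfl⟩ := exists_toC b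
  simp [toC, TensorProduct.smul_tmul', LieAlgebra.ExtendScalars.bracket_tmul,
    h𝔞.abelian _ u.2 _ u'.2, h𝔞.abelian _ u.2 _ v'.2, h𝔞.abelian _ v.2 _ u'.2,
    h𝔞.abelian _ v.2 _ v'.2]

lemma IsCartanSubspace.adC_commute (h𝔞 : IsCartanSubspace 𝔮 𝔞) (a b : 𝔞.baseChange ℂ) :
    Commute (adC (a : ℂ ⊗[ℝ] L)) (adC (b : ℂ ⊗[ℝ] L)) := by
  refine LinearMap.ext fun X => ?_
  show ⁅(a : ℂ ⊗[ℝ] L), ⁅(b : ℂ ⊗[ℝ] L), X⁆⁆ = ⁅(b : ℂ ⊗[ℝ] L), ⁅(a : ℂ ⊗[ℝ] L), X⁆⁆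
  rw [tensor_leibniz, h𝔞.lie_eq_zero, tensor_zero_lie, zero_add]

/-- An element of 𝔞ᶜ is u + iv with u, v ∈ 𝔞, and a sum of commuting semisimple endomorphisms over ℂ
is semisimple. -/
lemma IsCartanSubspace.adC_isSemisimple [FiniteDimensional ℝ L] (h𝔞 : IsCartanSubspace 𝔮 𝔞)
    (a : 𝔞.baseChange ℂ) : (adC (a : ℂ ⊗[ℝ] L)).IsSemisimple := by
  have key : ∀ u : 𝔞, (adC (toC u : ℂ ⊗[ℝ] L)).IsSemisimple := by
    intro u
    have := isSemisimple_baseChange (h𝔞.semisimple u u.2)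
    convert this using 1
    exact LinearMap.ext fun ξ => one_tmul_lie (u : L) ξ
  obtain ⟨u, v, rfl⟩ := exists_toC a
  have e : adC ((toC u + Complex.I • toC v : 𝔞.baseChange ℂ) : ℂ ⊗[ℝ] L)
      = adC (toC u : ℂ ⊗[ℝ] L) + Complex.I • adC (toC v : ℂ ⊗[ℝ] L) := by
    rw [Submodule.coe_add, Submodule.coe_smul, map_add, map_smul]
  rw [e]
  exact Module.End.IsSemisimple.add_of_commute ((h𝔞.adC_commute _ _).smul_right _) (key u)
    (Module.End.IsSemisimple_smul _ (key v))

lemma IsLieInvolution.map_one_tmul_of_mem (h𝔞 : IsCartanSubspace (LinearMap.ker (θ + LinearMap.id)) 𝔞)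
    (a : 𝔞.baseChange ℂ) : θ.baseChange ℂ (a : ℂ ⊗[ℝ] L) = -a :=
  mem_antiSub_baseChange.1 (baseChange_le_iff.2 h𝔞.le a.2)

/-- The complexified algebra is spanned by common eigenvectors of ad(𝔞ᶜ). If Y has weight χ then θY
has weight −χ, so the 𝔮-component of Y is an eigenvector of every ad(a)² with eigenvalue χ(a)². -/
lemma antiSub_baseChange_le_iSup_rootSpace [FiniteDimensional ℝ L] (hθ : IsLieInvolution θ)
    (h𝔞 : IsCartanSubspace (LinearMap.ker (θ + LinearMap.id)) 𝔞) :
    (LinearMap.ker (θ + LinearMap.id)).baseChange ℂ ≤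
      ⨆ α : Module.Dual ℂ (𝔞.baseChange ℂ),
        rootSpace (LinearMap.ker (θ + LinearMap.id)) 𝔞 α := by
  set f : 𝔞.baseChange ℂ → Module.End ℂ (ℂ ⊗[ℝ] L) := fun a => adC (a : ℂ ⊗[ℝ] L)
  have htop := Module.End.iSup_iInf_maxGenEigenspace_eq_top_of_iSup_maxGenEigenspace_eq_top_of_commute
    f (fun a b _ => h𝔞.adC_commute a b) (fun a => Module.End.iSup_maxGenEigenspace_eq_top (f a))
  set p : Module.End ℂ (ℂ ⊗[ℝ] L) := (1 / 2 : ℂ) • (LinearMap.id - θ.baseChange ℂ)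
  have hp : ∀ X, p X = (1 / 2 : ℂ) • (X - θ.baseChange ℂ X) := fun X => rfl
  intro X hX
  have hpX : p X = X := by
    rw [hp, mem_antiSub_baseChange.1 hX, sub_neg_eq_add, ← two_smul ℂ X, smul_smul]
    norm_num
  have hX' : p X ∈ (⊤ : Submodule ℂ (ℂ ⊗[ℝ] L)).map p := ⟨X, trivial, rfl⟩
  rw [hpX, ← htop, Submodule.map_iSup] at hX'
  refine SetLike.le_def.1 (iSup_le fun χ => ?_) hX'
  rintro _ ⟨Y, hY, rfl⟩
  have hY' : ∀ a : 𝔞.baseChange ℂ, ⁅(a : ℂ ⊗[ℝ] L), Y⁆ = χ a • Y := by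
    intro a
    have := (Submodule.mem_iInf _).1 hY a
    rw [(h𝔞.adC_isSemisimple a).isFinitelySemisimple.maxGenEigenspace_eq_eigenspace,
      Module.End.mem_eigenspace_iff] at this
    exact this
  -- Linearity of χ comes from comparing multiples of Y, which requires Y ≠ 0.
  by_cases hY0 : Y = 0
  · rw [hY0, map_zero]
    exact zero_mem _
  let α : Module.Dual ℂ (𝔞.baseChange ℂ) :=
    { toFun := χ
      map_add' := fun a b => smul_left_injective ℂ hY0 (by
        simp only [← hY', Submodule.coe_add, tensor_add_lie, add_smul])
      map_smul' := fun c a => smul_left_injective ℂ hY0 (by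
        simp only [← hY', Submodule.coe_smul, tensor_smul_lie, smul_eq_mul, mul_smul, RingHom.id_apply]) }
  refine Submodule.mem_iSup_of_mem α ⟨?_, fun a => ?_⟩
  · rw [mem_antiSub_baseChange, hp, map_smul, map_sub, hθ.baseChange_invol, ← smul_neg, neg_sub]
  · show _ = (χ a) ^ 2 • _
    have h1 : ⁅(a : ℂ ⊗[ℝ] L), ⁅(a : ℂ ⊗[ℝ] L), Y⁆⁆ = (χ a) ^ 2 • Y := by
      rw [hY', tensor_lie_smul, hY', smul_smul, sq]
    have h2 : ⁅(a : ℂ ⊗[ℝ] L), ⁅(a : ℂ ⊗[ℝ] L), θ.baseChange ℂ Y⁆⁆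
        = (χ a) ^ 2 • θ.baseChange ℂ Y := by
      rw [← map_smul, ← h1, baseChange_lie hθ.lie, baseChange_lie hθ.lie,
        IsLieInvolution.map_one_tmul_of_mem h𝔞,
        tensor_neg_lie, tensor_neg_lie, tensor_lie_neg, neg_neg]
    rw [hp, tensor_lie_smul, tensor_lie_smul, tensor_lie_sub, tensor_lie_sub, h1, h2, ← smul_sub, smul_comm]

/-- By semisimplicity ad(a)²X = 0 already gives [a,X] = 0, so the real and imaginary parts of X
centralize 𝔞 in 𝔮. Adjoining such a vector to 𝔞 leaves it abelian, hence by maximality the vector is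
in 𝔞. -/
lemma rootSpace_zero [FiniteDimensional ℝ L] (h𝔞 : IsCartanSubspace 𝔮 𝔞) :
    rootSpace 𝔮 𝔞 0 = 𝔞.baseChange ℂ := by
  have key : ∀ x ∈ 𝔮, (∀ a ∈ 𝔞, ⁅a, x⁆ = 0) → x ∈ 𝔞 := by
    intro x hx hax
    have := h𝔞.maximal (𝔞 ⊔ Submodule.span ℝ {x})
      (sup_le h𝔞.le (by simpa using hx)) (by
        intro y hy z hz
        obtain ⟨a, ha, y', hy', rfl⟩ := Submodule.mem_sup.1 hy
        obtain ⟨b, hb, z', hz', rfl⟩ := Submodule.mem_sup.1 hz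
        obtain ⟨s, rfl⟩ := Submodule.mem_span_singleton.1 hy'
        obtain ⟨t, rfl⟩ := Submodule.mem_span_singleton.1 hz'
        have h3 : ⁅x, b⁆ = 0 := by rw [← lie_skew, hax b hb, neg_zero]
        simp [h𝔞.abelian a ha b hb, hax a ha, h3]) le_sup_left
    rw [← this]
    exact Submodule.mem_sup_right (Submodule.mem_span_singleton_self x)
  apply le_antisymm
  · intro X hX
    have hX0 : ∀ a : 𝔞, ⁅(1 : ℂ) ⊗ₜ[ℝ] (a : L), X⁆ = 0 := by
      intro a
      apply one_tmul_lie_eq_zero_of_semisimple (h𝔞.semisimple a a.2)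
      rw [lie_lie_of_mem_rootSpace hX]
      simp [realEval]
    obtain ⟨h₁, h₂⟩ := mem_baseChange_iff.1 hX.1
    refine mem_baseChange_iff.2 ⟨key _ h₁ fun a ha => ?_, key _ h₂ fun a ha => ?_⟩
    · rw [← tensorRe_one_tmul_lie, hX0 ⟨a, ha⟩, map_zero]
    · rw [← tensorIm_one_tmul_lie, hX0 ⟨a, ha⟩, map_zero]
  · intro X hX
    refine ⟨baseChange_le_iff.2 h𝔞.le hX, fun a => ?_⟩
    rw [h𝔞.lie_eq_zero a ⟨X, hX⟩, tensor_lie_zero]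
    simp

variable {P : Set (Module.Dual ℂ (𝔞.baseChange ℂ))}

/-- The spaces of α and −α coincide because only α² enters, so one root of each pair is enough; α =
0 contributes 𝔞ᶜ. -/
lemma antiSub_baseChange_eq [FiniteDimensional ℝ L] (hθ : IsLieInvolution θ)
    (h𝔞 : IsCartanSubspace (LinearMap.ker (θ + LinearMap.id)) 𝔞)
    (hP : IsPositiveSystem (LinearMap.ker (θ + LinearMap.id)) 𝔞 P) :
    (LinearMap.ker (θ + LinearMap.id)).baseChange ℂ = 𝔞.baseChange ℂ ⊔
      ⨆ α ∈ P, rootSpace (LinearMap.ker (θ + LinearMap.id)) 𝔞 α := by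
  apply le_antisymm
  · refine (antiSub_baseChange_le_iSup_rootSpace hθ h𝔞).trans (iSup_le fun α => ?_)
    by_cases h0 : α = 0
    · rw [h0, rootSpace_zero h𝔞]
      exact le_sup_left
    by_cases hb : rootSpace (LinearMap.ker (θ + LinearMap.id)) 𝔞 α = ⊥
    · rw [hb]; exact bot_le
    refine le_trans ?_ le_sup_right
    rcases (hP.mem_roots_iff α).1 ⟨h0, hb⟩ with h | h
    · exact le_iSup₂_of_le α h le_rfl
    · exact le_iSup₂_of_le (-α) h (rootSpace_neg α).ge
  · exact sup_le (baseChange_le_iff.2 h𝔞.le) (iSup₂_le fun α _ => rootSpace_le α)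

lemma IsPositiveSystem.mem_roots (hP : IsPositiveSystem 𝔮 𝔞 P)
    {α : Module.Dual ℂ (𝔞.baseChange ℂ)} (hα : α ∈ P) : α ∈ roots 𝔮 𝔞 :=
  (hP.mem_roots_iff α).2 (Or.inl hα)

/-- Otherwise the kernels of α − β and α + β would be two proper subspaces covering the whole space;
the sum a + b of vectors outside each of them gives the contradiction. -/
lemma eq_or_eq_neg_of_sq_eq {E : Type*} [AddCommGroup E] [Module ℂ E] {α β : Module.Dual ℂ E}
    (h : ∀ a, α a ^ 2 = β a ^ 2) : α = β ∨ α = -β := by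
  by_contra! hne
  obtain ⟨a, ha⟩ : ∃ a, α a ≠ β a := by
    by_contra! h'; exact hne.1 (LinearMap.ext h')
  obtain ⟨b, hb⟩ : ∃ b, α b ≠ -β b := by
    by_contra! h'; exact hne.2 (LinearMap.ext h')
  have ha' : α a = -β a := (sq_eq_sq_iff_eq_or_eq_neg.1 (h a)).resolve_left ha
  have hb' : α b = β b := (sq_eq_sq_iff_eq_or_eq_neg.1 (h b)).resolve_right hb
  have hab := h (a + b)
  rw [map_add, map_add, ha', hb'] at hab
  have : β a * β b = 0 := by linear_combination -hab / 4
  rcases mul_eq_zero.1 this with h0 | h0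
  · exact ha (by rw [ha', h0, neg_zero])
  · exact hb (by rw [hb', h0, neg_zero])

/-- Root spaces lie in joint generalized eigenspaces of the operators ad(a)². These are independent,
so only finitely many are nonzero, and a positive root is determined by its square. -/
lemma IsPositiveSystem.finite [FiniteDimensional ℝ L] (h𝔞 : IsCartanSubspace 𝔮 𝔞)
    (hP : IsPositiveSystem 𝔮 𝔞 P) : P.Finite := by
  set f : 𝔞.baseChange ℂ → Module.End ℂ (ℂ ⊗[ℝ] L) :=
    fun a => adC (a : ℂ ⊗[ℝ] L) * adC (a : ℂ ⊗[ℝ] L)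
  have hcomm : ∀ a b, Commute (f a) (f b) := fun a b =>
    ((h𝔞.adC_commute a b).mul_left (h𝔞.adC_commute a b)).mul_right
      ((h𝔞.adC_commute a b).mul_left (h𝔞.adC_commute a b))
  have hind := Module.End.independent_iInf_maxGenEigenspace_of_forall_mapsTo f
    (fun i j φ => Module.End.mapsTo_maxGenEigenspace_of_comm (hcomm j i) φ)
  have hfin := WellFoundedGT.finite_ne_bot_of_iSupIndep hind
  have hinj : Set.InjOn (fun (α : Module.Dual ℂ (𝔞.baseChange ℂ)) (a : 𝔞.baseChange ℂ) =>
      α a ^ 2) P := by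
    intro α hα β hβ hαβ
    rcases eq_or_eq_neg_of_sq_eq (fun a => congrFun hαβ a) with h | h
    · exact h
    · exact absurd (h ▸ hα) (hP.neg_notMem β hβ)
  refine Set.Finite.of_finite_image (hfin.subset ?_) hinj
  rintro _ ⟨α, hα, rfl⟩
  have hne := (hP.mem_roots hα).2
  show _ ≠ ⊥
  refine fun hbot => hne (eq_bot_iff.2 (le_trans ?_ hbot.le))
  intro X hX
  refine (Submodule.mem_iInf _).2 fun a => ?_
  refine Module.End.mem_maxGenEigenspace _ _ _ |>.2 ⟨1, ?_⟩
  have h1 : f a X = α a ^ 2 • X := hX.2 a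
  rw [pow_one, LinearMap.sub_apply, h1]
  exact sub_self _

/-- There is a vector of `𝔞` on which none of the positive roots vanishes. -/
lemma IsPositiveSystem.exists_regular [FiniteDimensional ℝ L] (h𝔞 : IsCartanSubspace 𝔮 𝔞)
    (hP : IsPositiveSystem 𝔮 𝔞 P) : ∃ a : 𝔞, ∀ β ∈ P, realEval β a ≠ 0 := by
  have hfin := hP.finite h𝔞
  have := hfin.to_subtype
  let p : P → Submodule ℝ 𝔞 := fun β =>
    { carrier := {a | realEval β.1 a = 0}
      add_mem' := fun {a b} ha hb => by
        have := realEval_add_smul β.1 a b 1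
        rw [one_smul] at this
        simp only [Set.mem_ofPred_eq] at ha hb ⊢
        rw [this, ha, hb]; simp
      zero_mem' := realEval_zero _
      smul_mem' := fun c a ha => by
        have := realEval_add_smul β.1 0 a c
        rw [zero_add] at this
        simp only [Set.mem_ofPred_eq] at ha ⊢
        rw [this, ha]; simp [realEval_zero] }
  -- Finitely many proper real subspaces do not cover 𝔞. The zero set of β in 𝔞 is proper because β
  -- is determined by its values on real vectors.
  obtain ⟨a, ha⟩ := Submodule.exists_forall_notMem_of_forall_ne_top p (by
    intro β htop
    apply (hP.mem_roots β.2).1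
    apply dual_ext
    intro a
    have : a ∈ p β := htop ▸ trivial
    exact this)
  exact ⟨a, fun β hβ => ha ⟨β, hβ⟩⟩

end RootDecomposition

/-! ### The tangent and normal spaces in terms of roots -/

section Algebra

variable {L : Type*} [LieRing L] [LieAlgebra ℝ L]

/-- The complex bilinear extension of the Killing form. -/
def killC (L : Type*) [LieRing L] [LieAlgebra ℝ L] : LinearMap.BilinForm ℂ (ℂ ⊗[ℝ] L) :=
  LinearMap.BilinForm.baseChange ℂ (killingForm ℝ L)

lemma killC_tmul (z z' : ℂ) (x y : L) :
    killC L (z ⊗ₜ x) (z' ⊗ₜ y) = z * z' * (killingForm ℝ L x y : ℝ) := by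
  simp [killC, LinearMap.BilinForm.baseChange_tmul]
  ring

lemma killC_adjoint {f g : L →ₗ[ℝ] L}
    (h : ∀ x y, killingForm ℝ L (f x) y = killingForm ℝ L x (g y)) (ξ η : ℂ ⊗[ℝ] L) :
    killC L (f.baseChange ℂ ξ) η = killC L ξ (g.baseChange ℂ η) := by
  induction ξ with
  | zero => simp
  | add x y hx hy => rw [map_add, map_add, map_add, LinearMap.add_apply, LinearMap.add_apply, hx, hy]
  | tmul z v =>
    induction η with
    | zero => simp
    | add x y hx hy => rw [map_add, map_add, map_add, hx, hy]
    | tmul z' v' => simp [killC_tmul, h]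

lemma killingForm_comm (x y : L) : killingForm ℝ L x y = killingForm ℝ L y x :=
  LieModule.traceForm_comm ℝ L L x y

lemma killingForm_lie (a x y : L) : killingForm ℝ L ⁅a, x⁆ y = -killingForm ℝ L x ⁅a, y⁆ := by
  rw [← lie_skew a x, map_neg, LinearMap.neg_apply]
  congr 1
  exact LieModule.traceForm_apply_lie_apply ℝ L L x a y

lemma killC_comm (ξ η : ℂ ⊗[ℝ] L) : killC L ξ η = killC L η ξ := by
  induction ξ with
  | zero => simp
  | add x y hx hy => rw [map_add, LinearMap.add_apply, hx, hy, map_add]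
  | tmul z v =>
    induction η with
    | zero => simp
    | add x y hx hy => rw [map_add, hx, hy, map_add, LinearMap.add_apply]
    | tmul z' v' => rw [killC_tmul, killC_tmul, killingForm_comm]; ring

lemma killC_lie (a : L) (ξ η : ℂ ⊗[ℝ] L) :
    killC L ⁅(1 : ℂ) ⊗ₜ[ℝ] a, ξ⁆ η = -killC L ξ ⁅(1 : ℂ) ⊗ₜ[ℝ] a, η⁆ := by
  rw [one_tmul_lie, one_tmul_lie, killC_adjoint (g := -LieAlgebra.ad ℝ L a)
    (fun x y => by rw [LinearMap.neg_apply, map_neg]; exact killingForm_lie a x y), LinearMap.baseChange_neg, LinearMap.neg_apply, map_neg]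

lemma killC_one_tmul (ξ : ℂ ⊗[ℝ] L) (y : L) :
    killC L ξ ((1 : ℂ) ⊗ₜ y) = (killingForm ℝ L (tensorRe L ξ) y : ℝ)
      + Complex.I * (killingForm ℝ L (tensorIm L ξ) y : ℝ) := by
  conv_lhs => rw [eq_re_add_im ξ]
  rw [map_add, LinearMap.add_apply, killC_tmul, killC_tmul]
  ring

lemma killC_one_tmul_eq_zero_iff (ξ : ℂ ⊗[ℝ] L) (y : L) :
    killC L ξ ((1 : ℂ) ⊗ₜ y) = 0 ↔
      killingForm ℝ L (tensorRe L ξ) y = 0 ∧ killingForm ℝ L (tensorIm L ξ) y = 0 := by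
  rw [killC_one_tmul, Complex.ext_iff]
  simp

lemma killingForm_eq_zero [FiniteDimensional ℝ L] [LieAlgebra.IsKilling ℝ L] {x : L}
    (h : ∀ y, killingForm ℝ L x y = 0) : x = 0 :=
  (LieAlgebra.IsKilling.killingForm_nondegenerate ℝ L).1 x h

/-- The projection onto the `(-1)`-eigenspace of `θ`. -/
def antiPart (θ : L →ₗ[ℝ] L) : L →ₗ[ℝ] L := (1 / 2 : ℝ) • (LinearMap.id - θ)

/-- The projection onto the `(+1)`-eigenspace of `θ`. -/
def fixPart (θ : L →ₗ[ℝ] L) : L →ₗ[ℝ] L := (1 / 2 : ℝ) • (LinearMap.id + θ)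

lemma antiPart_apply (θ : L →ₗ[ℝ] L) (x : L) : antiPart θ x = (1 / 2 : ℝ) • (x - θ x) := rfl

lemma fixPart_apply (θ : L →ₗ[ℝ] L) (x : L) : fixPart θ x = (1 / 2 : ℝ) • (x + θ x) := rfl

lemma antiPart_baseChange_apply (θ : L →ₗ[ℝ] L) (ξ : ℂ ⊗[ℝ] L) :
    (antiPart θ).baseChange ℂ ξ = (1 / 2 : ℂ) • (ξ - θ.baseChange ℂ ξ) := by
  rw [antiPart, LinearMap.baseChange_smul, LinearMap.baseChange_sub, LinearMap.baseChange_id,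
    LinearMap.smul_apply, LinearMap.sub_apply, LinearMap.id_apply]
  rw [← algebraMap_smul ℂ (1 / 2 : ℝ)]
  simp

variable {θ : L →ₗ[ℝ] L}

lemma fixPart_add_antiPart (θ : L →ₗ[ℝ] L) (x : L) : fixPart θ x + antiPart θ x = x := by
  rw [fixPart_apply, antiPart_apply, ← smul_add, add_add_sub_cancel, ← two_smul ℝ x, smul_smul]
  norm_num

lemma IsLieInvolution.antiPart_mem (hθ : IsLieInvolution θ) (x : L) :
    antiPart θ x ∈ LinearMap.ker (θ + LinearMap.id) := by
  rw [mem_antiSub, antiPart_apply, map_smul, map_sub, hθ.invol, ← smul_neg, neg_sub]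

lemma IsLieInvolution.fixPart_mem (hθ : IsLieInvolution θ) (x : L) :
    fixPart θ x ∈ LinearMap.ker (θ - LinearMap.id) := by
  rw [mem_fixSub, fixPart_apply, map_smul, map_add, hθ.invol, add_comm]

lemma antiPart_of_mem {x : L} (hx : x ∈ LinearMap.ker (θ + LinearMap.id)) : antiPart θ x = x := by
  rw [antiPart_apply, mem_antiSub.1 hx, sub_neg_eq_add, ← two_smul ℝ x, smul_smul]
  norm_num

lemma antiPart_of_mem_fix {x : L} (hx : x ∈ LinearMap.ker (θ - LinearMap.id)) :
    antiPart θ x = 0 := by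
  rw [antiPart_apply, mem_fixSub.1 hx, sub_self, smul_zero]

lemma antiPart_eq_zero_iff {x : L} :
    antiPart θ x = 0 ↔ x ∈ LinearMap.ker (θ - LinearMap.id) := by
  rw [mem_fixSub, antiPart_apply, smul_eq_zero_iff_right (by norm_num), sub_eq_zero, eq_comm]

/-- `U` acts on the eigenvectors of `ad w` as the exponential of `ad w` does. -/
def ActsAsExp (w : L) (U : L →ₗ[ℝ] L) : Prop :=
  ∀ (X : ℂ ⊗[ℝ] L) (μ : ℂ), ⁅(1 : ℂ) ⊗ₜ[ℝ] w, X⁆ = μ • X →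
    U.baseChange ℂ X = Complex.exp μ • X

lemma ActsAsExp.apply_of_lie_eq_zero {w : L} {U : L →ₗ[ℝ] L} (hU : ActsAsExp w U)
    {X : ℂ ⊗[ℝ] L} (hX : ⁅(1 : ℂ) ⊗ₜ[ℝ] w, X⁆ = 0) : U.baseChange ℂ X = X := by
  simpa using hU X 0 (by rw [hX, zero_smul])

/-- X is the sum of ½(X ± μ⁻¹[w,X]), which are eigenvectors of ad(w) with eigenvalues ±μ. Collecting
exp(±μ) gives cosh and sinh. -/
lemma ActsAsExp.apply {w : L} {U : L →ₗ[ℝ] L} (hU : ActsAsExp w U) {X : ℂ ⊗[ℝ] L} {μ : ℂ}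
    (hμ : μ ≠ 0) (hX : ⁅(1 : ℂ) ⊗ₜ[ℝ] w, ⁅(1 : ℂ) ⊗ₜ[ℝ] w, X⁆⁆ = μ ^ 2 • X) :
    U.baseChange ℂ X = Complex.cosh μ • X + (Complex.sinh μ / μ) • ⁅(1 : ℂ) ⊗ₜ[ℝ] w, X⁆ := by
  set Y := ⁅(1 : ℂ) ⊗ₜ[ℝ] w, X⁆ with hY
  have h1 := hU ((1 / 2 : ℂ) • (X + μ⁻¹ • Y)) μ (by
    rw [tensor_lie_smul, tensor_lie_add, tensor_lie_smul, hX, ← hY]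
    match_scalars <;> field_simp)
  have h2 := hU ((1 / 2 : ℂ) • (X - μ⁻¹ • Y)) (-μ) (by
    rw [tensor_lie_smul, tensor_lie_sub, tensor_lie_smul, hX, ← hY]
    match_scalars <;> field_simp)
  have h3 : X = (1 / 2 : ℂ) • (X + μ⁻¹ • Y) + (1 / 2 : ℂ) • (X - μ⁻¹ • Y) := by
    module
  conv_lhs => rw [h3, map_add, h1, h2]
  rw [Complex.cosh, Complex.sinh]
  module

lemma ActsAsExp.apply_neg {w : L} {U : L →ₗ[ℝ] L} (hU : ActsAsExp (-w) U) {X : ℂ ⊗[ℝ] L} {μ : ℂ}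
    (hμ : μ ≠ 0) (hX : ⁅(1 : ℂ) ⊗ₜ[ℝ] w, ⁅(1 : ℂ) ⊗ₜ[ℝ] w, X⁆⁆ = μ ^ 2 • X) :
    U.baseChange ℂ X = Complex.cosh μ • X - (Complex.sinh μ / μ) • ⁅(1 : ℂ) ⊗ₜ[ℝ] w, X⁆ := by
  rw [hU.apply hμ (by rw [TensorProduct.tmul_neg, tensor_neg_lie, tensor_neg_lie, tensor_lie_neg,
    neg_neg, hX]), TensorProduct.tmul_neg, tensor_neg_lie, smul_neg, sub_eq_add_neg]

/-- The compatibility of `U = Ad(exp(-w))`, `U' = Ad(exp w)` with the involution `θ` and the Killing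
form. -/
structure IsExpPair (θ : L →ₗ[ℝ] L) (w : L) (U U' : L →ₗ[ℝ] L) : Prop where
  killing_invol : ∀ x y, killingForm ℝ L (θ x) y = killingForm ℝ L x (θ y)
  killing_adjoint : ∀ x y, killingForm ℝ L (U x) y = killingForm ℝ L x (U' y)
  act : ActsAsExp (-w) U
  act' : ActsAsExp w U'

/-- `g_*⁻¹ T_x M`, for `U = Ad(g⁻¹)`. -/
def tangentPart (θ U : L →ₗ[ℝ] L) : Submodule ℝ L :=
  (LinearMap.ker (θ - LinearMap.id)).map (antiPart θ ∘ₗ U)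

/-- The part of the `(-1)`-eigenspace of `θ` that is orthogonal to `T`. -/
def normalPart (θ : L →ₗ[ℝ] L) (T : Submodule ℝ L) : Submodule ℝ L :=
  LinearMap.ker (θ + LinearMap.id) ⊓ (killingForm ℝ L).orthogonal T

lemma mem_normalPart {T : Submodule ℝ L} {y : L} : y ∈ normalPart θ T ↔
    y ∈ LinearMap.ker (θ + LinearMap.id) ∧ ∀ x ∈ T, killingForm ℝ L y x = 0 := by
  rw [normalPart, Submodule.mem_inf]
  refine and_congr_right fun _ => forall₂_congr fun x _ => ?_
  rw [killingForm_comm]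

/-- The two eigenspaces of a self-adjoint involution are orthogonal. -/
lemma killC_fix_anti {ξ η : ℂ ⊗[ℝ] L}
    (h : ∀ x y, killingForm ℝ L (θ x) y = killingForm ℝ L x (θ y))
    (hξ : θ.baseChange ℂ ξ = ξ) (hη : θ.baseChange ℂ η = -η) : killC L ξ η = 0 := by
  have := killC_adjoint h ξ η
  rw [hξ, hη, map_neg] at this
  exact CharZero.eq_neg_self_iff.1 this

/-- An element of the complexified `(-1)`-eigenspace that is orthogonal to it vanishes. -/
lemma eq_zero_of_killC_anti [FiniteDimensional ℝ L] [LieAlgebra.IsKilling ℝ L]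
    (hθ : IsLieInvolution θ) (h : ∀ x y, killingForm ℝ L (θ x) y = killingForm ℝ L x (θ y))
    {ξ : ℂ ⊗[ℝ] L} (hξ : θ.baseChange ℂ ξ = -ξ)
    (h0 : ∀ η ∈ (LinearMap.ker (θ + LinearMap.id)).baseChange ℂ, killC L ξ η = 0) : ξ = 0 := by
  have key : ∀ y, killC L ξ ((1 : ℂ) ⊗ₜ y) = 0 := by
    intro y
    -- The 𝔥-component of y is orthogonal to ξ anyway, so orthogonality to 𝔮ᶜ means orthogonality to
    -- everything.
    rw [← fixPart_add_antiPart θ y, TensorProduct.tmul_add, map_add,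
      h0 _ (one_tmul_mem_baseChange.2 (hθ.antiPart_mem y)), add_zero, killC_comm]
    refine killC_fix_anti h ?_ hξ
    exact mem_fixSub_baseChange.1 (one_tmul_mem_baseChange.2 (hθ.fixPart_mem y))
  apply tensor_ext
  · rw [map_zero]
    exact killingForm_eq_zero fun y => ((killC_one_tmul_eq_zero_iff ξ y).1 (key y)).1
  · rw [map_zero]
    exact killingForm_eq_zero fun y => ((killC_one_tmul_eq_zero_iff ξ y).1 (key y)).2

variable {𝔞 : Submodule ℝ L} {P : Set (Module.Dual ℂ (𝔞.baseChange ℂ))}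
  {w : 𝔞} {U U' : L →ₗ[ℝ] L}

lemma sinh_eq_zero_iff {z : ℂ} : Complex.sinh z = 0 ↔ ∃ k : ℤ, z = Complex.I * Real.pi * k := by
  have h1 : Complex.sinh z = 0 ↔ Complex.sin (z * Complex.I) = 0 := by
    rw [Complex.sin_mul_I]
    simp
  rw [h1, Complex.sin_eq_zero_iff]
  constructor
  · rintro ⟨k, hk⟩
    refine ⟨-k, ?_⟩
    push_cast
    linear_combination (-Complex.I) * hk + z * Complex.I_mul_I
  · rintro ⟨k, rfl⟩
    refine ⟨-k, ?_⟩
    push_cast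
    linear_combination Real.pi * k * Complex.I_mul_I

lemma isSingularAt_iff {α : Module.Dual ℂ (𝔞.baseChange ℂ)} :
    IsSingularAt w α ↔ Complex.sinh (realEval α w) = 0 := sinh_eq_zero_iff.symm

lemma ne_zero_of_not_singular {α : Module.Dual ℂ (𝔞.baseChange ℂ)} (h : ¬ IsSingularAt w α) :
    realEval α w ≠ 0 := by
  intro h0
  exact h (isSingularAt_iff.2 (by rw [h0, Complex.sinh_zero]))

lemma invol_lie_of_anti (hθ : IsLieInvolution θ) {a : L} (ha : θ a = -a) (ξ : ℂ ⊗[ℝ] L) :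
    θ.baseChange ℂ ⁅(1 : ℂ) ⊗ₜ[ℝ] a, ξ⁆ = -⁅(1 : ℂ) ⊗ₜ[ℝ] a, θ.baseChange ℂ ξ⁆ := by
  rw [baseChange_lie hθ.lie, LinearMap.baseChange_tmul, ha, TensorProduct.tmul_neg, tensor_neg_lie]

lemma IsCartanSubspace.map_eq_neg
    (h𝔞 : IsCartanSubspace (LinearMap.ker (θ + LinearMap.id)) 𝔞) (a : 𝔞) : θ a = -(a : L) :=
  mem_antiSub.1 (h𝔞.le a.2)

/-- Taking adjoints, the pairing becomes B(E, U'X) with E ∈ 𝔥ᶜ. Here U' fixes 𝔞ᶜ and multiplies a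
singular root vector by cosh α(w), the sinh term being zero; so U'X stays in 𝔮ᶜ, orthogonal to 𝔥ᶜ.
-/
lemma IsExpPair.orth_singular [FiniteDimensional ℝ L]
    (h𝔞 : IsCartanSubspace (LinearMap.ker (θ + LinearMap.id)) 𝔞) (hU : IsExpPair θ w U U')
    {X ξ : ℂ ⊗[ℝ] L}
    (hX : X ∈ 𝔞.baseChange ℂ ⊔ ⨆ α ∈ {α ∈ P | IsSingularAt w α},
      rootSpace (LinearMap.ker (θ + LinearMap.id)) 𝔞 α)
    (hξ : ξ ∈ (tangentPart θ U).baseChange ℂ) : killC L ξ X = 0 := by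
  rw [tangentPart, map_baseChange] at hξ
  obtain ⟨E, hE, rfl⟩ := hξ
  have hE' := mem_fixSub_baseChange.1 hE
  suffices h : 𝔞.baseChange ℂ ⊔ (⨆ α ∈ {α ∈ P | IsSingularAt w α},
      rootSpace (LinearMap.ker (θ + LinearMap.id)) 𝔞 α) ≤
      LinearMap.ker (killC L (LinearMap.baseChange ℂ (antiPart θ ∘ₗ U) E)) from h hX
  have key : ∀ X, θ.baseChange ℂ X = -X → killC L E (U'.baseChange ℂ X) = 0 →
      killC L (LinearMap.baseChange ℂ (antiPart θ ∘ₗ U) E) X = 0 := by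
    intro X hX h0
    have hpart : (antiPart θ).baseChange ℂ X = X := by
      rw [antiPart_baseChange_apply, hX, sub_neg_eq_add, ← two_smul ℂ X, smul_smul]
      norm_num
    have hadj : ∀ x y, killingForm ℝ L (antiPart θ x) y = killingForm ℝ L x (antiPart θ y) := by
      intro x y
      simp [antiPart_apply, hU.killing_invol]
    rw [LinearMap.baseChange_comp, LinearMap.comp_apply, killC_adjoint hadj, hpart,
      killC_adjoint hU.killing_adjoint, h0]
  refine sup_le ?_ (iSup₂_le fun α hα => ?_)
  · intro X hX
    have hX' := mem_antiSub_baseChange.1 (baseChange_le_iff.2 h𝔞.le hX)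
    refine key X hX' ?_
    rw [hU.act'.apply_of_lie_eq_zero (h𝔞.lie_eq_zero (toC w) ⟨X, hX⟩)]
    exact killC_fix_anti hU.killing_invol hE' hX'
  · intro X hX
    have hX' := mem_antiSub_baseChange.1 hX.1
    refine key X hX' ?_
    -- The cosh/sinh formula divides by α(w). When α(w) = 0, semisimplicity gives [w,X] = 0, so U'
    -- fixes X.
    by_cases h0 : realEval α w = 0
    · rw [hU.act'.apply_of_lie_eq_zero]
      · exact killC_fix_anti hU.killing_invol hE' hX'
      · apply one_tmul_lie_eq_zero_of_semisimple (h𝔞.semisimple w w.2)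
        rw [lie_lie_of_mem_rootSpace hX, h0]
        simp
    · rw [hU.act'.apply h0 (lie_lie_of_mem_rootSpace hX w), isSingularAt_iff.1 hα.2, zero_div,
        zero_smul, add_zero, map_smul, killC_fix_anti hU.killing_invol hE' hX', smul_zero]

/-- With E = [w,X] ∈ 𝔥ᶜ and μ = α(w) one has UE = cosh μ · E − μ sinh μ · X. Its 𝔮-component is a
multiple of X that is nonzero exactly because α is not singular at w. -/
lemma IsExpPair.rootSpace_le_tangentPart (hθ : IsLieInvolution θ)
    (h𝔞 : IsCartanSubspace (LinearMap.ker (θ + LinearMap.id)) 𝔞) (hU : IsExpPair θ w U U')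
    {α : Module.Dual ℂ (𝔞.baseChange ℂ)} (hα : ¬ IsSingularAt w α) :
    rootSpace (LinearMap.ker (θ + LinearMap.id)) 𝔞 α ≤ (tangentPart θ U).baseChange ℂ := by
  intro X hX
  have h0 := ne_zero_of_not_singular hα
  rw [isSingularAt_iff] at hα
  have hX' := mem_antiSub_baseChange.1 hX.1
  set μ := realEval α w
  set E := ⁅(1 : ℂ) ⊗ₜ[ℝ] (w : L), X⁆ with hE
  have hθE : θ.baseChange ℂ E = E := by
    rw [hE, invol_lie_of_anti hθ (h𝔞.map_eq_neg w), hX', tensor_lie_neg, neg_neg]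
  have hwE : ⁅(1 : ℂ) ⊗ₜ[ℝ] (w : L), E⁆ = μ ^ 2 • X := lie_lie_of_mem_rootSpace hX w
  rw [tangentPart, map_baseChange]
  refine ⟨(-(μ * Complex.sinh μ))⁻¹ • E,
    Submodule.smul_mem _ _ (mem_fixSub_baseChange.2 hθE), ?_⟩
  rw [map_smul, LinearMap.baseChange_comp, LinearMap.comp_apply,
    hU.act.apply_neg h0 (by rw [hwE, tensor_lie_smul]), hwE, antiPart_baseChange_apply,
    map_sub, map_smul, map_smul, map_smul, hθE, hX', smul_sub, smul_neg, smul_neg]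
  match_scalars
  · ring
  · field_simp
    ring

/-- The positive root spaces split into those singular and those nonsingular at `w`. -/
lemma antiSub_baseChange_split [FiniteDimensional ℝ L] (hθ : IsLieInvolution θ)
    (h𝔞 : IsCartanSubspace (LinearMap.ker (θ + LinearMap.id)) 𝔞)
    (hP : IsPositiveSystem (LinearMap.ker (θ + LinearMap.id)) 𝔞 P) (w : 𝔞) :
    (LinearMap.ker (θ + LinearMap.id)).baseChange ℂ =
      (⨆ α ∈ {α ∈ P | ¬ IsSingularAt w α}, rootSpace (LinearMap.ker (θ + LinearMap.id)) 𝔞 α) ⊔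
      (𝔞.baseChange ℂ ⊔ ⨆ α ∈ {α ∈ P | IsSingularAt w α},
        rootSpace (LinearMap.ker (θ + LinearMap.id)) 𝔞 α) := by
  apply le_antisymm
  · rw [antiSub_baseChange_eq hθ h𝔞 hP]
    refine sup_le (le_sup_of_le_right le_sup_left) (iSup₂_le fun α hα => ?_)
    by_cases h : IsSingularAt w α
    · exact le_sup_of_le_right (le_sup_of_le_right (le_iSup₂_of_le α ⟨hα, h⟩ le_rfl))
    · exact le_sup_of_le_left (le_iSup₂_of_le α ⟨hα, h⟩ le_rfl)
  · exact sup_le (iSup₂_le fun α _ => rootSpace_le α)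
      (sup_le (baseChange_le_iff.2 h𝔞.le) (iSup₂_le fun α _ => rootSpace_le α))

lemma tangentPart_le (hθ : IsLieInvolution θ) :
    tangentPart θ U ≤ LinearMap.ker (θ + LinearMap.id) := by
  rintro _ ⟨x, _, rfl⟩
  exact hθ.antiPart_mem _

lemma killC_eq_zero_of_mem_normalPart {T : Submodule ℝ L} {Y ξ : ℂ ⊗[ℝ] L}
    (hY : Y ∈ (normalPart θ T).baseChange ℂ) (hξ : ξ ∈ T.baseChange ℂ) : killC L Y ξ = 0 := by
  have hY' := mem_baseChange_iff.1 hY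
  have hξ' := mem_baseChange_iff.1 hξ
  have key : ∀ x ∈ T, killC L Y ((1 : ℂ) ⊗ₜ x) = 0 := fun x hx =>
    (killC_one_tmul_eq_zero_iff Y x).2
      ⟨(mem_normalPart.1 hY'.1).2 x hx, (mem_normalPart.1 hY'.2).2 x hx⟩
  rw [eq_re_add_im ξ, show Complex.I ⊗ₜ[ℝ] tensorIm L ξ = Complex.I • ((1 : ℂ) ⊗ₜ[ℝ] tensorIm L ξ)
    by simp [TensorProduct.smul_tmul'], map_add, map_smul, key _ hξ'.1, key _ hξ'.2]
  simp

/-- Subtract from a tangent vector its nonsingular part. The remainder is tangent, hence orthogonal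
to the singular part of 𝔮ᶜ; it also lies in that part, hence is orthogonal to the nonsingular root
spaces, which are tangent. So it is orthogonal to 𝔮ᶜ and vanishes. -/
theorem IsExpPair.tangentPart_baseChange [FiniteDimensional ℝ L] [LieAlgebra.IsKilling ℝ L]
    (hθ : IsLieInvolution θ)
    (h𝔞 : IsCartanSubspace (LinearMap.ker (θ + LinearMap.id)) 𝔞)
    (hP : IsPositiveSystem (LinearMap.ker (θ + LinearMap.id)) 𝔞 P) (hU : IsExpPair θ w U U') :
    (tangentPart θ U).baseChange ℂ = ⨆ α ∈ {α ∈ P | ¬ IsSingularAt w α},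
      rootSpace (LinearMap.ker (θ + LinearMap.id)) 𝔞 α := by
  have hge : (⨆ α ∈ {α ∈ P | ¬ IsSingularAt w α},
      rootSpace (LinearMap.ker (θ + LinearMap.id)) 𝔞 α) ≤ (tangentPart θ U).baseChange ℂ :=
    iSup₂_le fun α hα => hU.rootSpace_le_tangentPart hθ h𝔞 hα.2
  refine le_antisymm (fun Y hY => ?_) hge
  have hYq := baseChange_le_iff.2 (tangentPart_le hθ) hY
  rw [antiSub_baseChange_split hθ h𝔞 hP w] at hYq
  obtain ⟨Y₁, hY₁, Y₂, hY₂, rfl⟩ := Submodule.mem_sup.1 hYq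
  have hY₂T : Y₂ ∈ (tangentPart θ U).baseChange ℂ := by
    simpa using sub_mem hY (hge hY₁)
  suffices h : Y₂ = 0 by rw [h, add_zero]; exact hY₁
  refine eq_zero_of_killC_anti hθ hU.killing_invol (mem_antiSub_baseChange.1
    (baseChange_le_iff.2 (tangentPart_le hθ) hY₂T)) fun η hη => ?_
  rw [antiSub_baseChange_split hθ h𝔞 hP w] at hη
  obtain ⟨η₁, hη₁, η₂, hη₂, rfl⟩ := Submodule.mem_sup.1 hη
  rw [map_add, hU.orth_singular h𝔞 hη₂ hY₂T, killC_comm,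
    hU.orth_singular h𝔞 hY₂ (hge hη₁), add_zero]

/-- The same argument with the roles exchanged: the nonsingular component of a normal vector is both
tangent and normal, hence orthogonal to both parts of 𝔮ᶜ. -/
theorem IsExpPair.normalPart_baseChange [FiniteDimensional ℝ L] [LieAlgebra.IsKilling ℝ L]
    (hθ : IsLieInvolution θ)
    (h𝔞 : IsCartanSubspace (LinearMap.ker (θ + LinearMap.id)) 𝔞)
    (hP : IsPositiveSystem (LinearMap.ker (θ + LinearMap.id)) 𝔞 P) (hU : IsExpPair θ w U U') :
    (normalPart θ (tangentPart θ U)).baseChange ℂ =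
      𝔞.baseChange ℂ ⊔ ⨆ α ∈ {α ∈ P | IsSingularAt w α},
        rootSpace (LinearMap.ker (θ + LinearMap.id)) 𝔞 α := by
  have hge : 𝔞.baseChange ℂ ⊔ (⨆ α ∈ {α ∈ P | IsSingularAt w α},
      rootSpace (LinearMap.ker (θ + LinearMap.id)) 𝔞 α) ≤
      (normalPart θ (tangentPart θ U)).baseChange ℂ := by
    intro X hX
    have hXq : X ∈ (LinearMap.ker (θ + LinearMap.id)).baseChange ℂ := by
      rw [antiSub_baseChange_split hθ h𝔞 hP w]
      exact Submodule.mem_sup_right hX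
    have hXq' := mem_baseChange_iff.1 hXq
    have h0 : ∀ x ∈ tangentPart θ U, killC L X ((1 : ℂ) ⊗ₜ x) = 0 := fun x hx => by
      rw [killC_comm]
      exact hU.orth_singular h𝔞 hX (one_tmul_mem_baseChange.2 hx)
    exact mem_baseChange_iff.2 ⟨mem_normalPart.2 ⟨hXq'.1, fun x hx =>
      ((killC_one_tmul_eq_zero_iff X x).1 (h0 x hx)).1⟩, mem_normalPart.2 ⟨hXq'.2, fun x hx =>
      ((killC_one_tmul_eq_zero_iff X x).1 (h0 x hx)).2⟩⟩
  refine le_antisymm (fun Y hY => ?_) hge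
  have hYq := baseChange_le_iff.2 (inf_le_left : normalPart θ (tangentPart θ U) ≤ _) hY
  have hYq' := hYq
  rw [antiSub_baseChange_split hθ h𝔞 hP w] at hYq
  obtain ⟨Y₁, hY₁, Y₂, hY₂, rfl⟩ := Submodule.mem_sup.1 hYq
  have hY₁N : Y₁ ∈ (normalPart θ (tangentPart θ U)).baseChange ℂ := by
    simpa using sub_mem hY (hge hY₂)
  have hY₁T : Y₁ ∈ (tangentPart θ U).baseChange ℂ := by
    rwa [hU.tangentPart_baseChange hθ h𝔞 hP]
  suffices h : Y₁ = 0 by rw [h, zero_add]; exact hY₂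
  refine eq_zero_of_killC_anti hθ hU.killing_invol (mem_antiSub_baseChange.1
    (baseChange_le_iff.2 (tangentPart_le hθ) hY₁T)) fun η hη => ?_
  rw [antiSub_baseChange_split hθ h𝔞 hP w] at hη
  obtain ⟨η₁, hη₁, η₂, hη₂, rfl⟩ := Submodule.mem_sup.1 hη
  rw [← hU.tangentPart_baseChange hθ h𝔞 hP] at hη₁
  rw [map_add, hU.orth_singular h𝔞 hη₂ hY₁T,
    killC_eq_zero_of_mem_normalPart hY₁N hη₁, add_zero]

/-- The Killing form is nondegenerate on the tangent part. -/
lemma IsExpPair.eq_zero_of_mem_tangentPart [FiniteDimensional ℝ L] [LieAlgebra.IsKilling ℝ L]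
    (hθ : IsLieInvolution θ)
    (h𝔞 : IsCartanSubspace (LinearMap.ker (θ + LinearMap.id)) 𝔞)
    (hP : IsPositiveSystem (LinearMap.ker (θ + LinearMap.id)) 𝔞 P) (hU : IsExpPair θ w U U')
    {x : L} (hx : x ∈ tangentPart θ U) (h0 : ∀ y ∈ tangentPart θ U, killingForm ℝ L x y = 0) :
    x = 0 := by
  have hxN : (1 : ℂ) ⊗ₜ[ℝ] x ∈ (normalPart θ (tangentPart θ U)).baseChange ℂ :=
    one_tmul_mem_baseChange.2 (mem_normalPart.2 ⟨tangentPart_le hθ hx, h0⟩)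
  have hxT : (1 : ℂ) ⊗ₜ[ℝ] x ∈ (tangentPart θ U).baseChange ℂ := one_tmul_mem_baseChange.2 hx
  have h : (1 : ℂ) ⊗ₜ[ℝ] x = 0 := by
    refine eq_zero_of_killC_anti hθ hU.killing_invol (mem_antiSub_baseChange.1
      (baseChange_le_iff.2 (tangentPart_le hθ) hxT)) fun η hη => ?_
    rw [antiSub_baseChange_split hθ h𝔞 hP w] at hη
    obtain ⟨η₁, hη₁, η₂, hη₂, rfl⟩ := Submodule.mem_sup.1 hη
    rw [← hU.tangentPart_baseChange hθ h𝔞 hP] at hη₁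
    rw [map_add, hU.orth_singular h𝔞 hη₂ hxT,
      killC_eq_zero_of_mem_normalPart hxN hη₁, add_zero]
  have := congrArg (tensorRe L) h
  simpa using this

/-- Polarization of ad(a)²X = α(a)²X, using that ad(a) and ad(b) commute. -/
lemma lie_lie_mixed (h𝔞 : IsCartanSubspace (LinearMap.ker (θ + LinearMap.id)) 𝔞)
    {α : Module.Dual ℂ (𝔞.baseChange ℂ)} {X : ℂ ⊗[ℝ] L}
    (hX : X ∈ rootSpace (LinearMap.ker (θ + LinearMap.id)) 𝔞 α) (a b : 𝔞) :
    ⁅(1 : ℂ) ⊗ₜ[ℝ] (a : L), ⁅(1 : ℂ) ⊗ₜ[ℝ] (b : L), X⁆⁆ = (realEval α a * realEval α b) • X := by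
  have hcomm : ⁅(1 : ℂ) ⊗ₜ[ℝ] (b : L), ⁅(1 : ℂ) ⊗ₜ[ℝ] (a : L), X⁆⁆
      = ⁅(1 : ℂ) ⊗ₜ[ℝ] (a : L), ⁅(1 : ℂ) ⊗ₜ[ℝ] (b : L), X⁆⁆ :=
    LinearMap.congr_fun (h𝔞.adC_commute (toC b) (toC a)) X
  have h1 := lie_lie_of_mem_rootSpace hX (a + (1 : ℝ) • b)
  rw [realEval_add_smul, one_smul, Submodule.coe_add, TensorProduct.tmul_add] at h1
  simp only [tensor_add_lie, tensor_lie_add, lie_lie_of_mem_rootSpace hX, hcomm] at h1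
  have h2 : (2 : ℂ) • ⁅(1 : ℂ) ⊗ₜ[ℝ] (a : L), ⁅(1 : ℂ) ⊗ₜ[ℝ] (b : L), X⁆⁆
      = (2 : ℂ) • (realEval α a * realEval α b) • X := by
    rw [← sub_eq_zero] at h1 ⊢
    rw [← h1]
    push_cast
    module
  exact smul_right_injective _ (two_ne_zero' ℂ) h2

/-- The difference Z of the two sides satisfies [w,Z] = 0 but also ad(w)²Z = α(w)²Z, so Z = 0. On X,
all of 𝔞 thus acts through the single vector [w,X]. -/
lemma lie_eq_smul_lie (h𝔞 : IsCartanSubspace (LinearMap.ker (θ + LinearMap.id)) 𝔞)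
    {α : Module.Dual ℂ (𝔞.baseChange ℂ)} {X : ℂ ⊗[ℝ] L}
    (hX : X ∈ rootSpace (LinearMap.ker (θ + LinearMap.id)) 𝔞 α) {w : 𝔞} (hw : realEval α w ≠ 0)
    (a : 𝔞) : ⁅(1 : ℂ) ⊗ₜ[ℝ] (a : L), X⁆
      = (realEval α a / realEval α w) • ⁅(1 : ℂ) ⊗ₜ[ℝ] (w : L), X⁆ := by
  set Z := ⁅(1 : ℂ) ⊗ₜ[ℝ] (a : L), X⁆
    - (realEval α a / realEval α w) • ⁅(1 : ℂ) ⊗ₜ[ℝ] (w : L), X⁆ with hZ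
  have h1 : ⁅(1 : ℂ) ⊗ₜ[ℝ] (w : L), Z⁆ = 0 := by
    rw [hZ, tensor_lie_sub, tensor_lie_smul, lie_lie_mixed h𝔞 hX, lie_lie_mixed h𝔞 hX, smul_smul,
      ← sub_smul]
    convert zero_smul ℂ X
    field_simp
    ring
  have hcomm : ∀ Y, ⁅(1 : ℂ) ⊗ₜ[ℝ] (w : L), ⁅(1 : ℂ) ⊗ₜ[ℝ] (a : L), Y⁆⁆
      = ⁅(1 : ℂ) ⊗ₜ[ℝ] (a : L), ⁅(1 : ℂ) ⊗ₜ[ℝ] (w : L), Y⁆⁆ := fun Y =>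
    LinearMap.congr_fun (h𝔞.adC_commute (toC w) (toC a)) Y
  have h2 : ⁅(1 : ℂ) ⊗ₜ[ℝ] (w : L), ⁅(1 : ℂ) ⊗ₜ[ℝ] (w : L), Z⁆⁆ = realEval α w ^ 2 • Z := by
    rw [hZ, tensor_lie_sub, tensor_lie_smul, tensor_lie_sub, tensor_lie_smul, hcomm, hcomm,
      lie_lie_of_mem_rootSpace hX w, tensor_lie_smul, tensor_lie_smul, smul_sub, smul_comm (_ / _)]
  rw [h1, tensor_lie_zero] at h2
  exact sub_eq_zero.1 ((smul_eq_zero.1 h2.symm).resolve_left (pow_ne_zero _ hw))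

/-- The identity behind the formula for the shape operator. -/
theorem IsExpPair.killC_lie_fixPart (hθ : IsLieInvolution θ)
    (h𝔞 : IsCartanSubspace (LinearMap.ker (θ + LinearMap.id)) 𝔞) (hU : IsExpPair θ w U U')
    {α : Module.Dual ℂ (𝔞.baseChange ℂ)} (hα : ¬ IsSingularAt w α) {X : ℂ ⊗[ℝ] L}
    (hX : X ∈ rootSpace (LinearMap.ker (θ + LinearMap.id)) 𝔞 α) (a : 𝔞) {F : L}
    (hF : F ∈ LinearMap.ker (θ - LinearMap.id)) :
    killC L X ((1 : ℂ) ⊗ₜ[ℝ] ⁅(a : L), fixPart θ (U F)⁆) =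
      (-(Complex.I * realEval α a) * Complex.cot (Complex.I * realEval α w)) *
        killC L X ((1 : ℂ) ⊗ₜ[ℝ] antiPart θ (U F)) := by
  have h0 := ne_zero_of_not_singular hα
  rw [isSingularAt_iff] at hα
  have hX' := mem_antiSub_baseChange.1 hX.1
  set μ := realEval α w
  have hFθ : θ.baseChange ℂ ((1 : ℂ) ⊗ₜ[ℝ] F) = (1 : ℂ) ⊗ₜ[ℝ] F := by
    rw [LinearMap.baseChange_tmul, mem_fixSub.1 hF]
  have haX : θ.baseChange ℂ ⁅(1 : ℂ) ⊗ₜ[ℝ] (a : L), X⁆ = ⁅(1 : ℂ) ⊗ₜ[ℝ] (a : L), X⁆ := by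
    rw [invol_lie_of_anti hθ (h𝔞.map_eq_neg a), hX', tensor_lie_neg, neg_neg]
  have hsplit : ∀ ξ : ℂ ⊗[ℝ] L, killC L ξ ((1 : ℂ) ⊗ₜ[ℝ] U F) =
      killC L ξ ((1 : ℂ) ⊗ₜ[ℝ] fixPart θ (U F)) + killC L ξ ((1 : ℂ) ⊗ₜ[ℝ] antiPart θ (U F)) := by
    intro ξ
    rw [← map_add, ← TensorProduct.tmul_add, fixPart_add_antiPart]
  have hfix : θ.baseChange ℂ ((1 : ℂ) ⊗ₜ[ℝ] fixPart θ (U F)) = (1 : ℂ) ⊗ₜ[ℝ] fixPart θ (U F) := by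
    rw [LinearMap.baseChange_tmul, mem_fixSub.1 (hθ.fixPart_mem _)]
  have hanti : θ.baseChange ℂ ((1 : ℂ) ⊗ₜ[ℝ] antiPart θ (U F))
      = -((1 : ℂ) ⊗ₜ[ℝ] antiPart θ (U F)) := by
    rw [LinearMap.baseChange_tmul, mem_antiSub.1 (hθ.antiPart_mem _), TensorProduct.tmul_neg]
  have hadj : ∀ ξ : ℂ ⊗[ℝ] L, killC L ξ ((1 : ℂ) ⊗ₜ[ℝ] U F)
      = killC L (U'.baseChange ℂ ξ) ((1 : ℂ) ⊗ₜ[ℝ] F) := by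
    intro ξ
    rw [killC_comm, ← LinearMap.baseChange_tmul, killC_adjoint hU.killing_adjoint, killC_comm]
  -- Invariance moves a onto X. As [a,X] ∈ 𝔥ᶜ, it pairs with UF as with its 𝔥-component, and the
  -- adjoint U' sends [a,X] to cosh μ · [a,X] plus a multiple of X, which is orthogonal to F.
  have e1 : killC L X ((1 : ℂ) ⊗ₜ[ℝ] ⁅(a : L), fixPart θ (U F)⁆)
      = -(Complex.cosh μ * killC L ⁅(1 : ℂ) ⊗ₜ[ℝ] (a : L), X⁆ ((1 : ℂ) ⊗ₜ[ℝ] F)) := by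
    have h1 : killC L ⁅(1 : ℂ) ⊗ₜ[ℝ] (a : L), X⁆ ((1 : ℂ) ⊗ₜ[ℝ] fixPart θ (U F))
        = killC L ⁅(1 : ℂ) ⊗ₜ[ℝ] (a : L), X⁆ ((1 : ℂ) ⊗ₜ[ℝ] U F) := by
      rw [hsplit, killC_fix_anti hU.killing_invol haX hanti, add_zero]
    have h2 : ⁅(1 : ℂ) ⊗ₜ[ℝ] (w : L), ⁅(1 : ℂ) ⊗ₜ[ℝ] (w : L), ⁅(1 : ℂ) ⊗ₜ[ℝ] (a : L), X⁆⁆⁆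
        = μ ^ 2 • ⁅(1 : ℂ) ⊗ₜ[ℝ] (a : L), X⁆ := by
      rw [lie_eq_smul_lie h𝔞 hX h0, tensor_lie_smul, tensor_lie_smul,
        lie_lie_of_mem_rootSpace hX w, tensor_lie_smul, smul_comm]
    have h3 : killC L ⁅(1 : ℂ) ⊗ₜ[ℝ] (w : L), ⁅(1 : ℂ) ⊗ₜ[ℝ] (a : L), X⁆⁆ ((1 : ℂ) ⊗ₜ[ℝ] F) = 0 := by
      rw [lie_lie_mixed h𝔞 hX, map_smul, LinearMap.smul_apply, killC_comm,
        killC_fix_anti hU.killing_invol hFθ hX', smul_zero]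
    have h4 : (1 : ℂ) ⊗ₜ[ℝ] ⁅(a : L), fixPart θ (U F)⁆
        = ⁅(1 : ℂ) ⊗ₜ[ℝ] (a : L), (1 : ℂ) ⊗ₜ[ℝ] fixPart θ (U F)⁆ := by
      rw [LieAlgebra.ExtendScalars.bracket_tmul, one_mul]
    have h5 := killC_lie (a : L) X ((1 : ℂ) ⊗ₜ[ℝ] fixPart θ (U F))
    rw [h4, ← neg_eq_iff_eq_neg.2 h5, h1, hadj, hU.act'.apply h0 h2, map_add, map_smul, map_smul,
      LinearMap.add_apply, LinearMap.smul_apply, LinearMap.smul_apply, h3, smul_zero, add_zero,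
      smul_eq_mul]
  -- Now U'X = cosh μ · X + (sinh μ/μ)[w,X], and only the second term meets F ∈ 𝔥.
  have e2 : killC L X ((1 : ℂ) ⊗ₜ[ℝ] antiPart θ (U F))
      = Complex.sinh μ / μ * killC L ⁅(1 : ℂ) ⊗ₜ[ℝ] (w : L), X⁆ ((1 : ℂ) ⊗ₜ[ℝ] F) := by
    have h1 : killC L X ((1 : ℂ) ⊗ₜ[ℝ] antiPart θ (U F)) = killC L X ((1 : ℂ) ⊗ₜ[ℝ] U F) := by
      rw [hsplit, killC_comm X (_ ⊗ₜ fixPart θ _), killC_fix_anti hU.killing_invol hfix hX',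
        zero_add]
    have h3 : killC L X ((1 : ℂ) ⊗ₜ[ℝ] F) = 0 := by
      rw [killC_comm, killC_fix_anti hU.killing_invol hFθ hX']
    rw [h1, hadj, hU.act'.apply h0 (lie_lie_of_mem_rootSpace hX w), map_add, map_smul, map_smul,
      LinearMap.add_apply, LinearMap.smul_apply, LinearMap.smul_apply, h3, smul_zero, zero_add,
      smul_eq_mul]
  have hμ : realEval α w = μ := rfl
  -- Replacing [a,X] by (α(a)/μ)[w,X], the quotient is −α(a) coth μ, and cot(iμ) = −i coth μ.
  rw [e1, e2, lie_eq_smul_lie h𝔞 hX h0 a, hμ, map_smul, LinearMap.smul_apply, smul_eq_mul,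
    Complex.cot, mul_comm Complex.I μ, Complex.cos_mul_I, Complex.sin_mul_I]
  have hI := Complex.I_ne_zero
  field_simp

end Algebra

/-! ### The isotropy algebra: transversality to 𝔞 and comparison of tangent dimensions. -/

section Algebra

variable {L : Type*} [LieRing L] [LieAlgebra ℝ L] {θ : L →ₗ[ℝ] L}
  {𝔞 : Submodule ℝ L} {P : Set (Module.Dual ℂ (𝔞.baseChange ℂ))}
  {w : 𝔞} {U U' : L →ₗ[ℝ] L}

/-- The infinitesimal isotropy action is transversal to `𝔞` at a regular vector `a`. -/
theorem IsExpPair.exists_eq_lie_add [FiniteDimensional ℝ L] [LieAlgebra.IsKilling ℝ L]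
    (hθ : IsLieInvolution θ)
    (h𝔞 : IsCartanSubspace (LinearMap.ker (θ + LinearMap.id)) 𝔞)
    (hP : IsPositiveSystem (LinearMap.ker (θ + LinearMap.id)) 𝔞 P) (hU : IsExpPair θ w U U')
    {a : 𝔞} (ha : ∀ β ∈ P, IsSingularAt w β → realEval β a ≠ 0)
    {Y : L} (hY : Y ∈ normalPart θ (tangentPart θ U)) :
    ∃ X ∈ LinearMap.ker (θ - LinearMap.id), U' X ∈ LinearMap.ker (θ - LinearMap.id) ∧
      ∃ b ∈ 𝔞, Y = ⁅X, (a : L)⁆ + b := by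
  -- For U' = Ad(g), K is Ad(g⁻¹) of the isotropy algebra at gH: both X and Ad(g)X must lie in 𝔥.
  set K : Submodule ℝ L := LinearMap.ker (θ - LinearMap.id) ⊓
    (LinearMap.ker (θ - LinearMap.id)).comap U' with hK
  set N : Submodule ℝ L := K.map (LieAlgebra.ad ℝ L (a : L)) ⊔ 𝔞 with hN
  have hle : (normalPart θ (tangentPart θ U)).baseChange ℂ ≤ N.baseChange ℂ := by
    rw [hU.normalPart_baseChange hθ h𝔞 hP]
    refine sup_le (baseChange_le_iff.2 le_sup_right) (iSup₂_le fun β hβ X hX => ?_)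
    have hβa := ha β hβ.1 hβ.2
    have hX' := mem_antiSub_baseChange.1 hX.1
    set E := ⁅(1 : ℂ) ⊗ₜ[ℝ] (a : L), X⁆ with hE
    have hθE : θ.baseChange ℂ E = E := by
      rw [hE, invol_lie_of_anti hθ (h𝔞.map_eq_neg a), hX', tensor_lie_neg, neg_neg]
    -- Singularity of β at w makes U' scalar on E = [a,X], so E belongs to Kᶜ.
    have hU'E : ∃ c : ℂ, U'.baseChange ℂ E = c • E := by
      have hcomm : ∀ Y, ⁅(1 : ℂ) ⊗ₜ[ℝ] (w : L), ⁅(1 : ℂ) ⊗ₜ[ℝ] (a : L), Y⁆⁆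
          = ⁅(1 : ℂ) ⊗ₜ[ℝ] (a : L), ⁅(1 : ℂ) ⊗ₜ[ℝ] (w : L), Y⁆⁆ := fun Y =>
        LinearMap.congr_fun (h𝔞.adC_commute (toC w) (toC a)) Y
      have hwwE : ⁅(1 : ℂ) ⊗ₜ[ℝ] (w : L), ⁅(1 : ℂ) ⊗ₜ[ℝ] (w : L), E⁆⁆
          = realEval β w ^ 2 • E := by
        rw [hE, hcomm, hcomm, lie_lie_of_mem_rootSpace hX w, tensor_lie_smul]
      by_cases h0 : realEval β w = 0
      · refine ⟨1, ?_⟩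
        rw [one_smul, hU.act'.apply_of_lie_eq_zero]
        apply one_tmul_lie_eq_zero_of_semisimple (h𝔞.semisimple w w.2)
        rw [hwwE, h0]
        simp
      · refine ⟨Complex.cosh (realEval β w), ?_⟩
        rw [hU.act'.apply h0 hwwE, isSingularAt_iff.1 hβ.2, zero_div, zero_smul, add_zero]
    have hEK : E ∈ K.baseChange ℂ := by
      obtain ⟨c, hc⟩ := hU'E
      have h1 := mem_fixSub_baseChange.2 hθE
      have h2 := Submodule.smul_mem _ c h1
      rw [← hc] at h2
      rw [mem_baseChange_iff] at h1 h2 ⊢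
      rw [tensorRe_baseChange, tensorIm_baseChange] at h2
      exact ⟨⟨h1.1, h2.1⟩, h1.2, h2.2⟩
    -- Regularity of a allows solving ad(a)²X = β(a)²X for X, which places X in [a, Kᶜ].
    have hXE : X = ((realEval β a) ^ 2)⁻¹ • (LieAlgebra.ad ℝ L (a : L)).baseChange ℂ E := by
      rw [← one_tmul_lie, hE, lie_lie_of_mem_rootSpace hX a, smul_smul,
        inv_mul_cancel₀ (pow_ne_zero _ hβa), one_smul]
    rw [hXE]
    refine Submodule.smul_mem _ _ (baseChange_le_iff.2 le_sup_left ?_)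
    rw [map_baseChange]
    exact ⟨E, hEK, rfl⟩
  obtain ⟨_, ⟨X, hX, rfl⟩, b, hb, rfl⟩ := Submodule.mem_sup.1 (baseChange_le_iff.1 hle hY)
  refine ⟨-X, neg_mem hX.1, ?_, b, hb, ?_⟩
  · rw [map_neg]
    exact neg_mem hX.2
  · rw [LieAlgebra.ad_apply, neg_lie, lie_skew]

lemma mem_normalPart_of_mem [FiniteDimensional ℝ L] [LieAlgebra.IsKilling ℝ L]
    (hθ : IsLieInvolution θ)
    (h𝔞 : IsCartanSubspace (LinearMap.ker (θ + LinearMap.id)) 𝔞)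
    (hP : IsPositiveSystem (LinearMap.ker (θ + LinearMap.id)) 𝔞 P) (hU : IsExpPair θ w U U')
    {a : L} (ha : a ∈ 𝔞) : a ∈ normalPart θ (tangentPart θ U) := by
  rw [← one_tmul_mem_baseChange, hU.normalPart_baseChange hθ h𝔞 hP]
  exact Submodule.mem_sup_left (one_tmul_mem_baseChange.2 ha)

/-- Arbitrarily close to `w` there are vectors at which no positive root is singular. -/
lemma IsPositiveSystem.exists_nonsingular [FiniteDimensional ℝ L] {𝔮 : Submodule ℝ L}
    (h𝔞 : IsCartanSubspace 𝔮 𝔞) (hP : IsPositiveSystem 𝔮 𝔞 P) (w : 𝔞) :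
    ∃ a : 𝔞, ∀ s ∈ 𝓝 (0 : ℝ), ∃ t ∈ s, ∀ β ∈ P, ¬ IsSingularAt (w + t • a) β := by
  obtain ⟨a, ha⟩ := hP.exists_regular h𝔞
  refine ⟨a, fun s hs => ?_⟩
  -- With β(a) ≠ 0, the equation β(w) + tβ(a) = iπk has at most one solution t for each pair (β,k),
  -- so the excluded parameters are countable and their complement is dense.
  have hbad : (⋃ β ∈ P, {t : ℝ | IsSingularAt (w + t • a) β}).Countable := by
    refine (hP.finite h𝔞).countable.biUnion fun β hβ => ?_
    refine Set.Countable.mono (?_ : _ ⊆ ⋃ k : ℤ,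
      {t : ℝ | realEval β (w + t • a) = Complex.I * Real.pi * k}) ?_
    · intro t ht
      exact Set.mem_iUnion.2 ht
    · refine Set.countable_iUnion fun k => Set.Subsingleton.countable ?_
      intro t ht t' ht'
      have h1 : realEval β (w + t • a) = realEval β (w + t' • a) := by
        rw [show realEval β (w + t • a) = _ from ht, show realEval β (w + t' • a) = _ from ht']
      rw [realEval_add_smul, realEval_add_smul, add_right_inj] at h1
      exact_mod_cast mul_right_cancel₀ (ha β hβ) h1
  obtain ⟨t, ht, hts⟩ := (hbad.dense_compl ℝ).inter_nhds_nonempty hs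
  refine ⟨t, hts, fun β hβ hsing => ht ?_⟩
  exact Set.mem_biUnion hβ hsing

/-- Rank–nullity: the tangent part is the image of 𝔥, and the kernel consists of the x ∈ 𝔥 with Ux ∈
𝔥. A larger kernel means a smaller image. -/
lemma finrank_tangentPart_le [FiniteDimensional ℝ L] {U₁ U₂ φ : L →ₗ[ℝ] L}
    (hφ : Function.Injective φ)
    (h : ∀ x ∈ LinearMap.ker (θ - LinearMap.id), U₁ x ∈ LinearMap.ker (θ - LinearMap.id) →
      φ x ∈ LinearMap.ker (θ - LinearMap.id) ∧ U₂ (φ x) ∈ LinearMap.ker (θ - LinearMap.id)) :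
    Module.finrank ℝ (tangentPart θ U₂) ≤ Module.finrank ℝ (tangentPart θ U₁) := by
  have key : ∀ U : L →ₗ[ℝ] L, Module.finrank ℝ (tangentPart θ U) +
      Module.finrank ℝ (LinearMap.ker ((antiPart θ ∘ₗ U).domRestrict
        (LinearMap.ker (θ - LinearMap.id)))) =
      Module.finrank ℝ (LinearMap.ker (θ - LinearMap.id)) := by
    intro U
    rw [← LinearMap.finrank_range_add_finrank_ker ((antiPart θ ∘ₗ U).domRestrict
        (LinearMap.ker (θ - LinearMap.id))), LinearMap.range_domRestrict]
    rfl
  have hmem : ∀ (U : L →ₗ[ℝ] L) (x : LinearMap.ker (θ - LinearMap.id)),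
      x ∈ LinearMap.ker ((antiPart θ ∘ₗ U).domRestrict (LinearMap.ker (θ - LinearMap.id))) ↔
      U x ∈ LinearMap.ker (θ - LinearMap.id) := fun U x => antiPart_eq_zero_iff
  have hle : Module.finrank ℝ (LinearMap.ker ((antiPart θ ∘ₗ U₁).domRestrict
        (LinearMap.ker (θ - LinearMap.id)))) ≤
      Module.finrank ℝ (LinearMap.ker ((antiPart θ ∘ₗ U₂).domRestrict
        (LinearMap.ker (θ - LinearMap.id)))) := by
    let f : LinearMap.ker ((antiPart θ ∘ₗ U₁).domRestrict (LinearMap.ker (θ - LinearMap.id))) →ₗ[ℝ]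
        LinearMap.ker ((antiPart θ ∘ₗ U₂).domRestrict (LinearMap.ker (θ - LinearMap.id))) :=
      { toFun := fun x => ⟨⟨φ x, (h x x.1.2 ((hmem U₁ x).1 x.2)).1⟩,
          (hmem U₂ _).2 (h x x.1.2 ((hmem U₁ x).1 x.2)).2⟩
        map_add' := fun x y => Subtype.ext (Subtype.ext (map_add φ _ _))
        map_smul' := fun c x => Subtype.ext (Subtype.ext (map_smul φ c _)) }
    apply LinearMap.finrank_le_finrank_of_injective (f := f)
    intro x y hxy
    exact Subtype.ext (Subtype.ext (hφ (congrArg (fun z => (z.1.1 : L)) hxy)))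
  have := key U₁
  have := key U₂
  omega

/-- If the tangent part at `w` is at least as large as at a vector without singular roots, then it
is the sum of all root spaces. -/
theorem IsExpPair.eq_of_finrank_le [FiniteDimensional ℝ L] [LieAlgebra.IsKilling ℝ L]
    (hθ : IsLieInvolution θ)
    (h𝔞 : IsCartanSubspace (LinearMap.ker (θ + LinearMap.id)) 𝔞)
    (hP : IsPositiveSystem (LinearMap.ker (θ + LinearMap.id)) 𝔞 P) (hU : IsExpPair θ w U U')
    {w₂ : 𝔞} {U₂ U₂' : L →ₗ[ℝ] L} (hU₂ : IsExpPair θ w₂ U₂ U₂')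
    (hw₂ : ∀ β ∈ P, ¬ IsSingularAt w₂ β)
    (hrank : Module.finrank ℝ (tangentPart θ U₂) ≤ Module.finrank ℝ (tangentPart θ U)) :
    (tangentPart θ U).baseChange ℂ = ⨆ α ∈ P,
        rootSpace (LinearMap.ker (θ + LinearMap.id)) 𝔞 α ∧
      (normalPart θ (tangentPart θ U)).baseChange ℂ = 𝔞.baseChange ℂ := by
  have h2 : (tangentPart θ U₂).baseChange ℂ = ⨆ α ∈ P,
      rootSpace (LinearMap.ker (θ + LinearMap.id)) 𝔞 α := by
    rw [hU₂.tangentPart_baseChange hθ h𝔞 hP]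
    congr 1
    ext1 α
    exact iSup_congr_Prop ⟨fun h => h.1, fun h => ⟨h, hw₂ α h⟩⟩ fun _ => rfl
  have hle : (tangentPart θ U).baseChange ℂ ≤ (tangentPart θ U₂).baseChange ℂ := by
    rw [h2, hU.tangentPart_baseChange hθ h𝔞 hP]
    exact iSup₂_le fun α hα => le_iSup₂_of_le α hα.1 le_rfl
  have heq : tangentPart θ U = tangentPart θ U₂ :=
    Submodule.eq_of_le_of_finrank_le (baseChange_le_iff.1 hle) hrank
  rw [heq, h2, hU₂.normalPart_baseChange hθ h𝔞 hP]
  refine ⟨rfl, sup_eq_left.2 (iSup₂_le fun α hα => absurd hα.2 (hw₂ α hα.1))⟩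

end Algebra

/-! ### Derivatives of flows and Lie brackets -/

section Calculus

variable {E : Type*} [NormedAddCommGroup E] [NormedSpace ℝ E] [CompleteSpace E]

/-- The derivative of the pullback of a vector field `Y` along a one-parameter family of maps, in
a vector space. -/
lemma hasDerivAt_pullback_vectorSpace {F : ℝ × E → E} {z : E} (hF : ContDiffAt ℝ 2 F (0, z))
    (h0 : ∀ᶠ y in 𝓝 z, F (0, y) = y) {v Y : E → E}
    (hv : ∀ᶠ y in 𝓝 z, v y = fderiv ℝ F (0, y) (1, 0)) (hY : DifferentiableAt ℝ Y z)
    {ζ : ℝ → E} (hζ : ∀ᶠ t in 𝓝 (0 : ℝ), fderiv ℝ F (t, z) (0, ζ t) = Y (F (t, z))) :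
    HasDerivAt ζ (VectorField.lieBracket ℝ v Y z) 0 := by
  have hF1 : DifferentiableAt ℝ F (0, z) := hF.differentiableAt (by norm_num)
  have hD : DifferentiableAt ℝ (fderiv ℝ F) (0, z) :=
    (hF.fderiv_right (m := 1) (by norm_num)).differentiableAt (by norm_num)
  set D2 := fderiv ℝ (fderiv ℝ F) (0, z) with hD2
  have hsymm : ∀ a b, D2 a b = D2 b a := by
    have := hF.isSymmSndFDerivAt (by simp)
    exact fun a b => this a b
  have hline : HasDerivAt (fun t : ℝ => (t, z)) ((1 : ℝ), (0 : E)) 0 :=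
    (hasDerivAt_id' (0 : ℝ)).prodMk (hasDerivAt_const 0 z)
  -- the partial derivative in the space direction along the axis
  set A : ℝ → E →L[ℝ] E := fun t => (fderiv ℝ F (t, z)).comp (ContinuousLinearMap.inr ℝ ℝ E)
    with hA
  set R := ((ContinuousLinearMap.compL ℝ E (ℝ × E) E).flip (ContinuousLinearMap.inr ℝ ℝ E))
  have hA' : HasDerivAt A ((D2 (1, 0)).comp (ContinuousLinearMap.inr ℝ ℝ E)) 0 := by
    have h1 : HasDerivAt (fun t : ℝ => fderiv ℝ F (t, z)) (D2 (1, 0)) 0 :=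
      HasFDerivAt.comp_hasDerivAt (0 : ℝ) (hD.hasFDerivAt : HasFDerivAt _ D2 ((0 : ℝ), z)) hline
    exact R.hasFDerivAt.comp_hasDerivAt (0 : ℝ) h1
  have hA0 : A 0 = 1 := by
    have h1 : HasFDerivAt (fun y : E => F (0, y))
        ((fderiv ℝ F (0, z)).comp (ContinuousLinearMap.inr ℝ ℝ E)) z :=
      HasFDerivAt.comp z hF1.hasFDerivAt (hasFDerivAt_prodMk_right (0 : ℝ) z)
    have h2 : HasFDerivAt (fun y : E => F (0, y)) (ContinuousLinearMap.id ℝ E) z :=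
      (hasFDerivAt_id z).congr_of_eventuallyEq h0
    exact h1.unique h2
  -- The derivative of v at z is the mixed second derivative of F; by symmetry it is also the time
  -- derivative of A.
  have hv' : HasFDerivAt v (((ContinuousLinearMap.apply ℝ E ((1 : ℝ), (0 : E))).comp D2).comp
      (ContinuousLinearMap.inr ℝ ℝ E)) z := by
    have h1 : HasFDerivAt (fun y : E => fderiv ℝ F (0, y)) (D2.comp
        (ContinuousLinearMap.inr ℝ ℝ E)) z :=
      HasFDerivAt.comp z (hD.hasFDerivAt : HasFDerivAt _ D2 ((0 : ℝ), z))
        (hasFDerivAt_prodMk_right (0 : ℝ) z)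
    exact ((ContinuousLinearMap.apply ℝ E ((1 : ℝ), (0 : E))).hasFDerivAt.comp z
      h1).congr_of_eventuallyEq hv
  have hz : F (0, z) = z := h0.self_of_nhds
  have hFt : HasDerivAt (fun t : ℝ => F (t, z)) (v z) 0 := by
    rw [hv.self_of_nhds]
    exact HasFDerivAt.comp_hasDerivAt (0 : ℝ) hF1.hasFDerivAt hline
  have hYt : HasDerivAt (fun t : ℝ => Y (F (t, z))) (fderiv ℝ Y z (v z)) 0 := by
    have : HasFDerivAt Y (fderiv ℝ Y z) (F (0, z)) := by rw [hz]; exact hY.hasFDerivAt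
    exact HasFDerivAt.comp_hasDerivAt (0 : ℝ) this hFt
  -- the inverse of the partial derivative
  have hinv : HasDerivAt (fun t => Ring.inverse (A t))
      (-((D2 (1, 0)).comp (ContinuousLinearMap.inr ℝ ℝ E))) 0 := by
    have h1 : HasFDerivAt Ring.inverse
        (-ContinuousLinearMap.mulLeftRight ℝ (E →L[ℝ] E) 1 1) (A 0) := by
      rw [hA0]
      simpa using hasFDerivAt_ringInverse (𝕜 := ℝ) (1 : (E →L[ℝ] E)ˣ)
    have h2 := h1.comp_hasDerivAt (0 : ℝ) hA'
    have h3 : (-ContinuousLinearMap.mulLeftRight ℝ (E →L[ℝ] E) 1 1)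
        ((D2 (1, 0)).comp (ContinuousLinearMap.inr ℝ ℝ E))
        = -((D2 (1, 0)).comp (ContinuousLinearMap.inr ℝ ℝ E)) := by
      ext y
      simp
    rw [h3] at h2
    exact h2
  have hunit : ∀ᶠ t in 𝓝 (0 : ℝ), IsUnit (A t) := by
    have : {f : E →L[ℝ] E | IsUnit f} ∈ 𝓝 (A 0) := by
      rw [hA0]
      exact Units.isOpen.mem_nhds isUnit_one
    exact hA'.continuousAt this
  -- Since A(0) = 1, A(t) is invertible for small t. The product rule yields DY·v − A'(0)Y = DY·v −
  -- Dv·Y, the Lie bracket.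
  have hζ' : ζ =ᶠ[𝓝 0] fun t => Ring.inverse (A t) (Y (F (t, z))) := by
    filter_upwards [hζ, hunit] with t ht hu
    have h1 : A t (ζ t) = Y (F (t, z)) := ht
    rw [← h1]
    exact (congrArg (fun T : E →L[ℝ] E => T (ζ t)) (Ring.inverse_mul_cancel _ hu)).symm
  have hprod := (hinv.clm_apply hYt).congr_of_eventuallyEq hζ'
  convert hprod using 1
  rw [VectorField.lieBracket, hv'.fderiv, hA0, Ring.inverse_one, hz]
  simp only [ContinuousLinearMap.comp_apply, ContinuousLinearMap.inr_apply,
    ContinuousLinearMap.apply_apply, neg_apply]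
  rw [hsymm (0, Y z), show (1 : E →L[ℝ] E) (fderiv ℝ Y z (v z)) = fderiv ℝ Y z (v z) from rfl]
  abel

end Calculus

/-! ### Manifold derivatives read in the model space, and the Lie derivative along a flow. -/

section Manifold

variable {E : Type*} [NormedAddCommGroup E] [NormedSpace ℝ E]
  {E' : Type*} [NormedAddCommGroup E'] [NormedSpace ℝ E']
  {E'' : Type*} [NormedAddCommGroup E''] [NormedSpace ℝ E'']
  {N : Type*} [TopologicalSpace N] [ChartedSpace E N]
  {N' : Type*} [TopologicalSpace N'] [ChartedSpace E' N']
  {N'' : Type*} [TopologicalSpace N''] [ChartedSpace E'' N'']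

/-- The manifold derivative, as a continuous linear map between the model vector spaces. -/
def dE (E E' : Type*) [NormedAddCommGroup E] [NormedSpace ℝ E] [NormedAddCommGroup E']
    [NormedSpace ℝ E'] {N N' : Type*} [TopologicalSpace N] [ChartedSpace E N] [TopologicalSpace N']
    [ChartedSpace E' N'] (f : N → N') (y : N) : E →L[ℝ] E' :=
  show E →L[ℝ] E' from mfderiv 𝓘(ℝ, E) 𝓘(ℝ, E') f y

lemma dE_comp {g : N' → N''} {f : N → N'} (y : N)
    (hg : MDifferentiableAt 𝓘(ℝ, E') 𝓘(ℝ, E'') g (f y))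
    (hf : MDifferentiableAt 𝓘(ℝ, E) 𝓘(ℝ, E') f y) :
    dE E E'' (g ∘ f) y = (dE E' E'' g (f y)).comp (dE E E' f y) :=
  mfderiv_comp y hg hf

lemma dE_comp_apply {g : N' → N''} {f : N → N'} (y : N)
    (hg : MDifferentiableAt 𝓘(ℝ, E') 𝓘(ℝ, E'') g (f y))
    (hf : MDifferentiableAt 𝓘(ℝ, E) 𝓘(ℝ, E') f y) (u : E) :
    dE E E'' (fun z => g (f z)) y u = dE E' E'' g (f y) (dE E E' f y u) := by
  have := dE_comp y hg hf
  exact congrArg (fun T : E →L[ℝ] E'' => T u) this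

lemma dE_id (y : N) : dE E E (fun z : N => z) y = ContinuousLinearMap.id ℝ E :=
  mfderiv_id

lemma dE_const (y : N) (c : N') : dE E E' (fun _ : N => c) y = 0 :=
  mfderiv_const

lemma dE_congr {f g : N → N'} {y : N} (h : f =ᶠ[𝓝 y] g) : dE E E' f y = dE E E' g y := by
  have := h.mfderiv_eq (I := 𝓘(ℝ, E)) (I' := 𝓘(ℝ, E'))
  exact this

lemma dE_eq_fderiv (f : E → E') (y : E) : dE E E' f y = fderiv ℝ f y :=
  mfderiv_eq_fderiv

lemma dE_extChartAt_self [IsManifold 𝓘(ℝ, E) 1 N] (x : N) :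
    dE E E (extChartAt 𝓘(ℝ, E) x) x = ContinuousLinearMap.id ℝ E :=
  mfderiv_extChartAt_self

/-- A curve with vanishing velocity is constant. -/
lemma eq_of_velocity_eq_zero [IsManifold 𝓘(ℝ, E) 1 N] {c : ℝ → N}
    (hc : MDifferentiable 𝓘(ℝ, ℝ) 𝓘(ℝ, E) c) (h0 : ∀ t, dE ℝ E c t (1 : ℝ) = 0) (t : ℝ) :
    c t = c 0 := by
  -- In a chart the derivative vanishes on an interval, so c is locally constant; connectedness of ℝ
  -- does the rest.
  have hloc : IsLocallyConstant c := by
    rw [IsLocallyConstant.iff_eventually_eq]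
    intro s
    set φ := extChartAt 𝓘(ℝ, E) (c s) with hφ
    have hs : c ⁻¹' φ.source ∈ 𝓝 s :=
      (hc s).continuousAt (extChartAt_source_mem_nhds (c s))
    obtain ⟨ε, hε, hball⟩ := Metric.mem_nhds_iff.1 hs
    have hd : ∀ r ∈ Metric.ball s ε, HasFDerivAt (φ ∘ c) (0 : ℝ →L[ℝ] E) r := by
      intro r hr
      have hsrc : c r ∈ (chartAt E (c s)).source := by
        rw [← extChartAt_source 𝓘(ℝ, E)]
        exact hball hr
      have hφr : MDifferentiableAt 𝓘(ℝ, E) 𝓘(ℝ, E) φ (c r) := mdifferentiableAt_extChartAt hsrc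
      have h1 : MDifferentiableAt 𝓘(ℝ, ℝ) 𝓘(ℝ, E) (φ ∘ c) r := hφr.comp r (hc r)
      have h2 := h1.differentiableAt.hasFDerivAt
      have h3 : fderiv ℝ (φ ∘ c) r = 0 := by
        rw [← dE_eq_fderiv, dE_comp (E' := E) r hφr (hc r)]
        ext
        simp [h0 r]
      rwa [h3] at h2
    have hconst : ∀ r ∈ Metric.ball s ε, (φ ∘ c) r = (φ ∘ c) s := by
      intro r hr
      refine (convex_ball s ε).is_const_of_fderivWithin_eq_zero (𝕜 := ℝ)
        (fun r hr => (hd r hr).differentiableAt.differentiableWithinAt) (fun r hr => ?_) hr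
        (Metric.mem_ball_self hε)
      rw [fderivWithin_of_isOpen Metric.isOpen_ball hr, (hd r hr).fderiv]
    filter_upwards [Metric.ball_mem_nhds s hε] with r hr
    exact φ.injOn (hball hr) (mem_extChartAt_source (c s)) (hconst r hr)
  exact hloc.apply_eq_of_preconnectedSpace t 0

variable [IsManifold 𝓘(ℝ, E) ∞ N]

/-- The coordinate expression of a vector field in the preferred chart at `x`. -/
def coordField (E : Type*) [NormedAddCommGroup E] [NormedSpace ℝ E] {N : Type*} [TopologicalSpace N]
    [ChartedSpace E N] (x : N) (Y : (y : N) → TangentSpace 𝓘(ℝ, E) y) : E → E :=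
  VectorField.mpullbackWithin 𝓘(ℝ, E) 𝓘(ℝ, E) (extChartAt 𝓘(ℝ, E) x).symm Y (Set.range 𝓘(ℝ, E))

lemma coordField_apply {x : N} (Y : (y : N) → TangentSpace 𝓘(ℝ, E) y) {y : N}
    (hy : y ∈ (extChartAt 𝓘(ℝ, E) x).source) :
    coordField E x Y (extChartAt 𝓘(ℝ, E) x y) = dE E E (extChartAt 𝓘(ℝ, E) x) y (Y y) := by
  have : IsManifold 𝓘(ℝ, E) 1 N := IsManifold.of_le (n := ∞) (by norm_num)
  set φ := extChartAt 𝓘(ℝ, E) x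
  have h1 := mfderiv_extChartAt_comp_mfderivWithin_extChartAt_symm' (I := 𝓘(ℝ, E)) hy
  have h2 := mfderivWithin_extChartAt_symm_comp_mfderiv_extChartAt' (I := 𝓘(ℝ, E)) hy
  rw [coordField, VectorField.mpullbackWithin_apply]
  have hleft : φ.symm (φ y) = y := φ.left_inv hy
  set S : E →L[ℝ] E := mfderivWithin 𝓘(ℝ, E) 𝓘(ℝ, E) φ.symm (Set.range 𝓘(ℝ, E)) (φ y)
  have h1' : (dE E E φ y).comp S = ContinuousLinearMap.id ℝ E := h1
  have h2' : S.comp (dE E E φ y) = ContinuousLinearMap.id ℝ E := h2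
  have h3 : S.inverse = dE E E φ y := ContinuousLinearMap.inverse_eq h2' h1'
  show S.inverse (Y (φ.symm (φ y))) = _
  rw [h3, hleft]

lemma coordField_self (x : N) (Y : (y : N) → TangentSpace 𝓘(ℝ, E) y) :
    coordField E x Y (extChartAt 𝓘(ℝ, E) x x) = Y x := by
  have : IsManifold 𝓘(ℝ, E) 1 N := IsManifold.of_le (n := ∞) (by norm_num)
  rw [coordField_apply Y (mem_extChartAt_source x), dE_extChartAt_self]
  rfl

lemma differentiableAt_coordField [CompleteSpace E] {x : N} {Y : (y : N) → TangentSpace 𝓘(ℝ, E) y}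
    (hY : MDifferentiableAt 𝓘(ℝ, E) 𝓘(ℝ, E).tangent
      (fun y => (⟨y, Y y⟩ : TangentBundle 𝓘(ℝ, E) N)) x) :
    DifferentiableAt ℝ (coordField E x Y) (extChartAt 𝓘(ℝ, E) x x) := by
  have : IsManifold 𝓘(ℝ, E) 1 N := IsManifold.of_le (n := ∞) (by norm_num)
  have : IsManifold 𝓘(ℝ, E) 2 N := IsManifold.of_le (n := ∞) (by
    exact_mod_cast ENat.LEInfty.out)
  have := MDifferentiableWithinAt.differentiableWithinAt_mpullbackWithin_vectorField
    (I := 𝓘(ℝ, E)) (s := Set.univ) hY.mdifferentiableWithinAt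
  rw [Set.preimage_univ, Set.univ_inter] at this
  have h2 : DifferentiableWithinAt ℝ (coordField E x Y) (Set.range 𝓘(ℝ, E))
    (extChartAt 𝓘(ℝ, E) x x) := this
  have hr : Set.range 𝓘(ℝ, E) = Set.univ := Set.range_id
  rw [hr] at h2
  exact differentiableWithinAt_univ.1 h2

lemma mlieBracket_eq_lieBracket_coordField (x : N) (V Y : (y : N) → TangentSpace 𝓘(ℝ, E) y) :
    (VectorField.mlieBracket 𝓘(ℝ, E) V Y x : E)
      = VectorField.lieBracket ℝ (coordField E x V) (coordField E x Y)
          (extChartAt 𝓘(ℝ, E) x x) := by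
  have : IsManifold 𝓘(ℝ, E) 1 N := IsManifold.of_le (n := ∞) (by norm_num)
  have hr : Set.range 𝓘(ℝ, E) = Set.univ := Set.range_id
  have h1 : (VectorField.mlieBracket 𝓘(ℝ, E) V Y x : E)
      = (dE E E (extChartAt 𝓘(ℝ, E) x) x).inverse (VectorField.lieBracketWithin ℝ
        (coordField E x V) (coordField E x Y)
        ((extChartAt 𝓘(ℝ, E) x).symm ⁻¹' Set.univ ∩ Set.range 𝓘(ℝ, E)) (extChartAt 𝓘(ℝ, E) x x)) := by
    rw [← VectorField.mlieBracketWithin_univ, VectorField.mlieBracketWithin_apply]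
    rfl
  rw [h1, dE_extChartAt_self, ContinuousLinearMap.inverse_id, Set.preimage_univ,
    Set.univ_inter, hr, VectorField.lieBracketWithin_univ]
  rfl

/-- The derivative at time `0` of the pullback of a vector field `Y` along a one-parameter family
of maps `Φ` with `Φ 0 = id` is the Lie bracket with the velocity field `V` of `Φ`. -/
theorem hasDerivAt_pullback [CompleteSpace E] {Φ : ℝ → N → N}
    (hΦ : ContMDiff (𝓘(ℝ, ℝ).prod 𝓘(ℝ, E)) 𝓘(ℝ, E) ∞ (fun p : ℝ × N => Φ p.1 p.2))
    (h0 : ∀ y, Φ 0 y = y) {V Y : (y : N) → TangentSpace 𝓘(ℝ, E) y}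
    (hV : ∀ y, dE ℝ E (fun t => Φ t y) (0 : ℝ) (1 : ℝ) = V y) {x : N}
    (hY : MDifferentiableAt 𝓘(ℝ, E) 𝓘(ℝ, E).tangent
      (fun y => (⟨y, Y y⟩ : TangentBundle 𝓘(ℝ, E) N)) x)
    {ζ : ℝ → E} (hζ : ∀ᶠ t in 𝓝 (0 : ℝ), dE E E (Φ t) x (ζ t) = Y (Φ t x)) :
    HasDerivAt ζ (VectorField.mlieBracket 𝓘(ℝ, E) V Y x : E) 0 := by
  have : IsManifold 𝓘(ℝ, E) 1 N := IsManifold.of_le (n := ∞) (by norm_num)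
  have : IsManifold 𝓘(ℝ, E) 2 N := IsManifold.of_le (n := ∞) (by
    exact_mod_cast ENat.LEInfty.out)
  set φ := extChartAt 𝓘(ℝ, E) x with hφ
  set z := φ x with hz
  have hxs : x ∈ φ.source := mem_extChartAt_source x
  have hzx : φ.symm z = x := φ.left_inv hxs
  set F : ℝ × E → E := fun p => φ (Φ p.1 (φ.symm p.2)) with hFdef
  have htgt : φ.target ∈ 𝓝 z := extChartAt_target_mem_nhds x
  have hsrc : φ.source ∈ 𝓝 x := extChartAt_source_mem_nhds x
  have hsymm : ContMDiffAt 𝓘(ℝ, E) 𝓘(ℝ, E) ∞ φ.symm z :=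
    (contMDiffOn_extChartAt_symm x).contMDiffAt htgt
  have hFsm : ContDiffAt ℝ ∞ F (0, z) := by
    have hφx : ContMDiffAt 𝓘(ℝ, E) 𝓘(ℝ, E) ∞ φ (Φ 0 (φ.symm z)) := by
      rw [h0, hzx]
      exact contMDiffAt_extChartAt
    have h2 : ContMDiffAt (𝓘(ℝ, ℝ).prod 𝓘(ℝ, E)) (𝓘(ℝ, ℝ).prod 𝓘(ℝ, E)) ∞
        (fun p : ℝ × E => (p.1, φ.symm p.2)) ((0 : ℝ), z) :=
      contMDiffAt_fst.prodMk (hsymm.comp ((0 : ℝ), z) contMDiffAt_snd)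
    have h3 := hφx.comp ((0 : ℝ), z) ((hΦ (0, φ.symm z)).comp ((0 : ℝ), z) h2)
    rw [← modelWithCornersSelf_prod, chartedSpaceSelf_prod] at h3
    exact h3.contDiffAt
  have hFsm2 : ContDiffAt ℝ 2 F (0, z) := hFsm.of_le (by exact_mod_cast ENat.LEInfty.out)
  have hφd : ∀ y ∈ φ.source, MDifferentiableAt 𝓘(ℝ, E) 𝓘(ℝ, E) φ y := by
    intro y hy
    apply mdifferentiableAt_extChartAt
    rwa [← extChartAt_source 𝓘(ℝ, E)]
  have hΦt : ∀ t, MDifferentiable 𝓘(ℝ, E) 𝓘(ℝ, E) (Φ t) := fun t =>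
    (hΦ.comp (contMDiff_const.prodMk contMDiff_id) : ContMDiff 𝓘(ℝ, E) 𝓘(ℝ, E) ∞
      (fun y : N => Φ t y)).mdifferentiable (by norm_num)
  have hΦy : ∀ y, MDifferentiable 𝓘(ℝ, ℝ) 𝓘(ℝ, E) (fun t => Φ t y) := fun y =>
    (hΦ.comp (contMDiff_id.prodMk contMDiff_const) : ContMDiff 𝓘(ℝ, ℝ) 𝓘(ℝ, E) ∞
      (fun t => Φ t y)).mdifferentiable (by norm_num)
  have hFd : ∀ᶠ p in 𝓝 ((0 : ℝ), z), DifferentiableAt ℝ F p := by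
    filter_upwards [hFsm2.eventually (by norm_num)] with p hp
    exact hp.differentiableAt (by norm_num)
  have hcont : Filter.Tendsto (fun t : ℝ => Φ t x) (𝓝 0) (𝓝 x) := by
    have := (hΦy x 0).continuousAt.tendsto
    rwa [h0] at this
  rw [mlieBracket_eq_lieBracket_coordField]
  have hζ2 : HasDerivAt (fun t => dE E E φ x (ζ t)) (VectorField.lieBracket ℝ (coordField E x V) (coordField E x Y) z) 0 := by
    refine hasDerivAt_pullback_vectorSpace hFsm2 ?_ ?_
      (differentiableAt_coordField hY) ?_
    · filter_upwards [htgt] with y hy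
      simp only [hFdef, h0, φ.right_inv hy]
    · filter_upwards [htgt, (Continuous.prodMk_right (0 : ℝ)).continuousAt.eventually hFd]
        with y hy hFy
      have hys : φ.symm y ∈ φ.source := φ.map_target hy
      have h1 : coordField E x V y = dE E E φ (φ.symm y) (V (φ.symm y)) := by
        rw [← coordField_apply V hys, φ.right_inv hy]
      have h2 : HasDerivAt (fun t : ℝ => F (t, y)) (fderiv ℝ F (0, y) (1, 0)) 0 :=
        HasFDerivAt.comp_hasDerivAt (f := fun t : ℝ => (t, y)) (0 : ℝ) hFy.hasFDerivAt
          ((hasDerivAt_id' (0 : ℝ)).prodMk (hasDerivAt_const 0 y))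
      have h3 : dE ℝ E (fun t : ℝ => φ (Φ t (φ.symm y))) (0 : ℝ) (1 : ℝ)
          = dE E E φ (φ.symm y) (V (φ.symm y)) := by
        rw [dE_comp_apply (g := φ) (f := fun t => Φ t (φ.symm y)) (0 : ℝ) (by
          rw [h0]; exact hφd _ hys) (hΦy _ _), hV, h0]
      rw [h1, ← h3, dE_eq_fderiv]
      exact h2.deriv
    · have hFt : ∀ᶠ t in 𝓝 (0 : ℝ), DifferentiableAt ℝ F (t, z) :=
        (Continuous.prodMk_left z).continuousAt.eventually hFd
      filter_upwards [hζ, hFt, hcont hsrc] with t ht hFt hts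
      have h1 : coordField E x Y (F (t, z)) = dE E E φ (Φ t x) (Y (Φ t x)) := by
        rw [← coordField_apply Y hts]
        simp only [hFdef, hzx]
        rfl
      rw [h1, ← ht, ← dE_comp_apply x (hφd _ hts) (hΦt t x)]
      have h2 : HasFDerivAt (fun y : E => F (t, y))
          ((fderiv ℝ F (t, z)).comp (ContinuousLinearMap.inr ℝ ℝ E)) z :=
        HasFDerivAt.comp z hFt.hasFDerivAt (hasFDerivAt_prodMk_right t z)
      have h3 : (fun y : N => φ (Φ t y)) =ᶠ[𝓝 x] fun y => (fun q : E => F (t, q)) (φ y) := by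
        filter_upwards [hsrc] with y hy
        simp only [hFdef, φ.left_inv hy]
      have h4 : dE E E (fun y : N => φ (Φ t y)) x = _ := dE_congr h3
      rw [h4, dE_comp_apply (g := fun q : E => F (t, q)) (f := φ) x
        h2.differentiableAt.mdifferentiableAt (hφd x hxs), dE_eq_fderiv]
      have h5 := h2.fderiv
      rw [show φ x = z from rfl, h5]
      rfl
  -- The preferred chart at x has the identity as derivative at x, so the statement in coordinates
  -- is already the desired one.
  have hid : ∀ u, dE E E φ x u = u := by
    intro u
    rw [dE_extChartAt_self]
    rfl
  simpa only [hid] using hζ2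

end Manifold

/-! ### One-parameter subgroups -/

/-- A solution of an autonomous ordinary differential equation is as smooth as the equation. -/
lemma contDiffAt_of_autonomous {E : Type*} [NormedAddCommGroup E] [NormedSpace ℝ E]
    {c : ℝ → E} {f : E → E} {t : ℝ} (hf : ContDiffAt ℝ ∞ f (c t))
    (hc : ∀ᶠ s in 𝓝 t, HasDerivAt c (f (c s)) s) : ContDiffAt ℝ ∞ c t := by
  rw [contDiffAt_infty]
  intro k
  induction k with
  | zero =>
    rw [Nat.cast_zero, contDiffAt_zero]
    exact ⟨_, hc, fun s hs => (HasDerivAt.continuousAt hs).continuousWithinAt⟩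
  -- Bootstrapping: if c is Cᵏ then its derivative f ∘ c is Cᵏ, so c is Cᵏ⁺¹.
  | succ k ih =>
    rw [Nat.cast_succ, contDiffAt_succ_iff_hasFDerivAt]
    refine ⟨fun s => ContinuousLinearMap.toSpanSingleton ℝ (f (c s)), ⟨_, hc, fun s hs => hs.hasFDerivAt⟩,
      ?_⟩
    have h1 : ContDiffAt ℝ k (fun s => f (c s)) t :=
      (contDiffAt_infty.1 hf k).comp t ih
    exact (ContinuousLinearMap.toSpanSingletonCLE (𝕜 := ℝ) (E := E)).contDiff.contDiffAt.comp t h1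

/-- The Euclidean space of dimension `n`. -/
abbrev Eu (n : ℕ) : Type := EuclideanSpace ℝ (Fin n)

section LieGroup

variable {n : ℕ} {G : Type*} [TopologicalSpace G] [ChartedSpace (Eu n) G]
  [Group G]

lemma mulInvariantVectorField_eq (X : GroupLieAlgebra (𝓡 n) G) (g : G) :
    (mulInvariantVectorField X g : Eu n) = dE (Eu n) (Eu n) (fun k => g * k) (1 : G) X := rfl

lemma isMIntegralCurve_iff {γ : ℝ → G} {X : GroupLieAlgebra (𝓡 n) G} :
    IsMIntegralCurve γ (mulInvariantVectorField (I := 𝓡 n) X) ↔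
      MDifferentiable 𝓘(ℝ, ℝ) (𝓡 n) γ ∧
        ∀ t, dE ℝ (Eu n) γ t (1 : ℝ) = mulInvariantVectorField X (γ t) := by
  constructor
  · intro h
    refine ⟨fun t => (h t).mdifferentiableAt, fun t => ?_⟩
    have h1 : dE ℝ (Eu n) γ t = (1 : ℝ →L[ℝ] ℝ).smulRight (mulInvariantVectorField X (γ t) : Eu n) :=
      (h t).mfderiv
    rw [h1]
    exact one_smul ℝ _
  · rintro ⟨h1, h2⟩ t
    have h3 : dE ℝ (Eu n) γ t
        = (1 : ℝ →L[ℝ] ℝ).smulRight (mulInvariantVectorField X (γ t) : Eu n) := by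
      ext
      rw [h2]
      exact (one_smul ℝ _).symm
    have h4 := (h1 t).hasMFDerivAt
    have h5 : mfderiv 𝓘(ℝ, ℝ) (𝓡 n) γ t = (1 : ℝ →L[ℝ] ℝ).smulRight
      (mulInvariantVectorField X (γ t) : Eu n) := h3
    rw [h5] at h4
    exact h4

lemma IsOneParameterSubgroup.map_zero {γ : ℝ → G} {X : GroupLieAlgebra (𝓡 n) G}
    (h : IsOneParameterSubgroup γ X) : γ 0 = 1 := by
  have := h.map_add 0 0
  rw [add_zero] at this
  exact left_eq_mul.1 this

lemma IsOneParameterSubgroup.mdiff {γ : ℝ → G} {X : GroupLieAlgebra (𝓡 n) G}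
    (h : IsOneParameterSubgroup γ X) : MDifferentiable 𝓘(ℝ, ℝ) (𝓡 n) γ :=
  h.smooth.mdifferentiable (by simp)

variable [LieGroup (𝓡 n) ∞ G]

lemma mdiff_mul_left (g k : G) : MDifferentiableAt (𝓡 n) (𝓡 n) (fun l : G => g * l) k :=
  (contMDiff_mul_left (I := 𝓡 n) (n := ∞)).mdifferentiable (by simp) k

lemma mdiff_mul_right (g k : G) : MDifferentiableAt (𝓡 n) (𝓡 n) (fun l : G => l * g) k :=
  (contMDiff_mul_right (I := 𝓡 n) (n := ∞)).mdifferentiable (by simp) k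

lemma dE_mul_left_mulInvariantVectorField (X : GroupLieAlgebra (𝓡 n) G) (g k : G) :
    dE (Eu n) (Eu n) (fun l => g * l) k (mulInvariantVectorField X k)
      = mulInvariantVectorField X (g * k) := by
  rw [mulInvariantVectorField_eq, mulInvariantVectorField_eq]
  have h1 := dE_comp_apply (E := Eu n) (E' := Eu n) (E'' := Eu n) (g := fun l : G => g * l)
    (f := fun l : G => k * l) (1 : G) (mdiff_mul_left g _) (mdiff_mul_left k _) X
  rw [mul_one] at h1
  rw [← h1]
  simp only [mul_assoc]

lemma contMDiff_mulInvariantVectorField_one (X : GroupLieAlgebra (𝓡 n) G) :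
    ContMDiff (𝓡 n) (𝓡 n).tangent 1
      (fun g => (⟨g, mulInvariantVectorField X g⟩ : TangentBundle (𝓡 n) G)) := by
  refine (contMDiff_mulInvariantVectorField (I := 𝓡 n) X).of_le ?_
  rw [minSmoothness_of_isRCLikeNormedField]
  norm_num

lemma dE_add_left {t : ℝ} (s : ℝ) : dE ℝ ℝ (fun s : ℝ => t + s) s (1 : ℝ) = 1 := by
  rw [dE_eq_fderiv, fderiv_const_add]
  simp

lemma mdiff_add_left (t s : ℝ) : MDifferentiableAt 𝓘(ℝ, ℝ) 𝓘(ℝ, ℝ) (fun s : ℝ => t + s) s :=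
  (differentiableAt_id.const_add t).mdifferentiableAt

lemma IsOneParameterSubgroup.isMIntegralCurve {γ : ℝ → G} {X : GroupLieAlgebra (𝓡 n) G}
    (h : IsOneParameterSubgroup γ X) :
    IsMIntegralCurve γ (mulInvariantVectorField (I := 𝓡 n) X) := by
  rw [isMIntegralCurve_iff]
  refine ⟨h.mdiff, fun t => ?_⟩
  have h1 := dE_comp_apply (E := ℝ) (E' := ℝ) (E'' := Eu n) (g := γ) (f := fun s : ℝ => t + s)
    (0 : ℝ) (h.mdiff _) (mdiff_add_left t 0) 1
  rw [dE_add_left, add_zero] at h1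
  have h2 := dE_comp_apply (E := ℝ) (E' := Eu n) (E'' := Eu n) (g := fun k : G => γ t * k) (f := γ)
    (0 : ℝ) (mdiff_mul_left _ _) (h.mdiff _) 1
  have h3 : dE ℝ (Eu n) γ (0 : ℝ) (1 : ℝ) = X := h.velocity
  rw [h.map_zero, h3] at h2
  rw [← h1, mulInvariantVectorField_eq, ← h2]
  simp only [h.map_add]

lemma IsMIntegralCurve.mul_left {γ : ℝ → G} {X : GroupLieAlgebra (𝓡 n) G}
    (h : IsMIntegralCurve γ (mulInvariantVectorField (I := 𝓡 n) X)) (g : G) :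
    IsMIntegralCurve (fun t => g * γ t) (mulInvariantVectorField (I := 𝓡 n) X) := by
  rw [isMIntegralCurve_iff] at h ⊢
  refine ⟨fun t => (mdiff_mul_left g _).comp t (h.1 t), fun t => ?_⟩
  rw [dE_comp_apply (E' := Eu n) (g := fun k : G => g * k) (f := γ) t (mdiff_mul_left g _) (h.1 t),
    h.2, dE_mul_left_mulInvariantVectorField]

/-- An integral curve through `1` of an invariant vector field is smooth near `0`. -/
lemma IsMIntegralCurve.contMDiffAt_zero {γ : ℝ → G} {X : GroupLieAlgebra (𝓡 n) G}
    (h : IsMIntegralCurve γ (mulInvariantVectorField (I := 𝓡 n) X)) (h0 : γ 0 = 1) :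
    ContMDiffAt 𝓘(ℝ, ℝ) (𝓡 n) ∞ γ 0 := by
  rw [isMIntegralCurve_iff] at h
  obtain ⟨X', hX'⟩ : ∃ X' : Eu n, X' = X := ⟨X, rfl⟩
  have hvel : ∀ t, dE ℝ (Eu n) γ t (1 : ℝ) = dE (Eu n) (Eu n) (fun k => γ t * k) (1 : G) X' := by
    subst hX'
    exact h.2
  clear hX'
  set φ := extChartAt (𝓡 n) (1 : G) with hφ
  set z := φ 1 with hz
  have hzx : φ.symm z = 1 := φ.left_inv (mem_extChartAt_source 1)
  have htgt : φ.target ∈ 𝓝 z := extChartAt_target_mem_nhds (1 : G)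
  have hsrc : φ.source ∈ 𝓝 (1 : G) := extChartAt_source_mem_nhds (1 : G)
  have hsymm : ContMDiffAt (𝓡 n) (𝓡 n) ∞ φ.symm z :=
    (contMDiffOn_extChartAt_symm (1 : G)).contMDiffAt htgt
  set m : Eu n × Eu n → Eu n := fun p => φ (φ.symm p.1 * φ.symm p.2) with hm
  have hmsm : ContDiffAt ℝ ∞ m (z, z) := by
    have h1 : ContMDiffAt ((𝓡 n).prod (𝓡 n)) (𝓡 n) ∞
        (fun p : Eu n × Eu n => φ.symm p.1 * φ.symm p.2) (z, z) :=
      (hsymm.comp (z, z) contMDiffAt_fst).mul (hsymm.comp (z, z) contMDiffAt_snd)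
    have h2 : ContMDiffAt (𝓡 n) (𝓡 n) ∞ φ (φ.symm z * φ.symm z) := by
      rw [hzx, one_mul]
      exact contMDiffAt_extChartAt
    have h3 := ContMDiffAt.comp (z, z) h2 h1
    rw [← modelWithCornersSelf_prod, chartedSpaceSelf_prod] at h3
    exact h3.contDiffAt
  -- This is the left-invariant field in the chart at 1, smooth because the multiplication m is. The
  -- curve solves the autonomous equation c' = f(c) in the chart.
  set f : Eu n → Eu n := fun y => fderiv ℝ m (y, z) (0, X') with hf
  have hfsm : ContDiffAt ℝ ∞ f z := by
    have h1 : ContDiffAt ℝ ∞ (fun y => fderiv ℝ m (y, z)) z :=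
      ContDiffAt.comp (f := fun y : Eu n => (y, z)) z (hmsm.fderiv_right (m := ∞) (by simp))
        (contDiffAt_id.prodMk contDiffAt_const)
    exact h1.clm_apply contDiffAt_const
  have hmd : ∀ᶠ y in 𝓝 z, DifferentiableAt ℝ m (y, z) := by
    have h1 : ∀ᶠ p in 𝓝 (z, z), DifferentiableAt ℝ m p := by
      filter_upwards [(hmsm.of_le (by simp : (1 : WithTop ℕ∞) ≤ ∞)).eventually (by simp)] with p hp
      exact hp.differentiableAt (by simp)
    exact (Continuous.prodMk_left z).continuousAt.eventually h1
  have hcont : Filter.Tendsto γ (𝓝 0) (𝓝 1) := by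
    have := (h.1 0).continuousAt.tendsto
    rwa [h0] at this
  have hcont' : Filter.Tendsto (fun t => φ (γ t)) (𝓝 0) (𝓝 z) :=
    (continuousAt_extChartAt (I := 𝓡 n) (1 : G)).tendsto.comp hcont
  have hφd : ∀ y ∈ φ.source, MDifferentiableAt (𝓡 n) (𝓡 n) φ y := by
    intro y hy
    apply mdifferentiableAt_extChartAt
    rwa [← extChartAt_source (𝓡 n)]
  have hode : ∀ᶠ t in 𝓝 (0 : ℝ), HasDerivAt (fun t => φ (γ t)) (f (φ (γ t))) t := by
    filter_upwards [hcont hsrc, hcont'.eventually hmd] with t hts hdt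
    have hd : MDifferentiableAt 𝓘(ℝ, ℝ) (𝓡 n) (fun t => φ (γ t)) t := (hφd _ hts).comp t (h.1 t)
    have h1 : dE ℝ (Eu n) (fun t => φ (γ t)) t 1 = f (φ (γ t)) := by
      rw [dE_comp_apply (E' := Eu n) (g := φ) (f := γ) t (hφd _ hts) (h.1 t), hvel]
      have h2 := dE_comp_apply (E := Eu n) (E' := Eu n) (E'' := Eu n) (g := φ)
        (f := fun k : G => γ t * k) (1 : G) (by rw [mul_one]; exact hφd _ hts)
        (mdiff_mul_left _ _) X'
      rw [mul_one] at h2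
      rw [← h2]
      have h3 : (fun k : G => φ (γ t * k)) =ᶠ[𝓝 1] fun k => m (φ (γ t), φ k) := by
        filter_upwards [hsrc] with k hk
        simp only [hm, φ.left_inv hk, φ.left_inv hts]
      have h4 : HasFDerivAt (fun q : Eu n => m (φ (γ t), q))
          ((fderiv ℝ m (φ (γ t), z)).comp (ContinuousLinearMap.inr ℝ (Eu n) (Eu n))) z :=
        HasFDerivAt.comp z hdt.hasFDerivAt (hasFDerivAt_prodMk_right (φ (γ t)) z)
      have h5 : dE (Eu n) (Eu n) (fun k : G => φ (γ t * k)) 1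
          = dE (Eu n) (Eu n) (fun k : G => m (φ (γ t), φ k)) 1 := dE_congr h3
      rw [h5, dE_comp_apply (E' := Eu n) (g := fun q : Eu n => m (φ (γ t), q)) (f := φ) (1 : G)
        h4.differentiableAt.mdifferentiableAt (hφd 1 (mem_extChartAt_source 1)), dE_eq_fderiv,
        dE_extChartAt_self]
      have h6 := h4.fderiv
      rw [show φ 1 = z from rfl, h6]
      rfl
    have h2 := hd.differentiableAt.hasDerivAt
    rw [← h1, dE_eq_fderiv]
    exact h2
  have hc0 : φ (γ 0) = z := by rw [h0]
  have hsm : ContDiffAt ℝ ∞ (fun t => φ (γ t)) 0 :=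
    contDiffAt_of_autonomous (by rw [hc0]; exact hfsm) hode
  rw [contMDiffAt_iff_target]
  refine ⟨(h.1 0).continuousAt, ?_⟩
  rw [h0]
  exact hsm.contMDiffAt

variable [T2Space G]

lemma IsOneParameterSubgroup.unique {γ γ' : ℝ → G} {X : GroupLieAlgebra (𝓡 n) G}
    (h : IsOneParameterSubgroup γ X) (h' : IsOneParameterSubgroup γ' X) : γ = γ' :=
  isMIntegralCurve_Ioo_eq_of_contMDiff_boundaryless (t₀ := 0)
    (contMDiff_mulInvariantVectorField_one X) h.isMIntegralCurve h'.isMIntegralCurve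
    (by rw [h.map_zero, h'.map_zero])

/-- Left translation carries the local solution through 1 to every point, so solutions exist for a
uniform time ε everywhere, and the field is complete. -/
lemma exists_isMIntegralCurve (X : GroupLieAlgebra (𝓡 n) G) :
    ∃ γ : ℝ → G, γ 0 = 1 ∧ IsMIntegralCurve γ (mulInvariantVectorField (I := 𝓡 n) X) := by
  have hv := contMDiff_mulInvariantVectorField_one X
  obtain ⟨γ, h0, hγ⟩ := exists_isMIntegralCurveAt_of_contMDiffAt_boundaryless (t₀ := 0)
    (hv.contMDiffAt (x := (1 : G)))
  obtain ⟨ε, hε, h⟩ := isMIntegralCurveAt_iff'.1 hγ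
  refine exists_isMIntegralCurve_of_isMIntegralCurveOn hv hε (fun g => ?_) 1
  refine ⟨fun t => g * γ t, by simp [h0], ?_⟩
  rw [Real.ball_eq_Ioo, zero_sub, zero_add, isMIntegralCurveOn_iff_isMIntegralCurveAt isOpen_Ioo]
    at h
  rw [isMIntegralCurveOn_iff_isMIntegralCurveAt isOpen_Ioo]
  intro t ht
  filter_upwards [h t ht] with s hs
  have h1 : HasMFDerivAt (𝓡 n) (𝓡 n) (fun k : G => g * k) (γ s)
      (mfderiv (𝓡 n) (𝓡 n) (fun k : G => g * k) (γ s)) := (mdiff_mul_left g _).hasMFDerivAt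
  have h2 := h1.comp s hs
  have h3 : (dE (Eu n) (Eu n) (fun k : G => g * k) (γ s)).comp
      ((1 : ℝ →L[ℝ] ℝ).smulRight (mulInvariantVectorField X (γ s) : Eu n))
      = (1 : ℝ →L[ℝ] ℝ).smulRight (mulInvariantVectorField X (g * γ s) : Eu n) := by
    refine ContinuousLinearMap.ext_ring ?_
    have h6 : ∀ v : Eu n, (1 : ℝ →L[ℝ] ℝ).smulRight v 1 = v := fun v => one_smul ℝ v
    exact (congrArg (dE (Eu n) (Eu n) (fun k : G => g * k) (γ s)) (h6 _)).trans
      ((dE_mul_left_mulInvariantVectorField X g (γ s)).trans (h6 _).symm)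
  have h4 : HasMFDerivAt 𝓘(ℝ, ℝ) (𝓡 n) (fun t => g * γ t) s
    ((dE (Eu n) (Eu n) (fun k : G => g * k) (γ s)).comp
      ((1 : ℝ →L[ℝ] ℝ).smulRight (mulInvariantVectorField X (γ s) : Eu n))) := h2
  exact (congrArg (fun T : ℝ →L[ℝ] Eu n =>
    HasMFDerivAt 𝓘(ℝ, ℝ) (𝓡 n) (fun t => g * γ t) s T) h3).mp h4

/-- Both t ↦ γ(s+t) and t ↦ γ(s)γ(t) are integral curves through γ(s), so they agree. Smoothness
near 0 spreads to all times by left translation. -/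
theorem exists_isOneParameterSubgroup (X : GroupLieAlgebra (𝓡 n) G) :
    ∃ γ : ℝ → G, IsOneParameterSubgroup γ X := by
  obtain ⟨γ, h0, h⟩ := exists_isMIntegralCurve X
  have hadd : ∀ s t, γ (s + t) = γ s * γ t := by
    intro s t
    have h1 : IsMIntegralCurve (fun t => γ (t + s)) (mulInvariantVectorField (I := 𝓡 n) X) :=
      h.comp_add s
    have h2 := IsMIntegralCurve.mul_left h (γ s)
    have h3 := isMIntegralCurve_Ioo_eq_of_contMDiff_boundaryless (t₀ := 0)
      (contMDiff_mulInvariantVectorField_one X) h1 h2 (by simp [h0])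
    rw [add_comm]
    exact congrFun h3 t
  refine ⟨γ, hadd, fun t => ?_, ?_⟩
  · have h1 : γ = fun s => γ t * γ (-t + s) := by
      ext s
      rw [← hadd]
      congr 1
      ring
    have h2 : ContMDiffAt 𝓘(ℝ, ℝ) (𝓡 n) ∞ γ (-t + t) := by
      rw [neg_add_cancel]
      exact IsMIntegralCurve.contMDiffAt_zero h h0
    have h3 : ContMDiffAt 𝓘(ℝ, ℝ) 𝓘(ℝ, ℝ) ∞ (fun s : ℝ => -t + s) t :=
      (contDiffAt_const.add contDiffAt_id).contMDiffAt
    rw [h1]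
    exact (contMDiffAt_mul_left).comp t (ContMDiffAt.comp t h2 h3)
  · have := (isMIntegralCurve_iff.1 h).2 0
    rw [h0, mulInvariantVectorField_eq] at this
    simp only [one_mul] at this
    rw [dE_id] at this
    exact this

/-- The one-parameter subgroup with velocity `X`. -/
def oneParam (X : GroupLieAlgebra (𝓡 n) G) : ℝ → G := (exists_isOneParameterSubgroup X).choose

lemma isOneParameterSubgroup_oneParam (X : GroupLieAlgebra (𝓡 n) G) :
    IsOneParameterSubgroup (oneParam X) X := (exists_isOneParameterSubgroup X).choose_spec

lemma lieExp_eq (X : GroupLieAlgebra (𝓡 n) G) : lieExp X = oneParam X 1 := by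
  rw [lieExp, dif_pos (exists_isOneParameterSubgroup X)]
  rfl

lemma oneParam_zero (X : GroupLieAlgebra (𝓡 n) G) : oneParam X 0 = 1 :=
  (isOneParameterSubgroup_oneParam X).map_zero

lemma oneParam_add (X : GroupLieAlgebra (𝓡 n) G) (s t : ℝ) :
    oneParam X (s + t) = oneParam X s * oneParam X t :=
  (isOneParameterSubgroup_oneParam X).map_add s t

lemma oneParam_neg (X : GroupLieAlgebra (𝓡 n) G) (t : ℝ) :
    oneParam X (-t) = (oneParam X t)⁻¹ := by
  rw [eq_inv_iff_mul_eq_one, ← oneParam_add, neg_add_cancel, oneParam_zero]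

lemma contMDiff_oneParam (X : GroupLieAlgebra (𝓡 n) G) :
    ContMDiff 𝓘(ℝ, ℝ) (𝓡 n) ∞ (oneParam X) := (isOneParameterSubgroup_oneParam X).smooth

lemma mdiff_oneParam (X : GroupLieAlgebra (𝓡 n) G) :
    MDifferentiable 𝓘(ℝ, ℝ) (𝓡 n) (oneParam X) := (isOneParameterSubgroup_oneParam X).mdiff

lemma dE_oneParam_zero (X : GroupLieAlgebra (𝓡 n) G) :
    dE ℝ (Eu n) (oneParam X) (0 : ℝ) (1 : ℝ) = X := (isOneParameterSubgroup_oneParam X).velocity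

end LieGroup

/-! ### The adjoint representation -/

section Adjoint

variable {n : ℕ} {G : Type*} [TopologicalSpace G] [ChartedSpace (Eu n) G]
  [Group G]

instance : FiniteDimensional ℝ (GroupLieAlgebra (𝓡 n) G) :=
  inferInstanceAs (FiniteDimensional ℝ (Eu n))

/-- The differential at the identity of an endomorphism of `G`. -/
def dHom (n : ℕ) {G : Type*} [TopologicalSpace G] [ChartedSpace (Eu n) G] [Group G] (f : G →* G) :
    GroupLieAlgebra (𝓡 n) G →ₗ[ℝ] GroupLieAlgebra (𝓡 n) G :=
  (show Eu n →L[ℝ] Eu n from dE (Eu n) (Eu n) f (1 : G)).toLinearMap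

/-- The adjoint representation. -/
def Ad (n : ℕ) {G : Type*} [TopologicalSpace G] [ChartedSpace (Eu n) G] [Group G] (g : G) :
    GroupLieAlgebra (𝓡 n) G →ₗ[ℝ] GroupLieAlgebra (𝓡 n) G :=
  dHom n (MulAut.conj g).toMonoidHom

lemma dHom_comp {f f' : G →* G} (hf : ContMDiff (𝓡 n) (𝓡 n) ∞ f)
    (hf' : ContMDiff (𝓡 n) (𝓡 n) ∞ f') : dHom n (f'.comp f) = dHom n f' ∘ₗ dHom n f := by
  ext1 X
  have h := dE_comp_apply (E := Eu n) (E' := Eu n) (E'' := Eu n) (g := f') (f := f) (1 : G)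
    (hf'.mdifferentiable (by simp) _) (hf.mdifferentiable (by simp) _) X
  rw [map_one] at h
  exact h

lemma dHom_id : dHom n (MonoidHom.id G) = LinearMap.id := by
  ext1 X
  have h := dE_id (E := Eu n) (1 : G)
  exact congrArg (fun T : Eu n →L[ℝ] Eu n => T X) h

lemma Ad_one : Ad n (1 : G) = LinearMap.id := by
  rw [Ad, ← dHom_id]
  congr 1
  ext l
  simp

lemma IsSymmetricPair.dInv_invol {σ : G →* G} {H : Subgroup G} (hσ : IsSymmetricPair n σ H)
    (X : GroupLieAlgebra (𝓡 n) G) : dInv n σ (dInv n σ X) = X := by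
  have h : dHom n (σ.comp σ) = dHom n σ ∘ₗ dHom n σ := dHom_comp hσ.smooth hσ.smooth
  have h2 : σ.comp σ = MonoidHom.id G := MonoidHom.ext hσ.involutive
  rw [h2, dHom_id] at h
  exact (LinearMap.congr_fun h X).symm

variable [LieGroup (𝓡 n) ∞ G]

lemma contMDiff_conj (g : G) :
    ContMDiff (𝓡 n) (𝓡 n) ∞ (MulAut.conj g).toMonoidHom := by
  have h : ContMDiff (𝓡 n) (𝓡 n) ∞ (fun k => g * k * g⁻¹) :=
    contMDiff_mul_right.comp contMDiff_mul_left
  exact h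

lemma Ad_mul (g k : G) : Ad n (g * k) = Ad n g ∘ₗ Ad n k := by
  rw [Ad, Ad, Ad, ← dHom_comp (contMDiff_conj k) (contMDiff_conj g)]
  congr 1
  ext l
  simp

lemma Ad_mul_apply (g k : G) (X : GroupLieAlgebra (𝓡 n) G) : Ad n (g * k) X = Ad n g (Ad n k X) := by
  rw [Ad_mul]
  rfl

lemma Ad_inv_Ad (g : G) (X : GroupLieAlgebra (𝓡 n) G) : Ad n g⁻¹ (Ad n g X) = X := by
  rw [← Ad_mul_apply, inv_mul_cancel, Ad_one]
  rfl

lemma Ad_Ad_inv (g : G) (X : GroupLieAlgebra (𝓡 n) G) : Ad n g (Ad n g⁻¹ X) = X := by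
  rw [← Ad_mul_apply, mul_inv_cancel, Ad_one]
  rfl

lemma dHom_Ad {f : G →* G} (hf : ContMDiff (𝓡 n) (𝓡 n) ∞ f) (g : G) :
    dHom n f ∘ₗ Ad n g = Ad n (f g) ∘ₗ dHom n f := by
  rw [Ad, Ad, ← dHom_comp (contMDiff_conj g) hf, ← dHom_comp hf (contMDiff_conj (f g))]
  congr 1
  ext l
  simp

/-- Right translation relates `Ad g X` to the left-invariant field of `X`. -/
lemma dE_mul_right_Ad (g : G) (X : GroupLieAlgebra (𝓡 n) G) :
    dE (Eu n) (Eu n) (fun k => k * g) (1 : G) (Ad n g X) = mulInvariantVectorField X g := by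
  have h := dE_comp_apply (E := Eu n) (E' := Eu n) (E'' := Eu n) (g := fun k : G => k * g)
    (f := fun k => g * k * g⁻¹) (1 : G) (mdiff_mul_right _ _)
    ((contMDiff_conj g).mdifferentiable (by simp) _) X
  rw [mul_one, mul_inv_cancel] at h
  simp only [inv_mul_cancel_right] at h
  exact h.symm

lemma dHom_mulInvariantVectorField {f : G →* G} (hf : ContMDiff (𝓡 n) (𝓡 n) ∞ f) (g : G)
    (X : GroupLieAlgebra (𝓡 n) G) :
    dE (Eu n) (Eu n) f g (mulInvariantVectorField X g)
      = mulInvariantVectorField (dHom n f X) (f g) := by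
  have h := dE_comp_apply (E := Eu n) (E' := Eu n) (E'' := Eu n) (g := f)
    (f := fun k => g * k) (1 : G) (hf.mdifferentiable (by simp) _) (mdiff_mul_left _ _) X
  have h' := dE_comp_apply (E := Eu n) (E' := Eu n) (E'' := Eu n) (g := fun k => f g * k)
    (f := f) (1 : G) (mdiff_mul_left _ _) (hf.mdifferentiable (by simp) _) X
  rw [mul_one] at h
  simp only [map_mul] at h
  rw [map_one] at h'
  exact h.symm.trans h'

/-- The differential of an automorphism of `G` preserves Lie brackets. -/
lemma dHom_lie {f f' : G →* G} (hf : ContMDiff (𝓡 n) (𝓡 n) ∞ f)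
    (hf' : ContMDiff (𝓡 n) (𝓡 n) ∞ f') (h : ∀ g, f' (f g) = g) (h' : ∀ g, f (f' g) = g)
    (X Y : GroupLieAlgebra (𝓡 n) G) : dHom n f ⁅X, Y⁆ = ⁅dHom n f X, dHom n f Y⁆ := by
  have hd := hf.mdifferentiable (by simp)
  have hd' := hf'.mdifferentiable (by simp)
  have hcomp : ∀ g, (dE (Eu n) (Eu n) f' (f g)).comp (dE (Eu n) (Eu n) f g)
      = ContinuousLinearMap.id ℝ (Eu n) := by
    intro g
    rw [← dE_comp (E' := Eu n) g (hd' _) (hd _), show f' ∘ f = fun g => g from funext h, dE_id]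
  have hcomp' : ∀ g, (dE (Eu n) (Eu n) f g).comp (dE (Eu n) (Eu n) f' (f g))
      = ContinuousLinearMap.id ℝ (Eu n) := by
    intro g
    have := dE_comp (E := Eu n) (E' := Eu n) (E'' := Eu n) (f g) (hd (f' (f g))) (hd' (f g))
    rw [h] at this
    rw [← this, show f ∘ f' = fun g => g from funext h', dE_id]
  have hinv : ∀ g, (dE (Eu n) (Eu n) f g).inverse = dE (Eu n) (Eu n) f' (f g) := fun g =>
    ContinuousLinearMap.inverse_eq (hcomp' g) (hcomp g)
  -- An automorphism pulls left-invariant fields back to left-invariant fields, so naturality of the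
  -- bracket of vector fields applies.
  have hpull : ∀ Z : GroupLieAlgebra (𝓡 n) G,
      VectorField.mpullback (𝓡 n) (𝓡 n) f (mulInvariantVectorField (dHom n f Z))
        = mulInvariantVectorField Z := by
    intro Z
    ext1 g
    have h1 := dHom_mulInvariantVectorField hf g Z
    show (dE (Eu n) (Eu n) f g).inverse (mulInvariantVectorField (dHom n f Z) (f g) : Eu n) = _
    rw [hinv, ← h1]
    exact congrArg (fun T : Eu n →L[ℝ] Eu n => T (mulInvariantVectorField Z g)) (hcomp g)
  have key := VectorField.mpullback_mlieBracket (I := 𝓡 n) (I' := 𝓡 n) (n := ∞) (f := f) (x₀ := 1)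
    (V := mulInvariantVectorField (dHom n f X)) (W := mulInvariantVectorField (dHom n f Y))
    (mdifferentiableAt_mulInvariantVectorField _) (mdifferentiableAt_mulInvariantVectorField _)
    (hf 1) (by
      rw [minSmoothness_of_isRCLikeNormedField]
      exact ENat.LEInfty.out)
  rw [hpull, hpull] at key
  have h1 : (⁅X, Y⁆ : GroupLieAlgebra (𝓡 n) G)
      = dE (Eu n) (Eu n) f' (1 : G) (⁅dHom n f X, dHom n f Y⁆ : GroupLieAlgebra (𝓡 n) G) := by
    have h2 : VectorField.mpullback (𝓡 n) (𝓡 n) f (VectorField.mlieBracket (𝓡 n)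
        (mulInvariantVectorField (dHom n f X)) (mulInvariantVectorField (dHom n f Y))) (1 : G)
        = (dE (Eu n) (Eu n) f (1 : G)).inverse (VectorField.mlieBracket (𝓡 n)
        (mulInvariantVectorField (dHom n f X)) (mulInvariantVectorField (dHom n f Y)) (f 1) : Eu n) :=
      rfl
    rw [hinv, map_one] at h2
    exact key.symm.trans h2
  have h3 := hcomp' 1
  rw [map_one] at h3
  have h4 := congrArg (fun T : Eu n →L[ℝ] Eu n =>
    T (⁅dHom n f X, dHom n f Y⁆ : GroupLieAlgebra (𝓡 n) G)) h3
  have h5 : dHom n f ⁅X, Y⁆ = dE (Eu n) (Eu n) f (1 : G) (dE (Eu n) (Eu n) f' (1 : G)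
      (⁅dHom n f X, dHom n f Y⁆ : GroupLieAlgebra (𝓡 n) G)) :=
    congrArg (dE (Eu n) (Eu n) f (1 : G)) h1
  exact h5.trans h4

lemma Ad_lie (g : G) (X Y : GroupLieAlgebra (𝓡 n) G) : Ad n g ⁅X, Y⁆ = ⁅Ad n g X, Ad n g Y⁆ :=
  dHom_lie (contMDiff_conj g) (contMDiff_conj g⁻¹) (fun k => by simp [mul_assoc])
    (fun k => by simp [mul_assoc]) X Y

/-- An automorphism of a Lie algebra preserves the Killing form. -/
lemma killingForm_map {L : Type*} [LieRing L] [LieAlgebra ℝ L] {f f' : L →ₗ[ℝ] L}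
    (hf : ∀ x y, f ⁅x, y⁆ = ⁅f x, f y⁆) (h : ∀ x, f' (f x) = x) (h' : ∀ x, f (f' x) = x) (x y : L) :
    killingForm ℝ L (f x) (f y) = killingForm ℝ L x y := by
  let e : L ≃ₗ⁅ℝ⁆ L :=
    { f with
      map_lie' := fun {x y} => hf x y
      invFun := f'
      left_inv := h
      right_inv := h' }
  exact LieAlgebra.killingForm_of_equiv_apply e x y

lemma killingForm_Ad (g : G) (x y : GroupLieAlgebra (𝓡 n) G) :
    killingForm ℝ (GroupLieAlgebra (𝓡 n) G) (Ad n g x) (Ad n g y)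
      = killingForm ℝ (GroupLieAlgebra (𝓡 n) G) x y :=
  killingForm_map (L := GroupLieAlgebra (𝓡 n) G) (f := Ad n g) (f' := Ad n g⁻¹) (Ad_lie g)
    (Ad_inv_Ad g) (Ad_Ad_inv g) x y

lemma IsSymmetricPair.isLieInvolution {σ : G →* G} {H : Subgroup G} (hσ : IsSymmetricPair n σ H) :
    IsLieInvolution (dInv n σ) where
  lie := dHom_lie hσ.smooth hσ.smooth hσ.involutive hσ.involutive
  invol := hσ.dInv_invol

lemma IsSymmetricPair.killing_invol {σ : G →* G} {H : Subgroup G} (hσ : IsSymmetricPair n σ H)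
    (x y : GroupLieAlgebra (𝓡 n) G) :
    killingForm ℝ (GroupLieAlgebra (𝓡 n) G) (dInv n σ x) y
      = killingForm ℝ (GroupLieAlgebra (𝓡 n) G) x (dInv n σ y) := by
  have h := killingForm_map hσ.isLieInvolution.lie hσ.dInv_invol hσ.dInv_invol x (dInv n σ y)
  rw [hσ.dInv_invol] at h
  exact h

lemma IsSymmetricPair.dInv_Ad {σ : G →* G} {H : Subgroup G} (hσ : IsSymmetricPair n σ H) {h : G}
    (hh : h ∈ H) (X : GroupLieAlgebra (𝓡 n) G) :
    dInv n σ (Ad n h X) = Ad n h (dInv n σ X) := by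
  have h1 := LinearMap.congr_fun (dHom_Ad hσ.smooth h) X
  rw [hσ.le_fixed h hh] at h1
  exact h1

end Adjoint

/-! ### The adjoint representation along one-parameter subgroups. -/

lemma exp_smul_mul_exp_smul_neg {A : Type*} [NormedRing A] [NormedAlgebra ℝ A] [CompleteSpace A]
    (x : A) (t : ℝ) : NormedSpace.exp (t • x) * NormedSpace.exp (t • (-x)) = 1 := by
  let _ : NormedAlgebra ℚ A := NormedAlgebra.restrictScalars ℚ ℝ A
  rw [smul_neg, ← NormedSpace.exp_add_of_commute (Commute.refl _).neg_right, add_neg_cancel,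
    NormedSpace.exp_zero]

lemma exp_zero_smul {A : Type*} [NormedRing A] [NormedAlgebra ℝ A] (x : A) :
    NormedSpace.exp ((0 : ℝ) • x) = 1 := by
  rw [zero_smul, NormedSpace.exp_zero]

lemma tensorRe_neg_I_smul {V : Type*} [AddCommGroup V] [Module ℝ V] (ξ : ℂ ⊗[ℝ] V) :
    tensorRe V (-Complex.I • ξ) = tensorIm V ξ := by
  induction ξ with
  | zero => simp
  | tmul z v =>
    rw [TensorProduct.smul_tmul', tensorRe_tmul, tensorIm_tmul]
    simp
  | add x y hx hy => rw [smul_add, map_add, map_add, hx, hy]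

section AdExp

variable {n : ℕ} {G : Type*} [TopologicalSpace G] [ChartedSpace (Eu n) G]
  [Group G]

/-- The adjoint action of the group, on the model vector space. -/
def AdE (n : ℕ) {G : Type*} [TopologicalSpace G] [ChartedSpace (Eu n) G]
    [Group G] (g : G) : Eu n →L[ℝ] Eu n :=
  dE (Eu n) (Eu n) (fun k => g * k * g⁻¹) (1 : G)

lemma AdE_one (X : Eu n) : AdE n (1 : G) X = X := by
  have h := LinearMap.congr_fun (Ad_one (n := n) (G := G)) X
  exact h

variable [LieGroup (𝓡 n) ∞ G]

/-- The adjoint action of the Lie algebra, on the model vector space. -/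
def adE (X : GroupLieAlgebra (𝓡 n) G) : Eu n →L[ℝ] Eu n :=
  LinearMap.toContinuousLinearMap
    (show Eu n →ₗ[ℝ] Eu n from LieAlgebra.ad ℝ (GroupLieAlgebra (𝓡 n) G) X)

lemma adE_apply (X Y : GroupLieAlgebra (𝓡 n) G) :
    adE X Y = (⁅X, Y⁆ : GroupLieAlgebra (𝓡 n) G) := rfl

lemma AdE_mul (g k : G) (X : Eu n) : AdE n (g * k) X = AdE n g (AdE n k X) :=
  Ad_mul_apply g k X

-- The real curve t ↦ exp(t ad w) Re(e^(−tμ)cX) has zero derivative, because ad w applied to Re(cX)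
-- is Re(cμX). Comparing t = 0 and t = 1 for all complex c recovers real and imaginary parts, so no
-- complex exponential of operators is needed.
open NormedSpace in
lemma actsAsExp_of_eq_exp {w : GroupLieAlgebra (𝓡 n) G}
    {U : GroupLieAlgebra (𝓡 n) G →ₗ[ℝ] GroupLieAlgebra (𝓡 n) G}
    (hU : ∀ Y : Eu n, (U Y : Eu n) = exp (adE w) Y) : ActsAsExp w U := by
  intro X μ hX
  let T₀ : ℂ →ₗ[ℝ] Eu n :=
    { toFun := fun c => (tensorRe (GroupLieAlgebra (𝓡 n) G) (c • X) : GroupLieAlgebra (𝓡 n) G)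
      map_add' := fun a b => by rw [add_smul, map_add]; rfl
      map_smul' := fun r a => by rw [smul_assoc, map_smul]; rfl }
  let T : ℂ →L[ℝ] Eu n := LinearMap.toContinuousLinearMap T₀
  have hT : ∀ c, T c = (tensorRe (GroupLieAlgebra (𝓡 n) G) (c • X) : GroupLieAlgebra (𝓡 n) G) :=
    fun c => rfl
  have hDT : ∀ c, adE w (T c) = T (c * μ) := by
    intro c
    rw [hT, hT, adE_apply, ← tensorRe_one_tmul_lie, tensor_lie_smul, hX, mul_smul]
  have hconst : ∀ c : ℂ, exp (adE w) (T (Complex.exp (-μ) * c)) = T c := by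
    intro c
    have hd : ∀ s : ℝ, HasDerivAt
        (fun t : ℝ => exp (t • adE w) (T (Complex.exp (-(t * μ)) * c))) 0 s := by
      intro s
      have h1 : HasDerivAt (fun t : ℝ => exp (t • adE w)) (exp (s • adE w) * adE w) s :=
        hasDerivAt_exp_smul_const (adE w) s
      have h2 : HasDerivAt (fun t : ℝ => Complex.exp (-(t * μ)) * c)
          (Complex.exp (-(s * μ)) * (-(1 * μ)) * c) s :=
        ((((Complex.ofRealCLM.hasDerivAt (x := s)).mul_const μ).neg).cexp).mul_const c
      have h3 := h1.clm_apply (T.hasFDerivAt.comp_hasDerivAt s h2)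
      have h4 : (exp (s • adE w) * adE w) (T (Complex.exp (-(s * μ)) * c))
          + exp (s • adE w) (T (Complex.exp (-(s * μ)) * (-(1 * μ)) * c)) = 0 := by
        show exp (s • adE w) (adE w (T (Complex.exp (-(s * μ)) * c)))
          + exp (s • adE w) (T (Complex.exp (-(s * μ)) * (-(1 * μ)) * c)) = 0
        rw [hDT, ← map_add, ← map_add]
        have : Complex.exp (-(s * μ)) * c * μ + Complex.exp (-(s * μ)) * (-(1 * μ)) * c = 0 := by
          ring
        rw [this, map_zero, map_zero]
      have h5 := h3
      simp only [Function.comp_apply] at h5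
      rw [h4] at h5
      exact h5
    have h4 := is_const_of_deriv_eq_zero (fun s => (hd s).differentiableAt)
      (fun s => (hd s).deriv) 1 0
    have h5 : exp ((0 : ℝ) • adE w) = 1 := exp_zero_smul (adE w)
    rw [h5] at h4
    simp only [one_smul, Complex.ofReal_one, one_mul, Complex.ofReal_zero,
      zero_mul, neg_zero, Complex.exp_zero] at h4
    exact h4
  have hre : ∀ c : ℂ, tensorRe (GroupLieAlgebra (𝓡 n) G) (c • U.baseChange ℂ X)
      = tensorRe (GroupLieAlgebra (𝓡 n) G) (c • (Complex.exp μ • X)) := by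
    intro c
    have h1 := hconst (c * Complex.exp μ)
    rw [show Complex.exp (-μ) * (c * Complex.exp μ) = c * (Complex.exp (-μ) * Complex.exp μ) by ring,
      ← Complex.exp_add, neg_add_cancel, Complex.exp_zero, mul_one, ← hU] at h1
    rw [← map_smul, tensorRe_baseChange, smul_smul]
    exact h1
  refine tensor_ext ?_ ?_
  · simpa using hre 1
  · have h := hre (-Complex.I)
    rwa [tensorRe_neg_I_smul, tensorRe_neg_I_smul] at h

variable [T2Space G]

lemma contMDiff_mul_oneParam (X : GroupLieAlgebra (𝓡 n) G) :
    ContMDiff (𝓘(ℝ, ℝ).prod (𝓡 n)) (𝓡 n) ∞ (fun p : ℝ × G => p.2 * oneParam X p.1) := by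
  have h1 : ContMDiff (𝓘(ℝ, ℝ).prod (𝓡 n)) (𝓡 n) ∞ (fun p : ℝ × G => oneParam X p.1) :=
    (contMDiff_oneParam X).comp contMDiff_fst
  exact contMDiff_snd.mul h1

lemma dE_mul_oneParam (X : GroupLieAlgebra (𝓡 n) G) (k : G) :
    dE ℝ (Eu n) (fun t => k * oneParam X t) (0 : ℝ) (1 : ℝ) = mulInvariantVectorField X k := by
  rw [dE_comp_apply (E' := Eu n) (g := fun l : G => k * l) (0 : ℝ) (mdiff_mul_left _ _)
    (mdiff_oneParam X _), oneParam_zero, dE_oneParam_zero]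
  rfl

/-- The flow of the left-invariant field of X is right translation by exp(tX). Pulling the
left-invariant field of Y back along it gives Ad(exp tX)Y at 1, so the derivative is the Lie bracket
of the two fields. -/
lemma hasDerivAt_AdE_zero (X : GroupLieAlgebra (𝓡 n) G) (Y : Eu n) :
    HasDerivAt (fun t => AdE n (oneParam X t) Y) (adE X Y) 0 := by
  have h := hasDerivAt_pullback (E := Eu n) (N := G) (Φ := fun t k => k * oneParam X t)
    (V := mulInvariantVectorField X)
    (Y := mulInvariantVectorField (I := 𝓡 n) (G := G) (show GroupLieAlgebra (𝓡 n) G from Y))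
    (x := (1 : G)) (ζ := fun t => AdE n (oneParam X t) Y)
    (contMDiff_mul_oneParam X) (fun k => by rw [oneParam_zero, mul_one]) (dE_mul_oneParam X)
    (mdifferentiableAt_mulInvariantVectorField _) (Filter.Eventually.of_forall fun t => by
      have h1 := dE_mul_right_Ad (oneParam X t) (show GroupLieAlgebra (𝓡 n) G from Y)
      rw [one_mul]
      exact h1)
  exact h

lemma hasDerivAt_AdE (X : GroupLieAlgebra (𝓡 n) G) (Y : Eu n) (t : ℝ) :
    HasDerivAt (fun t => AdE n (oneParam X t) Y) (adE X (AdE n (oneParam X t) Y)) t := by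
  have h := hasDerivAt_AdE_zero X (AdE n (oneParam X t) Y)
  have h1 : (fun s => AdE n (oneParam X s) (AdE n (oneParam X t) Y))
      = fun s => AdE n (oneParam X (s + t)) Y := by
    ext1 s
    rw [oneParam_add, AdE_mul]
  rw [h1] at h
  rw [← sub_self t] at h
  have h2 := h.comp_sub_const t t
  simpa using h2

open NormedSpace in
/-- `Ad(exp(tX)) = exp(t ad X)`. -/
theorem AdE_oneParam (X : GroupLieAlgebra (𝓡 n) G) (t : ℝ) :
    AdE n (oneParam X t) = exp (t • adE X) := by
  -- The product exp(−t ad X) Ad(exp tX) has zero derivative, by the differential equation for Ad.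
  have hconst : ∀ (Y : Eu n) (t : ℝ), exp (t • (-adE X)) (AdE n (oneParam X t) Y) = Y := by
    intro Y t
    have hd : ∀ s, HasDerivAt (fun t : ℝ => exp (t • (-adE X)) (AdE n (oneParam X t) Y)) 0 s := by
      intro s
      have h1 : HasDerivAt (fun t : ℝ => exp (t • (-adE X))) (exp (s • (-adE X)) * (-adE X)) s :=
        hasDerivAt_exp_smul_const (-adE X) s
      have h2 := h1.clm_apply (hasDerivAt_AdE X Y s)
      have h3 : (exp (s • (-adE X)) * (-adE X)) (AdE n (oneParam X s) Y)
          + exp (s • (-adE X)) (adE X (AdE n (oneParam X s) Y)) = 0 := by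
        show exp (s • (-adE X)) (-(adE X (AdE n (oneParam X s) Y)))
          + exp (s • (-adE X)) (adE X (AdE n (oneParam X s) Y)) = 0
        rw [map_neg, neg_add_cancel]
      rwa [h3] at h2
    have h4 := is_const_of_deriv_eq_zero (fun s => (hd s).differentiableAt)
      (fun s => (hd s).deriv) t 0
    have h5 : exp ((0 : ℝ) • (-adE X)) = 1 := exp_zero_smul (-adE X)
    rw [h4, h5, oneParam_zero, AdE_one]
    rfl
  ext1 Y
  have h1 : exp (t • adE X) * exp (t • (-adE X)) = 1 := exp_smul_mul_exp_smul_neg (adE X) t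
  have h2 := congrArg (fun T : Eu n →L[ℝ] Eu n => T (AdE n (oneParam X t) Y)) h1
  have h3 : exp (t • adE X) (exp (t • (-adE X)) (AdE n (oneParam X t) Y))
      = AdE n (oneParam X t) Y := h2
  rw [hconst] at h3
  exact h3.symm

end AdExp

/-! ### The homogeneous space -/

/-- A submersion has smooth local sections. -/
lemma exists_local_section {n d : ℕ} {N M : Type*} [TopologicalSpace N] [ChartedSpace (Eu n) N]
    [IsManifold (𝓡 n) ∞ N] [TopologicalSpace M] [ChartedSpace (Eu d) M] [IsManifold (𝓡 d) ∞ M]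
    {f : N → M} (hf : Manifold.IsSubmersion (𝓡 n) (𝓡 d) ∞ f) (k : N) :
    ∃ s : M → N, ContMDiffAt (𝓡 d) (𝓡 n) ∞ s (f k) ∧ s (f k) = k ∧ ∀ᶠ y in 𝓝 (f k), f (s y) = y := by
  have h := hf.isSubmersionAt k
  set φ := h.domChart with hφ
  set ψ := h.codChart with hψ
  set e := h.equiv
  have hk : k ∈ φ.source := h.mem_domChart_source
  have hk' : f k ∈ ψ.source := h.mem_codChart_source
  have hw : ∀ z ∈ φ.target, ψ (f (φ.symm z)) = (e z).1 := by
    intro z hz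
    have hz' : z ∈ (h.domChart.extend (𝓡 n)).target := by simpa using hz
    have h1 := h.writtenInCharts hz'
    simpa using h1
  have hu : ψ (f k) = (e (φ k)).1 := by
    rw [← hw _ (φ.map_source hk), φ.left_inv hk]
  -- In suitable charts the submersion is a linear projection; the section freezes the fibre
  -- coordinate at its value at k.
  set c : M → Eu n := fun y => e.symm (ψ y, (e (φ k)).2) with hc
  have hck : c (f k) = φ k := by
    simp only [hc, hu, Prod.mk.eta, ContinuousLinearEquiv.symm_apply_apply]
  have hψsm : ContMDiffAt (𝓡 d) (𝓡 d) ∞ ψ (f k) :=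
    (contMDiffOn_of_mem_maximalAtlas h.codChart_mem_maximalAtlas).contMDiffAt
      (ψ.open_source.mem_nhds hk')
  have hcsm : ContMDiffAt (𝓡 d) (𝓡 n) ∞ c (f k) := by
    have h1 : ContDiff ℝ ∞ (fun u : Eu d => e.symm (u, (e (φ k)).2)) :=
      e.symm.contDiff.comp (contDiff_id.prodMk contDiff_const)
    exact h1.contMDiff.contMDiffAt.comp (f k) hψsm
  have htgt : φ.target ∈ 𝓝 (c (f k)) := by
    rw [hck]
    exact φ.open_target.mem_nhds (φ.map_source hk)
  refine ⟨fun y => φ.symm (c y), ?_, (congrArg φ.symm hck).trans (φ.left_inv hk), ?_⟩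
  · exact ((contMDiffOn_symm_of_mem_maximalAtlas h.domChart_mem_maximalAtlas).contMDiffAt
      htgt).comp (f k) hcsm
  · filter_upwards [hcsm.continuousAt htgt, ψ.open_source.mem_nhds hk'] with y hy hyψ
    have h1 := hw _ hy
    have h2 : (e (c y)).1 = ψ y := by simp only [hc, ContinuousLinearEquiv.apply_symm_apply]
    rw [h2] at h1
    exact ψ.injOn (h.source_subset_preimage_source (φ.map_target hy)) hyψ h1

section Quotient

variable {n d : ℕ} {G : Type*} [TopologicalSpace G] [ChartedSpace (Eu n) G]
  [Group G] [LieGroup (𝓡 n) ∞ G] {H : Subgroup G} [ChartedSpace (Eu d) (G ⧸ H)]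

lemma smul_base (g : G) : g • base H = (g : G ⧸ H) := by
  rw [base, MulAction.Quotient.smul_coe, smul_eq_mul, mul_one]

lemma smul_coe (k g : G) : k • (g : G ⧸ H) = ((k * g : G) : G ⧸ H) := rfl

variable [IsManifold (𝓡 d) ∞ (G ⧸ H)]

/-- Near any point the action is (g,y) ↦ g s(y) H for a smooth local section s of the projection. -/
lemma contMDiff_smul (hπ : Manifold.IsSubmersion (𝓡 n) (𝓡 d) ∞ (fun k : G => (k : G ⧸ H))) :
    ContMDiff ((𝓡 n).prod (𝓡 d)) (𝓡 d) ∞ (fun p : G × (G ⧸ H) => p.1 • p.2) := by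
  rintro ⟨g, y⟩
  obtain ⟨k, rfl⟩ := QuotientGroup.mk_surjective y
  obtain ⟨s, hs, hsk, hsec⟩ := exists_local_section hπ k
  have h1 : ContMDiffAt ((𝓡 n).prod (𝓡 d)) (𝓡 n) ∞
      (fun p : G × (G ⧸ H) => p.1 * s p.2) (g, (k : G ⧸ H)) :=
    contMDiffAt_fst.mul (ContMDiffAt.comp (g, (k : G ⧸ H)) hs contMDiffAt_snd)
  have h2 := (hπ.contMDiff _).comp (g, (k : G ⧸ H)) h1
  refine h2.congr_of_eventuallyEq ?_
  filter_upwards [(continuousAt_snd (p := (g, (k : G ⧸ H)))).eventually hsec] with p hp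
  show p.1 • p.2 = ((p.1 * s p.2 : G) : G ⧸ H)
  have hp' : ((s p.2 : G) : G ⧸ H) = p.2 := hp
  rw [← smul_coe, hp']

lemma contMDiff_act (hπ : Manifold.IsSubmersion (𝓡 n) (𝓡 d) ∞ (fun k : G => (k : G ⧸ H))) (k : G) :
    ContMDiff (𝓡 d) (𝓡 d) ∞ (fun y : G ⧸ H => k • y) :=
  (contMDiff_smul hπ).comp (contMDiff_const.prodMk contMDiff_id)

lemma contMDiff_orbit (hπ : Manifold.IsSubmersion (𝓡 n) (𝓡 d) ∞ (fun k : G => (k : G ⧸ H)))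
    (y : G ⧸ H) : ContMDiff (𝓡 n) (𝓡 d) ∞ (fun k : G => k • y) :=
  (contMDiff_smul hπ).comp (contMDiff_id.prodMk contMDiff_const)

lemma mdiff_act (hπ : Manifold.IsSubmersion (𝓡 n) (𝓡 d) ∞ (fun k : G => (k : G ⧸ H))) (k : G) :
    MDifferentiable (𝓡 d) (𝓡 d) (fun y : G ⧸ H => k • y) :=
  (contMDiff_act hπ k).mdifferentiable (by simp)

lemma mdiff_orbit (hπ : Manifold.IsSubmersion (𝓡 n) (𝓡 d) ∞ (fun k : G => (k : G ⧸ H)))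
    (y : G ⧸ H) : MDifferentiable (𝓡 n) (𝓡 d) (fun k : G => k • y) :=
  (contMDiff_orbit hπ y).mdifferentiable (by simp)

lemma mdiff_proj (hπ : Manifold.IsSubmersion (𝓡 n) (𝓡 d) ∞ (fun k : G => (k : G ⧸ H))) :
    MDifferentiable (𝓡 n) (𝓡 d) (fun k : G => (k : G ⧸ H)) :=
  hπ.contMDiff.mdifferentiable (by simp)

/-- The differential at `e` of `k ↦ gkH`. -/
def gS (n d : ℕ) {G : Type*} [TopologicalSpace G] [ChartedSpace (Eu n) G]
    [Group G] (H : Subgroup G) [ChartedSpace (Eu d) (G ⧸ H)] (g : G) :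
    GroupLieAlgebra (𝓡 n) G →ₗ[ℝ] Eu d :=
  (show Eu n →L[ℝ] Eu d from
    dE (Eu n) (Eu d) (fun k : G => ((g * k : G) : G ⧸ H)) (1 : G)).toLinearMap

lemma gS_apply (g : G) (X : GroupLieAlgebra (𝓡 n) G) :
    gS n d H g X = dE (Eu n) (Eu d) (fun k : G => ((g * k : G) : G ⧸ H)) (1 : G) X := rfl

lemma gS_one_eq (X : GroupLieAlgebra (𝓡 n) G) :
    gS n d H 1 X = dE (Eu n) (Eu d) (fun k : G => (k : G ⧸ H)) (1 : G) X := by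
  rw [gS_apply]
  simp only [one_mul]

lemma dE_act_gS (hπ : Manifold.IsSubmersion (𝓡 n) (𝓡 d) ∞ (fun k : G => (k : G ⧸ H))) (k g : G)
    (X : GroupLieAlgebra (𝓡 n) G) :
    dE (Eu d) (Eu d) (fun y : G ⧸ H => k • y) (g : G ⧸ H) (gS n d H g X) = gS n d H (k * g) X := by
  have h := dE_comp_apply (E := Eu n) (E' := Eu d) (E'' := Eu d) (g := fun y : G ⧸ H => k • y)
    (f := fun l : G => ((g * l : G) : G ⧸ H)) (1 : G) (mdiff_act hπ k _)
    ((mdiff_proj hπ _).comp _ (mdiff_mul_left g _)) X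
  rw [mul_one] at h
  rw [gS_apply, gS_apply, ← h]
  simp only [smul_coe, mul_assoc]

lemma gStar_eq (hπ : Manifold.IsSubmersion (𝓡 n) (𝓡 d) ∞ (fun k : G => (k : G ⧸ H))) (g : G)
    (X : GroupLieAlgebra (𝓡 n) G) : (gStar n d H g X : Eu d) = gS n d H g X := by
  have h := dE_act_gS hπ g 1 X
  rw [gS_one_eq, mul_one] at h
  exact h

/-- For h ∈ H, ghkH = g(hkh⁻¹)H. This measures how g_* depends on the representative of the coset.
-/
lemma gS_mul_of_mem (hπ : Manifold.IsSubmersion (𝓡 n) (𝓡 d) ∞ (fun k : G => (k : G ⧸ H))) (g : G)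
    {h : G} (hh : h ∈ H) (X : GroupLieAlgebra (𝓡 n) G) :
    gS n d H (g * h) X = gS n d H g (Ad n h X) := by
  have h1 := dE_comp_apply (E := Eu n) (E' := Eu n) (E'' := Eu d)
    (g := fun l : G => ((g * l : G) : G ⧸ H)) (f := fun k : G => h * k * h⁻¹) (1 : G)
    ((mdiff_proj hπ _).comp _ (mdiff_mul_left g _))
    ((contMDiff_conj h).mdifferentiable (by simp) _) X
  rw [mul_one, mul_inv_cancel] at h1
  refine Eq.trans ?_ h1
  rw [gS_apply]
  congr 3
  ext k
  rw [QuotientGroup.eq]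
  have : (g * h * k)⁻¹ * (g * (h * k * h⁻¹)) = h⁻¹ := by group
  rw [this]
  exact inv_mem hh

lemma dE_orbit (hπ : Manifold.IsSubmersion (𝓡 n) (𝓡 d) ∞ (fun k : G => (k : G ⧸ H))) (g : G)
    (X : GroupLieAlgebra (𝓡 n) G) :
    dE (Eu n) (Eu d) (fun k : G => k • (g : G ⧸ H)) (1 : G) X = gS n d H g (Ad n g⁻¹ X) := by
  have h1 := dE_comp_apply (E := Eu n) (E' := Eu n) (E'' := Eu d)
    (g := fun l : G => ((g * l : G) : G ⧸ H)) (f := fun k : G => g⁻¹ * k * g⁻¹⁻¹) (1 : G)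
    ((mdiff_proj hπ _).comp _ (mdiff_mul_left g _))
    ((contMDiff_conj g⁻¹).mdifferentiable (by simp) _) X
  rw [mul_one, mul_inv_cancel] at h1
  refine Eq.trans ?_ h1
  congr 3
  ext k
  rw [smul_coe]
  congr 1
  group

lemma gS_surjective (hπ : Manifold.IsSubmersion (𝓡 n) (𝓡 d) ∞ (fun k : G => (k : G ⧸ H))) (g : G) :
    Function.Surjective (gS n d H g) := by
  intro v
  obtain ⟨s, hs, hsk, hsec⟩ := exists_local_section hπ g
  have hsd : MDifferentiableAt (𝓡 d) (𝓡 n) s (g : G ⧸ H) := hs.mdifferentiableAt (by simp)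
  have h1 := dE_comp_apply (E := Eu d) (E' := Eu n) (E'' := Eu d) (g := fun l : G => (l : G ⧸ H))
    (f := s) (g : G ⧸ H) (mdiff_proj hπ _) hsd v
  have h2 : dE (Eu d) (Eu d) (fun y => ((s y : G) : G ⧸ H)) (g : G ⧸ H)
      = dE (Eu d) (Eu d) (fun y => y) (g : G ⧸ H) := dE_congr hsec
  rw [h2, dE_id, hsk] at h1
  set u := dE (Eu d) (Eu n) s (g : G ⧸ H) v with hu
  refine ⟨dE (Eu n) (Eu n) (fun l : G => g⁻¹ * l) g u, ?_⟩
  have h3 := dE_comp_apply (E := Eu n) (E' := Eu n) (E'' := Eu d)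
    (g := fun l : G => ((g * l : G) : G ⧸ H)) (f := fun l : G => g⁻¹ * l) g
    ((mdiff_proj hπ _).comp _ (mdiff_mul_left g _)) (mdiff_mul_left _ _) u
  rw [inv_mul_cancel] at h3
  simp only [mul_inv_cancel_left] at h3
  exact h3.symm.trans h1.symm

variable [T2Space G]

lemma oneParam_of_fixed {σ : G →* G} (hσ : IsSymmetricPair n σ H) {X : GroupLieAlgebra (𝓡 n) G}
    (hX : dInv n σ X = X) (t : ℝ) : σ (oneParam X t) = oneParam X t := by
  have h : IsOneParameterSubgroup (fun t => σ (oneParam X t)) X := by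
    refine ⟨fun s t => by rw [oneParam_add, map_mul], hσ.smooth.comp (contMDiff_oneParam X), ?_⟩
    have h1 := dE_comp_apply (E := ℝ) (E' := Eu n) (E'' := Eu n) (g := σ) (f := oneParam X) (0 : ℝ)
      (hσ.smooth.mdifferentiable (by simp) _) (mdiff_oneParam X _) (1 : ℝ)
    rw [dE_oneParam_zero, oneParam_zero] at h1
    exact h1.trans hX
  exact congrFun (h.unique (isOneParameterSubgroup_oneParam X)) t

/-- The whole curve is connected, passes through 1 and is fixed by σ, so it lies in the identity
component of Fix σ. -/
lemma oneParam_mem {σ : G →* G} (hσ : IsSymmetricPair n σ H) {X : GroupLieAlgebra (𝓡 n) G}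
    (hX : dInv n σ X = X) (t : ℝ) : oneParam X t ∈ H := by
  have h1 : IsPreconnected (Set.range (oneParam X)) :=
    isPreconnected_range (contMDiff_oneParam X).continuous
  have h2 : Set.range (oneParam X) ⊆ {g : G | σ g = g} := by
    rintro _ ⟨t, rfl⟩
    exact oneParam_of_fixed hσ hX t
  have h3 := h1.subset_connectedComponentIn (x := 1) ⟨0, oneParam_zero X⟩ h2
  exact hσ.component_le (h3 ⟨t, rfl⟩)

lemma dInv_eq_of_oneParam_mem {σ : G →* G} (hσ : IsSymmetricPair n σ H)
    {X : GroupLieAlgebra (𝓡 n) G} (hX : ∀ t, oneParam X t ∈ H) : dInv n σ X = X := by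
  have h1 := dE_comp_apply (E := ℝ) (E' := Eu n) (E'' := Eu n) (g := σ) (f := oneParam X) (0 : ℝ)
    (hσ.smooth.mdifferentiable (by simp) _) (mdiff_oneParam X _) (1 : ℝ)
  simp only [fun t => hσ.le_fixed _ (hX t)] at h1
  rw [dE_oneParam_zero, oneParam_zero] at h1
  exact h1.symm

lemma dE_proj_oneParam (hπ : Manifold.IsSubmersion (𝓡 n) (𝓡 d) ∞ (fun k : G => (k : G ⧸ H)))
    (g : G) (X : GroupLieAlgebra (𝓡 n) G) (t : ℝ) :
    dE ℝ (Eu d) (fun t => ((g * oneParam X t : G) : G ⧸ H)) t (1 : ℝ)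
      = gS n d H (g * oneParam X t) X := by
  have h1 : (fun s => ((g * oneParam X s : G) : G ⧸ H))
      = fun s => (fun l : G => ((g * oneParam X t * l : G) : G ⧸ H)) (oneParam X (-t + s)) := by
    ext1 s
    show ((g * oneParam X s : G) : G ⧸ H) = ((g * oneParam X t * oneParam X (-t + s) : G) : G ⧸ H)
    rw [mul_assoc, ← oneParam_add, add_neg_cancel_left]
  have h0 : MDifferentiable 𝓘(ℝ, ℝ) (𝓡 n) (fun s => oneParam X (-t + s)) := fun s =>
    (mdiff_oneParam X _).comp s (mdiff_add_left (-t) s)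
  rw [h1, dE_comp_apply (E' := Eu n) (g := fun l : G => ((g * oneParam X t * l : G) : G ⧸ H)) t
    ((mdiff_proj hπ _).comp _ (mdiff_mul_left _ _)) (h0 t),
    dE_comp_apply (E' := ℝ) (g := oneParam X) (f := fun s => -t + s) t (mdiff_oneParam X _)
    (mdiff_add_left (-t) t), dE_add_left, neg_add_cancel, oneParam_zero, dE_oneParam_zero]
  rfl

/-- The kernel of the differential of the projection is `𝔥`. -/
theorem gS_eq_zero_iff (hπ : Manifold.IsSubmersion (𝓡 n) (𝓡 d) ∞ (fun k : G => (k : G ⧸ H)))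
    {σ : G →* G} (hσ : IsSymmetricPair n σ H) (g : G) (X : GroupLieAlgebra (𝓡 n) G) :
    gS n d H g X = 0 ↔ dInv n σ X = X := by
  have hzero : ∀ (g : G) (Z : GroupLieAlgebra (𝓡 n) G), dInv n σ Z = Z → gS n d H g Z = 0 := by
    intro g Z hZ
    have h1 := dE_proj_oneParam hπ g Z 0
    rw [oneParam_zero, mul_one] at h1
    rw [← h1]
    have h2 : (fun t => ((g * oneParam Z t : G) : G ⧸ H)) = fun _ => (g : G ⧸ H) := by
      ext1 t
      rw [QuotientGroup.eq]
      have : (g * oneParam Z t)⁻¹ * g = (oneParam Z t)⁻¹ := by group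
      rw [this]
      exact inv_mem (oneParam_mem hσ hZ t)
    rw [h2, dE_const]
    rfl
  refine ⟨fun h => ?_, hzero g X⟩
  set Z := antiPart (dInv n σ) X with hZ
  have hdec := fixPart_add_antiPart (θ := dInv n σ) X
  have hfix : gS n d H g (fixPart (dInv n σ) X) = 0 :=
    hzero g _ (mem_fixSub.1 (hσ.isLieInvolution.fixPart_mem X))
  have hgZ : gS n d H g Z = 0 := by
    rw [← hdec, map_add, hfix, zero_add] at h
    exact h
  -- The action makes the kernel independent of the point, so t ↦ exp(tZ)H has zero velocity and is
  -- constant. Hence exp(tZ) ∈ H and θZ = Z; as also θZ = −Z, the 𝔮-component Z vanishes.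
  have hall : ∀ k, gS n d H k Z = 0 := by
    intro k
    have h1 := dE_act_gS hπ (k * g⁻¹) g Z
    rw [hgZ, map_zero, inv_mul_cancel_right] at h1
    exact h1.symm
  have hconst : ∀ t, ((1 * oneParam Z t : G) : G ⧸ H) = ((1 * oneParam Z 0 : G) : G ⧸ H) := by
    intro t
    refine eq_of_velocity_eq_zero (E := Eu d) (c := fun t => ((1 * oneParam Z t : G) : G ⧸ H)) ?_
      (fun t => by rw [dE_proj_oneParam hπ, hall]) t
    exact fun t => (mdiff_proj hπ _).comp t ((mdiff_mul_left 1 _).comp t (mdiff_oneParam Z t))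
  have hmem : ∀ t, oneParam Z t ∈ H := by
    intro t
    have h1 := hconst t
    rw [oneParam_zero, one_mul, one_mul, eq_comm, QuotientGroup.eq] at h1
    simpa using h1
  have h1 := dInv_eq_of_oneParam_mem hσ hmem
  have h2 : antiPart (dInv n σ) Z = 0 := antiPart_of_mem_fix (mem_fixSub.2 h1)
  rw [antiPart_of_mem (hσ.isLieInvolution.antiPart_mem X)] at h2
  rw [h2, add_zero] at hdec
  rw [← hdec]
  exact mem_fixSub.1 (hσ.isLieInvolution.fixPart_mem X)

end Quotient

/-- The inverse of a bijective continuous linear map between finite-dimensional spaces. -/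
lemma inverse_apply_of_bijective {V W : Type*} [AddCommGroup V] [Module ℝ V] [TopologicalSpace V]
    [IsTopologicalAddGroup V] [ContinuousSMul ℝ V] [T2Space V] [FiniteDimensional ℝ V]
    [AddCommGroup W] [Module ℝ W] [TopologicalSpace W] [IsTopologicalAddGroup W]
    [ContinuousSMul ℝ W] [T2Space W] [FiniteDimensional ℝ W] (T : V →L[ℝ] W)
    (hT : Function.Bijective T) (v : V) : T.inverse (T v) = v := by
  let e : V ≃L[ℝ] W := (LinearEquiv.ofBijective T.toLinearMap hT).toContinuousLinearEquiv
  have he : T = (e : V →L[ℝ] W) := by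
    ext u
    rfl
  rw [he, ContinuousLinearMap.inverse_equiv]
  exact e.symm_apply_apply v

lemma IsSymmetricPair.antiPart_Ad {n : ℕ} {G : Type*} [TopologicalSpace G] [ChartedSpace (Eu n) G]
    [Group G] [LieGroup (𝓡 n) ∞ G] {H : Subgroup G} {σ : G →* G} (hσ : IsSymmetricPair n σ H) {h : G}
    (hh : h ∈ H) (X : GroupLieAlgebra (𝓡 n) G) :
    antiPart (dInv n σ) (Ad n h X) = Ad n h (antiPart (dInv n σ) X) := by
  rw [antiPart_apply, antiPart_apply, hσ.dInv_Ad hh, map_smul, map_sub]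

/-! ### The isomorphism of 𝔮 with tangent spaces, the invariant metric, and tangent and normal
spaces of orbits. -/

section Quotient

variable {n d : ℕ} {G : Type*} [TopologicalSpace G] [ChartedSpace (Eu n) G]
  [Group G] {H : Subgroup G} [ChartedSpace (Eu d) (G ⧸ H)]

instance : T2Space (GroupLieAlgebra (𝓡 n) G) := inferInstanceAs (T2Space (Eu n))

instance : ContinuousSMul ℝ (GroupLieAlgebra (𝓡 n) G) := inferInstanceAs (ContinuousSMul ℝ (Eu n))

instance (y : G ⧸ H) : T2Space (TangentSpace (𝓡 d) y) := inferInstanceAs (T2Space (Eu d))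

instance (y : G ⧸ H) : ContinuousSMul ℝ (TangentSpace (𝓡 d) y) :=
  inferInstanceAs (ContinuousSMul ℝ (Eu d))

instance (y : G ⧸ H) : FiniteDimensional ℝ (TangentSpace (𝓡 d) y) :=
  inferInstanceAs (FiniteDimensional ℝ (Eu d))

/-- `g_*⁻¹`, on the model vector space. -/
def gI (n d : ℕ) {G : Type*} [TopologicalSpace G] [ChartedSpace (Eu n) G] [Group G] (σ : G →* G)
    (H : Subgroup G) [ChartedSpace (Eu d) (G ⧸ H)] (g : G) :
    Eu d →ₗ[ℝ] GroupLieAlgebra (𝓡 n) G :=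
  gStarInv n d σ H g

variable [LieGroup (𝓡 n) ∞ G] [IsManifold (𝓡 d) ∞ (G ⧸ H)] [T2Space G]
  (hπ : Manifold.IsSubmersion (𝓡 n) (𝓡 d) ∞ (fun k : G => (k : G ⧸ H)))
  {σ : G →* G} (hσ : IsSymmetricPair n σ H)

include hπ hσ

lemma gS_antiPart (g : G) (X : GroupLieAlgebra (𝓡 n) G) :
    gS n d H g (antiPart (dInv n σ) X) = gS n d H g X := by
  have h1 := fixPart_add_antiPart (dInv n σ) X
  have h2 : gS n d H g (fixPart (dInv n σ) X) = 0 :=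
    (gS_eq_zero_iff hπ hσ g _).2 (mem_fixSub.1 (hσ.isLieInvolution.fixPart_mem X))
  conv_rhs => rw [← h1, map_add, h2, zero_add]

/-- The kernel of g_* is 𝔥, so g_* is bijective on 𝔮 and kills the 𝔥-component of X. Bijectivity
matters because `ContinuousLinearMap.inverse` is 0 on maps that are not invertible. -/
lemma gI_gS (g : G) (X : GroupLieAlgebra (𝓡 n) G) :
    gI n d σ H g (gS n d H g X) = antiPart (dInv n σ) X := by
  set T : qSub n σ →L[ℝ] TangentSpace (𝓡 d) (g • base H) :=
    (gStar n d H g).comp (qSub n σ).subtypeL with hT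
  have hTa : ∀ Y : qSub n σ, (T Y : Eu d) = gS n d H g (Y : GroupLieAlgebra (𝓡 n) G) :=
    fun Y => gStar_eq hπ g _
  have hbij : Function.Bijective T := by
    constructor
    · refine (injective_iff_map_eq_zero T).2 fun Y hY => ?_
      have h1 : gS n d H g (Y : GroupLieAlgebra (𝓡 n) G) = 0 := (hTa Y).symm.trans hY
      rw [gS_eq_zero_iff hπ hσ] at h1
      have h2 : dInv n σ Y = -(Y : GroupLieAlgebra (𝓡 n) G) := mem_antiSub.1 Y.2
      rw [h1] at h2
      have h3 : (2 : ℝ) • (Y : GroupLieAlgebra (𝓡 n) G) = 0 := by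
        rw [two_smul]
        exact eq_neg_iff_add_eq_zero.1 h2
      exact Subtype.ext ((smul_eq_zero_iff_right (by norm_num)).1 h3)
    · intro v
      obtain ⟨X, hX⟩ := gS_surjective hπ g v
      refine ⟨⟨antiPart (dInv n σ) X, hσ.isLieInvolution.antiPart_mem X⟩, ?_⟩
      refine (hTa _).trans ?_
      exact (gS_antiPart hπ hσ g X).trans hX
  have h1 := inverse_apply_of_bijective T hbij
    ⟨antiPart (dInv n σ) X, hσ.isLieInvolution.antiPart_mem X⟩
  have h2 : gI n d σ H g (gS n d H g X)
      = (T.inverse (T ⟨antiPart (dInv n σ) X, hσ.isLieInvolution.antiPart_mem X⟩) : qSub n σ) := by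
    have h3 := (hTa ⟨antiPart (dInv n σ) X, hσ.isLieInvolution.antiPart_mem X⟩).trans
      (gS_antiPart hπ hσ g X)
    rw [← h3]
    rfl
  rw [h2, h1]

lemma gS_gI (g : G) (v : Eu d) : gS n d H g (gI n d σ H g v) = v := by
  obtain ⟨X, rfl⟩ := gS_surjective hπ g v
  rw [gI_gS hπ hσ, gS_antiPart hπ hσ]

lemma gI_mem (g : G) (v : Eu d) : gI n d σ H g v ∈ LinearMap.ker (dInv n σ + LinearMap.id) := by
  obtain ⟨X, rfl⟩ := gS_surjective hπ g v
  rw [gI_gS hπ hσ]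
  exact hσ.isLieInvolution.antiPart_mem X

/-- The metric does not depend on the representative. -/
theorem metric_gS (g : G) (X Y : GroupLieAlgebra (𝓡 n) G) :
    metric n d σ (g : G ⧸ H) (gS n d H g X) (gS n d H g Y)
      = killingForm ℝ (GroupLieAlgebra (𝓡 n) G) (antiPart (dInv n σ) X)
          (antiPart (dInv n σ) Y) := by
  set g' := (g : G ⧸ H).out with hg'
  -- The representative g' used in `metric` is gh with h ∈ H. This changes g_*⁻¹ by Ad(h⁻¹), which
  -- commutes with θ and preserves the Killing form.
  have hmem : g⁻¹ * g' ∈ H := by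
    rw [← QuotientGroup.eq, hg', QuotientGroup.out_eq']
  have hI : ∀ X, gI n d σ H g' (gS n d H g X)
      = Ad n (g⁻¹ * g')⁻¹ (antiPart (dInv n σ) X) := by
    intro X
    have h1 := gS_mul_of_mem hπ g hmem (Ad n (g⁻¹ * g')⁻¹ X)
    rw [Ad_Ad_inv, mul_inv_cancel_left] at h1
    rw [← h1, gI_gS hπ hσ, hσ.antiPart_Ad (inv_mem hmem)]
  have h1 : metric n d σ (g : G ⧸ H) (gS n d H g X) (gS n d H g Y)
      = killingForm ℝ (GroupLieAlgebra (𝓡 n) G) (gI n d σ H g' (gS n d H g X))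
        (gI n d σ H g' (gS n d H g Y)) := rfl
  rw [h1, hI, hI, killingForm_Ad]

lemma metric_eq (g : G) (u v : Eu d) :
    metric n d σ (g : G ⧸ H) u v = killingForm ℝ (GroupLieAlgebra (𝓡 n) G) (gI n d σ H g u)
      (gI n d σ H g v) := by
  obtain ⟨X, rfl⟩ := gS_surjective hπ g u
  obtain ⟨Y, rfl⟩ := gS_surjective hπ g v
  rw [metric_gS hπ hσ, gI_gS hπ hσ, gI_gS hπ hσ]

/-- The metric is invariant under the action of `G`. -/
theorem metric_act (k g : G) (u v : Eu d) :
    metric n d σ ((k * g : G) : G ⧸ H)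
      (dE (Eu d) (Eu d) (fun y : G ⧸ H => k • y) (g : G ⧸ H) u)
      (dE (Eu d) (Eu d) (fun y : G ⧸ H => k • y) (g : G ⧸ H) v) = metric n d σ (g : G ⧸ H) u v := by
  obtain ⟨X, rfl⟩ := gS_surjective hπ g u
  obtain ⟨Y, rfl⟩ := gS_surjective hπ g v
  rw [dE_act_gS hπ, dE_act_gS hπ, metric_gS hπ hσ, metric_gS hπ hσ]

lemma mem_orbitTangent (g : G) (v : Eu d) :
    v ∈ orbitTangent n d σ (g : G ⧸ H) ↔ ∃ X, dInv n σ X = X ∧ gS n d H g (Ad n g⁻¹ X) = v := by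
  constructor
  · rintro ⟨X, hX, rfl⟩
    exact ⟨X, mem_fixSub.1 hX, (dE_orbit hπ g X).symm⟩
  · rintro ⟨X, hX, rfl⟩
    exact ⟨X, mem_fixSub.2 hX, dE_orbit hπ g X⟩

lemma mem_orbitTangent_iff (g : G) (v : Eu d) :
    v ∈ orbitTangent n d σ (g : G ⧸ H) ↔ gI n d σ H g v ∈ tangentPart (dInv n σ) (Ad n g⁻¹) := by
  rw [mem_orbitTangent hπ hσ]
  constructor
  · rintro ⟨X, hX, rfl⟩
    rw [gI_gS hπ hσ]
    exact ⟨X, mem_fixSub.2 hX, rfl⟩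
  · rintro ⟨X, hX, h⟩
    refine ⟨X, mem_fixSub.1 hX, ?_⟩
    rw [← gS_gI hπ hσ g v, ← h]
    exact (gS_antiPart hπ hσ g _).symm

lemma mem_orbitNormal_iff (g : G) (v : Eu d) :
    v ∈ orbitNormal n d σ (g : G ⧸ H) ↔
      gI n d σ H g v ∈ normalPart (dInv n σ) (tangentPart (dInv n σ) (Ad n g⁻¹)) := by
  rw [mem_normalPart]
  constructor
  · intro h
    refine ⟨gI_mem hπ hσ g v, fun x hx => ?_⟩
    have h1 : gS n d H g x ∈ orbitTangent n d σ (g : G ⧸ H) := by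
      rw [mem_orbitTangent_iff hπ hσ, gI_gS hπ hσ,
        antiPart_of_mem (tangentPart_le hσ.isLieInvolution hx)]
      exact hx
    have h2 : metric n d σ (g : G ⧸ H) (gS n d H g x) v = 0 := h _ h1
    rw [metric_eq hπ hσ, gI_gS hπ hσ, antiPart_of_mem (tangentPart_le hσ.isLieInvolution hx)] at h2
    rw [killingForm_comm, h2]
  · rintro ⟨h1, h2⟩ u hu
    exact ((metric_eq hπ hσ g u v).trans (killingForm_comm _ _)).trans
      (h2 _ ((mem_orbitTangent_iff hπ hσ g u).1 hu))

lemma map_gStarInv {g : G} {T : Submodule ℝ (TangentSpace (𝓡 d) (g • base H))}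
    {N : Submodule ℝ (GroupLieAlgebra (𝓡 n) G)}
    (h : ∀ v : Eu d, v ∈ T ↔ gI n d σ H g v ∈ N)
    (hN : N ≤ LinearMap.ker (dInv n σ + LinearMap.id)) :
    (T.baseChange ℂ).map ((gStarInv n d σ H g).baseChange ℂ) = N.baseChange ℂ := by
  rw [← map_baseChange]
  congr 1
  ext1 Y
  constructor
  · rintro ⟨v, hv, rfl⟩
    exact (h v).1 hv
  · intro hY
    refine ⟨gS n d H g Y, (h _).2 ?_, ?_⟩
    · rw [gI_gS hπ hσ, antiPart_of_mem (hN hY)]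
      exact hY
    · exact (gI_gS hπ hσ g Y).trans (antiPart_of_mem (hN hY))

theorem map_orbitTangent (g : G) :
    ((orbitTangent n d σ (g • base H)).baseChange ℂ).map ((gStarInv n d σ H g).baseChange ℂ)
      = (tangentPart (dInv n σ) (Ad n g⁻¹)).baseChange ℂ := by
  refine map_gStarInv hπ hσ (fun v => ?_) (tangentPart_le hσ.isLieInvolution)
  rw [← mem_orbitTangent_iff hπ hσ, ← smul_base g]

theorem map_orbitNormal (g : G) :
    ((orbitNormal n d σ (g • base H)).baseChange ℂ).map ((gStarInv n d σ H g).baseChange ℂ)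
      = (normalPart (dInv n σ) (tangentPart (dInv n σ) (Ad n g⁻¹))).baseChange ℂ := by
  refine map_gStarInv hπ hσ (fun v => ?_) fun Y hY => (mem_normalPart.1 hY).1
  rw [← mem_orbitNormal_iff hπ hσ, ← smul_base g]

end Quotient

/-! ### Isotropy groups and principal orbits. -/

section Isotropy

variable {n d : ℕ} {G : Type*} [TopologicalSpace G] [ChartedSpace (Eu n) G]
  [Group G] {H : Subgroup G} [LieGroup (𝓡 n) ∞ G]

-- Only Ad(g) = exp(ad w) is used, not g = exp w, so the result also applies to products of
-- exponentials of commuting vectors.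
open NormedSpace in
lemma isExpPair_of_eq_exp {σ : G →* G} (hσ : IsSymmetricPair n σ H) {g : G}
    {w : GroupLieAlgebra (𝓡 n) G} (hg : AdE n g = exp (adE w)) :
    IsExpPair (dInv n σ) w (Ad n g⁻¹) (Ad n g) where
  killing_invol := hσ.killing_invol
  killing_adjoint x y := by
    have h := killingForm_Ad g (Ad n g⁻¹ x) y
    rw [Ad_Ad_inv] at h
    exact h.symm
  act := by
    refine actsAsExp_of_eq_exp fun Y => ?_
    have h1 : exp ((1 : ℝ) • (-adE w)) * exp ((1 : ℝ) • (-(-adE w))) = 1 :=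
      exp_smul_mul_exp_smul_neg (-adE w) 1
    rw [one_smul, one_smul, neg_neg, ← hg] at h1
    have h2 := congrArg (fun T : Eu n →L[ℝ] Eu n => T (AdE n g⁻¹ Y)) h1
    have h3 : exp (-adE w) (AdE n g (AdE n g⁻¹ Y)) = AdE n g⁻¹ Y := h2
    rw [← AdE_mul, mul_inv_cancel, AdE_one] at h3
    have h4 : adE (-w) = -adE w := by
      ext1 Z
      exact neg_lie w (show GroupLieAlgebra (𝓡 n) G from Z)
    rw [h4, h3]
    rfl
  act' := by
    refine actsAsExp_of_eq_exp fun Y => ?_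
    rw [← hg]
    rfl

lemma smul_coe_eq_iff (k g : G) : k • (g : G ⧸ H) = (g : G ⧸ H) ↔ g⁻¹ * k * g ∈ H := by
  rw [smul_coe, eq_comm, QuotientGroup.eq, mul_assoc]

variable [T2Space G]

lemma map_oneParam {f : G →* G} (hf : ContMDiff (𝓡 n) (𝓡 n) ∞ f) (X : GroupLieAlgebra (𝓡 n) G)
    (t : ℝ) : f (oneParam X t) = oneParam (dHom n f X) t := by
  have h : IsOneParameterSubgroup (fun t => f (oneParam X t)) (dHom n f X) := by
    refine ⟨fun s t => by rw [oneParam_add, map_mul], hf.comp (contMDiff_oneParam X), ?_⟩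
    have h1 := dE_comp_apply (E := ℝ) (E' := Eu n) (E'' := Eu n) (g := f) (f := oneParam X) (0 : ℝ)
      (hf.mdifferentiable (by simp) _) (mdiff_oneParam X _) (1 : ℝ)
    rw [dE_oneParam_zero, oneParam_zero] at h1
    exact h1
  exact congrFun (h.unique (isOneParameterSubgroup_oneParam _)) t

lemma conj_oneParam (g : G) (X : GroupLieAlgebra (𝓡 n) G) (t : ℝ) :
    g * oneParam X t * g⁻¹ = oneParam (Ad n g X) t :=
  map_oneParam (contMDiff_conj g) X t

open NormedSpace in
lemma AdE_lieExp (w : GroupLieAlgebra (𝓡 n) G) : AdE n (lieExp w) = exp (adE w) := by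
  rw [lieExp_eq, AdE_oneParam, one_smul]

-- For commuting w and a it is enough that ad w and ad(ta) commute; the identity exp(w)exp(ta) =
-- exp(w+ta) in G is not required.
open NormedSpace in
lemma AdE_lieExp_mul_oneParam {w a : GroupLieAlgebra (𝓡 n) G} (h : ⁅w, a⁆ = 0) (t : ℝ) :
    AdE n (lieExp w * oneParam a t) = exp (adE (w + t • a)) := by
  have hta : t • adE a = adE (t • a) := by
    ext1 Z
    exact (smul_lie t a (show GroupLieAlgebra (𝓡 n) G from Z)).symm
  have hcomm : Commute (adE w) (adE (t • a)) := by
    refine ContinuousLinearMap.ext fun Z => ?_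
    have h1 := lie_lie w (t • a) (show GroupLieAlgebra (𝓡 n) G from Z)
    rw [lie_smul, h, smul_zero, zero_lie, eq_comm, sub_eq_zero] at h1
    exact h1
  have hadd : adE (w + t • a) = adE w + adE (t • a) := by
    ext1 Z
    exact add_lie w (t • a) (show GroupLieAlgebra (𝓡 n) G from Z)
  have h2 : exp (adE w + adE (t • a)) = exp (adE w) * exp (adE (t • a)) := by
    let _ : NormedAlgebra ℚ (Eu n →L[ℝ] Eu n) := NormedAlgebra.restrictScalars ℚ ℝ _
    exact exp_add_of_commute hcomm
  rw [hadd, h2, ← hta, ← AdE_lieExp, ← AdE_oneParam]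
  ext1 Z
  exact AdE_mul _ _ Z

variable [ChartedSpace (Eu d) (G ⧸ H)] [IsManifold (𝓡 d) ∞ (G ⧸ H)]

/-- At a principal orbit, the infinitesimal isotropy algebra embeds into that of nearby points. -/
lemma finrank_tangentPart_le_of_isotropy {σ : G →* G} (hσ : IsSymmetricPair n σ H) {g g₂ h : G}
    (hh : h ∈ H)
    (hiso : ∀ k ∈ H, k • (g : G ⧸ H) = (g : G ⧸ H) → (h * k * h⁻¹) • (g₂ : G ⧸ H) = (g₂ : G ⧸ H)) :
    Module.finrank ℝ (tangentPart (dInv n σ) (Ad n g₂⁻¹))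
      ≤ Module.finrank ℝ (tangentPart (dInv n σ) (Ad n g⁻¹)) := by
  refine finrank_tangentPart_le (φ := Ad n h)
    (Function.LeftInverse.injective (g := Ad n h⁻¹) (Ad_inv_Ad h)) fun X hX hX' => ?_
  rw [mem_fixSub] at hX hX'
  constructor
  · rw [mem_fixSub, hσ.dInv_Ad hh, hX]
  · rw [mem_fixSub]
    refine dInv_eq_of_oneParam_mem hσ fun t => ?_
    have h1 : oneParam X t • (g : G ⧸ H) = (g : G ⧸ H) := by
      rw [smul_coe_eq_iff]
      have h2 := conj_oneParam g⁻¹ X t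
      rw [inv_inv] at h2
      rw [h2]
      exact oneParam_mem hσ hX' t
    have h2 := hiso _ (oneParam_mem hσ hX t) h1
    rw [conj_oneParam, smul_coe_eq_iff] at h2
    have h3 := conj_oneParam g₂⁻¹ (Ad n h X) t
    rw [inv_inv] at h3
    rw [← h3]
    exact h2

variable {σ : G →* G} (hσ : IsSymmetricPair n σ H)
  {𝔞 : Submodule ℝ (GroupLieAlgebra (𝓡 n) G)}
  (h𝔞 : IsCartanSubspace (LinearMap.ker (dInv n σ + LinearMap.id)) 𝔞)
  {P : Set (Module.Dual ℂ (𝔞.baseChange ℂ))}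
  (hP : IsPositiveSystem (LinearMap.ker (dInv n σ + LinearMap.id)) 𝔞 P)

include hσ h𝔞 hP

/-- Along t ↦ g exp(ta)H, principality holds for all small t, and some such t makes every root
nonsingular at w + ta. Comparing tangent dimensions at the two points finishes. -/
theorem tangentPart_of_isPrincipalOrbit [LieAlgebra.IsKilling ℝ (GroupLieAlgebra (𝓡 n) G)]
    (hπ : Manifold.IsSubmersion (𝓡 n) (𝓡 d) ∞ (fun k : G => (k : G ⧸ H))) (w : 𝔞)
    (hprin : IsPrincipalOrbit H ((lieExp (w : GroupLieAlgebra (𝓡 n) G) : G) : G ⧸ H)) :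
    (tangentPart (dInv n σ) (Ad n (lieExp (w : GroupLieAlgebra (𝓡 n) G))⁻¹)).baseChange ℂ
        = ⨆ α ∈ P, rootSpace (LinearMap.ker (dInv n σ + LinearMap.id)) 𝔞 α ∧
      (normalPart (dInv n σ) (tangentPart (dInv n σ)
        (Ad n (lieExp (w : GroupLieAlgebra (𝓡 n) G))⁻¹))).baseChange ℂ = 𝔞.baseChange ℂ := by
  set g : G := lieExp (w : GroupLieAlgebra (𝓡 n) G) with hg
  obtain ⟨a, ha⟩ := hP.exists_nonsingular h𝔞 w
  have hcont : Continuous (fun t => ((g * oneParam (a : GroupLieAlgebra (𝓡 n) G) t : G) : G ⧸ H)) :=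
    (mdiff_proj hπ).continuous.comp ((contMDiff_mul_left (I := 𝓡 n) (n := ∞)).continuous.comp
      (contMDiff_oneParam _).continuous)
  have hev : ∀ᶠ t in 𝓝 (0 : ℝ), ∃ h ∈ H, ∀ k ∈ H, k • (g : G ⧸ H) = (g : G ⧸ H) →
      (h * k * h⁻¹) • ((g * oneParam (a : GroupLieAlgebra (𝓡 n) G) t : G) : G ⧸ H)
        = ((g * oneParam (a : GroupLieAlgebra (𝓡 n) G) t : G) : G ⧸ H) := by
    have h1 := hcont.continuousAt (x := 0)
    rw [ContinuousAt, oneParam_zero, mul_one] at h1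
    exact h1.eventually hprin
  obtain ⟨t, ⟨h, hh, hiso⟩, hreg⟩ := ha _ hev
  have hrank := finrank_tangentPart_le_of_isotropy hσ hh hiso
  have h1 := isExpPair_of_eq_exp hσ (AdE_lieExp (w : GroupLieAlgebra (𝓡 n) G))
  have h2 := isExpPair_of_eq_exp hσ (AdE_lieExp_mul_oneParam (h𝔞.abelian w w.2 a a.2) t)
  have h3 : ((w + t • a : 𝔞) : GroupLieAlgebra (𝓡 n) G)
      = (w : GroupLieAlgebra (𝓡 n) G) + t • (a : GroupLieAlgebra (𝓡 n) G) := rfl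
  rw [← h3] at h2
  exact h1.eq_of_finrank_le hσ.isLieInvolution h𝔞 hP h2 hreg hrank

end Isotropy

/-! ### Slices and regular vectors. -/

open NormedSpace in
/-- A slice for a linear action: if `𝔨 ⋅ a + 𝔞` fills `𝔭`, then every vector of `𝔭` near `a` is
moved into `a + 𝔞` by the exponential of some element of `𝔨`. -/
lemma eventually_mem_slice {E : Type*} [NormedAddCommGroup E] [InnerProductSpace ℝ E]
    [FiniteDimensional ℝ E] {𝔨 𝔞 𝔭 : Submodule ℝ E} {ρ : E →L[ℝ] E →L[ℝ] E} {a : E}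
    (hmem : ∀ X ∈ 𝔨, ∀ b ∈ 𝔞, exp (ρ X) (a + b) ∈ 𝔭)
    (hsurj : ∀ Y ∈ 𝔭, ∃ X ∈ 𝔨, ∃ b ∈ 𝔞, Y = ρ X a + b) {s : Set E} (hs : s ∈ 𝓝 (0 : E)) :
    ∀ᶠ Z in 𝓝 a, Z ∈ 𝔭 → ∃ X ∈ 𝔨, ∃ b ∈ 𝔞, b ∈ s ∧ Z = exp (ρ X) (a + b) := by
  have : CompleteSpace E := FiniteDimensional.complete ℝ E
  set p𝔨 := 𝔨.starProjection
  set p𝔞 := 𝔞.starProjection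
  set p𝔭 := 𝔭ᗮ.starProjection
  -- The last summand ranges over 𝔭ᗮ and makes the derivative at 0 surjective onto E. It must vanish
  -- when the value of f lies in 𝔭, because the first summand is in 𝔭. The projections let the
  -- argument run on the full space.
  set f : E × E × E → E := fun q => exp (ρ (p𝔨 q.1)) (a + p𝔞 q.2.1) + p𝔭 q.2.2 with hf
  set ℓ₁ : E × E × E →L[ℝ] (E →L[ℝ] E) :=
    (ρ.comp p𝔨).comp (ContinuousLinearMap.fst ℝ E (E × E))
  set ℓ₂ : E × E × E →L[ℝ] E := p𝔞.comp
    ((ContinuousLinearMap.fst ℝ E E).comp (ContinuousLinearMap.snd ℝ E (E × E)))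
  set ℓ₃ : E × E × E →L[ℝ] E := p𝔭.comp
    ((ContinuousLinearMap.snd ℝ E E).comp (ContinuousLinearMap.snd ℝ E (E × E)))
  have hexp : HasStrictFDerivAt (fun q : E × E × E => exp (ℓ₁ q))
      ((1 : (E →L[ℝ] E) →L[ℝ] (E →L[ℝ] E)).comp ℓ₁) 0 := by
    have h1 : HasStrictFDerivAt exp (1 : (E →L[ℝ] E) →L[ℝ] (E →L[ℝ] E)) (ℓ₁ 0) := by
      rw [map_zero]
      exact hasStrictFDerivAt_exp_zero
    exact h1.comp 0 ℓ₁.hasStrictFDerivAt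
  have h2 := (hexp.clm_apply ((ℓ₂.hasStrictFDerivAt (x := 0)).const_add a)).add
    (ℓ₃.hasStrictFDerivAt (x := 0))
  set D := (exp (ℓ₁ 0)).comp ℓ₂ +
    (((1 : (E →L[ℝ] E) →L[ℝ] (E →L[ℝ] E)).comp ℓ₁).flip (a + ℓ₂ 0)) + ℓ₃ with hD
  have hfd : HasStrictFDerivAt f D 0 := h2
  have hDa : ∀ X b c, D (X, b, c) = p𝔞 b + ρ (p𝔨 X) a + p𝔭 c := by
    intro X b c
    simp only [hD, map_zero, exp_zero, add_zero]
    rfl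
  have hDs : D.range = ⊤ := by
    rw [LinearMap.range_eq_top]
    intro Y
    obtain ⟨X, hX, b, hb, hY⟩ := hsurj (𝔭.starProjection Y) (𝔭.starProjection_apply_mem Y)
    refine ⟨(X, b, Y), ?_⟩
    show D (X, b, Y) = Y
    rw [hDa, show p𝔞 b = b from Submodule.starProjection_eq_self_iff.2 hb,
      show p𝔨 X = X from Submodule.starProjection_eq_self_iff.2 hX, add_comm b, ← hY]
    exact 𝔭.starProjection_add_starProjection_orthogonal Y
  -- A surjective strict derivative makes f open at 0.
  have hnhds := hfd.map_nhds_eq_of_surj hDs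
  have hf0 : f 0 = a := by
    simp only [hf, Prod.fst_zero, Prod.snd_zero, map_zero, exp_zero, add_zero]
    rfl
  rw [hf0] at hnhds
  have hsq : {q : E × E × E | p𝔞 q.2.1 ∈ s} ∈ 𝓝 (0 : E × E × E) := by
    have hc : Continuous (fun q : E × E × E => p𝔞 q.2.1) :=
      p𝔞.continuous.comp (continuous_fst.comp continuous_snd)
    refine hc.continuousAt ?_
    simpa using hs
  have himg := Filter.image_mem_map (m := f) hsq
  rw [hnhds] at himg
  filter_upwards [himg]
  rintro _ ⟨⟨X, b, c⟩, hb, rfl⟩ hZ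
  have hX := 𝔨.starProjection_apply_mem X
  have hb' := 𝔞.starProjection_apply_mem b
  have h3 := hmem _ hX _ hb'
  have h4 : p𝔭 c ∈ 𝔭 := by
    have h5 := sub_mem hZ h3
    rwa [add_sub_cancel_left] at h5
  have h5 : p𝔭 c = 0 := by
    have h6 : p𝔭 c ∈ 𝔭ᗮ := 𝔭ᗮ.starProjection_apply_mem c
    exact inner_self_eq_zero.1 (h6 _ h4 : inner ℝ (p𝔭 c) (p𝔭 c) = 0)
  refine ⟨_, hX, _, hb', hb, ?_⟩
  show _ + p𝔭 c = _
  rw [h5, add_zero]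

section Regular

variable {L : Type*} [LieRing L] [LieAlgebra ℝ L] [FiniteDimensional ℝ L] {𝔮 𝔞 : Submodule ℝ L}
  {P : Set (Module.Dual ℂ (𝔞.baseChange ℂ))}

/-- The value of a complex linear form at real vectors, as a real linear map. -/
def realEvalₗ (β : Module.Dual ℂ (𝔞.baseChange ℂ)) : 𝔞 →ₗ[ℝ] ℂ where
  toFun := realEval β
  map_add' a b := by
    have h := realEval_add_smul β a b 1
    rwa [one_smul, Complex.ofReal_one, one_mul] at h
  map_smul' c a := by
    have h := realEval_add_smul β 0 a c
    rwa [zero_add, realEval_zero, zero_add] at h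

lemma eventually_regular [TopologicalSpace L] [IsTopologicalAddGroup L] [ContinuousSMul ℝ L]
    [T2Space L] (hfin : P.Finite) (w a : 𝔞) (ha : ∀ β ∈ P, IsSingularAt w β → realEval β a ≠ 0) :
    ∀ᶠ b in 𝓝 (0 : L), ∀ hb : b ∈ 𝔞, ∀ β ∈ P, IsSingularAt w β →
      realEval β (a + ⟨b, hb⟩) ≠ 0 := by
  have h : ∀ β ∈ P, ∀ᶠ b in 𝓝 (0 : L), ∀ hb : b ∈ 𝔞, IsSingularAt w β →
      realEval β (a + ⟨b, hb⟩) ≠ 0 := by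
    intro β hβ
    by_cases hs : IsSingularAt w β
    -- A real-linear extension of β to all of L turns nonvanishing into an open condition near 0.
    · obtain ⟨f, hf⟩ := LinearMap.exists_extend (realEvalₗ β)
      have hfa : ∀ b : 𝔞, f b = realEval β b := fun b => LinearMap.congr_fun hf b
      have hc : Continuous (fun b : L => f (a + b)) :=
        f.continuous_of_finiteDimensional.comp (continuous_const.add continuous_id)
      have h0 : f (a + 0) ≠ 0 := by
        rw [add_zero, hfa]
        exact ha β hβ hs
      filter_upwards [hc.continuousAt.eventually_ne h0] with b hb hb' _
      rw [← hfa]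
      exact hb
    · exact Filter.Eventually.of_forall fun b hb h => absurd h hs
  filter_upwards [(Filter.eventually_all_finite hfin).2 h] with b hb hb' β hβ hs
  exact hb β hβ hb' hs

/-- On a line whose direction is killed by no root, each root has at most one zero. -/
lemma IsPositiveSystem.exists_dense_regular (h𝔞 : IsCartanSubspace 𝔮 𝔞)
    (hP : IsPositiveSystem 𝔮 𝔞 P) (a : 𝔞) :
    ∃ b : 𝔞, Dense {t : ℝ | ∀ β ∈ P, realEval β (a + t • b) ≠ 0} := by
  obtain ⟨b, hb⟩ := hP.exists_regular h𝔞
  refine ⟨b, ?_⟩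
  have hbad : (⋃ β ∈ P, {t : ℝ | realEval β (a + t • b) = 0}).Countable := by
    refine (hP.finite h𝔞).countable.biUnion fun β hβ => Set.Subsingleton.countable ?_
    intro t ht u hu
    have ht' := (realEval_add_smul β a b t).symm.trans ht
    have hu' := (realEval_add_smul β a b u).symm.trans hu
    have h1 := mul_right_cancel₀ (hb β hβ) (add_left_cancel (ht'.trans hu'.symm))
    exact_mod_cast h1
  have h := hbad.dense_compl ℝ
  refine h.mono fun t ht => ?_
  intro β hβ h0
  exact ht (Set.mem_biUnion (t := fun β => {t : ℝ | realEval β (a + t • b) = 0}) hβ h0)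

end Regular

/-! ### The set H_x(g_*𝔞): normality, openness and density. -/

section IsotropyImage

variable {n d : ℕ} {G : Type*} [TopologicalSpace G] [ChartedSpace (Eu n) G]
  [Group G] {H : Subgroup G}

/-- The vectors `h_* g_* a` with `h` in the isotropy group of `gH` and `a ∈ 𝔞` such that `p a`. -/
def isotropyImage (n d : ℕ) {G : Type*} [TopologicalSpace G] [ChartedSpace (Eu n) G] [Group G]
    (H : Subgroup G) [ChartedSpace (Eu d) (G ⧸ H)] (g : G)
    (𝔞 : Submodule ℝ (GroupLieAlgebra (𝓡 n) G)) (p : 𝔞 → Prop) : Set (Eu d) :=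
  {v | ∃ k ∈ H, g * k * g⁻¹ ∈ H ∧ ∃ a : 𝔞, p a ∧ v = gS n d H g (Ad n k a)}

/-- The differential of the isotropy action on `𝔭`, as a bilinear map on the model space. -/
def adBilin (n : ℕ) (G : Type*) [TopologicalSpace G] [ChartedSpace (Eu n) G]
    [Group G] [LieGroup (𝓡 n) ∞ G] : Eu n →L[ℝ] Eu n →L[ℝ] Eu n :=
  LinearMap.toContinuousLinearMap
    { toFun := fun X => adE (show GroupLieAlgebra (𝓡 n) G from X)
      map_add' := fun X Y => by
        ext1 Z
        exact add_lie (show GroupLieAlgebra (𝓡 n) G from X) (show GroupLieAlgebra (𝓡 n) G from Y)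
          (show GroupLieAlgebra (𝓡 n) G from Z)
      map_smul' := fun c X => by
        ext1 Z
        exact smul_lie c (show GroupLieAlgebra (𝓡 n) G from X)
          (show GroupLieAlgebra (𝓡 n) G from Z) }

variable [LieGroup (𝓡 n) ∞ G]

/-- Here k = g⁻¹hg with h = gkg⁻¹ in the isotropy group. Since Ad(h⁻¹) preserves 𝔥 and Ad(k⁻¹)
commutes with θ, Ad(k⁻¹) preserves the tangent part; invariance of the Killing form transfers this
to the normal part. -/
lemma IsSymmetricPair.Ad_mem_normalPart {σ : G →* G} (hσ : IsSymmetricPair n σ H) {g k : G}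
    (hk : k ∈ H) (hgk : g * k * g⁻¹ ∈ H) {Z : GroupLieAlgebra (𝓡 n) G}
    (hZ : Z ∈ normalPart (dInv n σ) (tangentPart (dInv n σ) (Ad n g⁻¹))) :
    Ad n k Z ∈ normalPart (dInv n σ) (tangentPart (dInv n σ) (Ad n g⁻¹)) := by
  rw [mem_normalPart] at hZ ⊢
  constructor
  · rw [mem_antiSub, hσ.dInv_Ad hk, mem_antiSub.1 hZ.1, map_neg]
  · rintro _ ⟨E, hE, rfl⟩
    have h1 := hZ.2 (antiPart (dInv n σ) (Ad n g⁻¹ (Ad n (g * k * g⁻¹)⁻¹ E)))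
      ⟨_, mem_fixSub.2 (by rw [hσ.dInv_Ad (inv_mem hgk), mem_fixSub.1 hE]), rfl⟩
    have h2 : g⁻¹ * (g * k * g⁻¹)⁻¹ = k⁻¹ * g⁻¹ := by group
    rw [← Ad_mul_apply, h2, Ad_mul_apply, hσ.antiPart_Ad (inv_mem hk), ← killingForm_Ad k,
      Ad_Ad_inv] at h1
    exact h1

lemma isotropyImage_subset_closure [ChartedSpace (Eu d) (G ⧸ H)] {𝔮 𝔞 : Submodule ℝ (GroupLieAlgebra (𝓡 n) G)}
    (h𝔞 : IsCartanSubspace 𝔮 𝔞) {P : Set (Module.Dual ℂ (𝔞.baseChange ℂ))}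
    (hP : IsPositiveSystem 𝔮 𝔞 P) (g : G) (w : 𝔞) :
    isotropyImage n d H g 𝔞 (fun _ => True) ⊆ closure (isotropyImage n d H g 𝔞
      (fun a => ∀ β ∈ P, IsSingularAt w β → realEval β a ≠ 0)) := by
  rintro _ ⟨k, hk, hgk, a, -, rfl⟩
  obtain ⟨b, hb⟩ := hP.exists_dense_regular h𝔞 a
  have hc : Continuous (fun t : ℝ => gS n d H g (Ad n k (a + t • b : 𝔞))) := by
    have h1 : ∀ t : ℝ, gS n d H g (Ad n k (a + t • b : 𝔞)) = gS n d H g (Ad n k a)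
        + t • gS n d H g (Ad n k b) := by
      intro t
      have h2 : ((a + t • b : 𝔞) : GroupLieAlgebra (𝓡 n) G)
        = (a : GroupLieAlgebra (𝓡 n) G) + t • (b : GroupLieAlgebra (𝓡 n) G) := rfl
      rw [h2, map_add, map_add, map_smul, map_smul]
    simp only [h1]
    fun_prop
  have h0 := map_mem_closure hc (hb 0) (t := isotropyImage n d H g 𝔞
      (fun a => ∀ β ∈ P, IsSingularAt w β → realEval β a ≠ 0))
    fun t ht => ⟨k, hk, hgk, _, fun β hβ _ => ht β hβ, rfl⟩
  rwa [zero_smul, add_zero] at h0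

variable [ChartedSpace (Eu d) (G ⧸ H)] [IsManifold (𝓡 d) ∞ (G ⧸ H)]
  (hπ : Manifold.IsSubmersion (𝓡 n) (𝓡 d) ∞ (fun k : G => (k : G ⧸ H)))

include hπ in
lemma dIso_gStar {g h : G} (hh : g⁻¹ * h * g ∈ H) (X : GroupLieAlgebra (𝓡 n) G) :
    (dIso d h (g • base H) (gStar n d H g X) : Eu d) = gS n d H g (Ad n (g⁻¹ * h * g) X) := by
  have h1 : (dIso d h (g • base H) (gStar n d H g X) : Eu d)
      = dE (Eu d) (Eu d) (fun y : G ⧸ H => h • y) (g • base H) (gS n d H g X) :=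
    congrArg (dE (Eu d) (Eu d) (fun y : G ⧸ H => h • y) (g • base H)) (gStar_eq hπ g X)
  refine h1.trans ?_
  rw [smul_base, dE_act_gS hπ, ← gS_mul_of_mem hπ g hh]
  congr 2
  group

include hπ in
lemma setOf_dIso_gStar (g : G) (𝔞 : Submodule ℝ (GroupLieAlgebra (𝓡 n) G)) (p : 𝔞 → Prop) :
    {v : TangentSpace (𝓡 d) (g • base H) | ∃ h ∈ H, h • (g • base H) = g • base H ∧ ∃ a : 𝔞, p a ∧
      v = dIso d h (g • base H) (gStar n d H g a)} = isotropyImage n d H g 𝔞 p := by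
  ext v
  constructor
  · rintro ⟨h, hh, hx, a, ha, rfl⟩
    rw [smul_base, smul_coe_eq_iff] at hx
    refine ⟨_, hx, ?_, a, ha, dIso_gStar hπ hx a⟩
    have : g * (g⁻¹ * h * g) * g⁻¹ = h := by group
    rwa [this]
  · rintro ⟨k, hk, hgk, a, ha, hv⟩
    have : g⁻¹ * (g * k * g⁻¹) * g = k := by group
    refine ⟨_, hgk, ?_, a, ha, hv.trans ?_⟩
    · rw [smul_base, smul_coe_eq_iff, this]
      exact hk
    · have h1 := dIso_gStar (d := d) hπ (g := g) (h := g * k * g⁻¹) (by rwa [this]) a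
      rw [this] at h1
      exact h1.symm

variable [T2Space G] [LieAlgebra.IsKilling ℝ (GroupLieAlgebra (𝓡 n) G)]
  {σ : G →* G} (hσ : IsSymmetricPair n σ H)
  {𝔞 : Submodule ℝ (GroupLieAlgebra (𝓡 n) G)}
  (h𝔞 : IsCartanSubspace (LinearMap.ker (dInv n σ + LinearMap.id)) 𝔞)
  {P : Set (Module.Dual ℂ (𝔞.baseChange ℂ))}
  (hP : IsPositiveSystem (LinearMap.ker (dInv n σ + LinearMap.id)) 𝔞 P)
  {g : G} {w : 𝔞} (hU : IsExpPair (dInv n σ) w (Ad n g⁻¹) (Ad n g))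

include hπ hσ h𝔞 hP hU

lemma isotropyImage_subset (p : 𝔞 → Prop) :
    isotropyImage n d H g 𝔞 p ⊆ {v : Eu d | v ∈ orbitNormal n d σ (g : G ⧸ H)} := by
  rintro _ ⟨k, hk, hgk, a, -, rfl⟩
  refine (mem_orbitNormal_iff hπ hσ g _).2 ?_
  have h1 := hσ.Ad_mem_normalPart hk hgk (mem_normalPart_of_mem hσ.isLieInvolution h𝔞 hP hU a.2)
  rwa [gI_gS hπ hσ, antiPart_of_mem (mem_normalPart.1 h1).1]

/-- Apply Ad(k⁻¹) to bring nearby normal vectors close to a, write them there as Ad(exp X)(a+b) by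
the slice lemma with a+b still regular, and go back with k exp(X). -/
lemma eventually_mem_isotropyImage {v : Eu d} (hv : v ∈ isotropyImage n d H g 𝔞
      (fun a => ∀ β ∈ P, IsSingularAt w β → realEval β a ≠ 0)) :
    ∀ᶠ v' in 𝓝 v, v' ∈ orbitNormal n d σ (g : G ⧸ H) → v' ∈ isotropyImage n d H g 𝔞
      (fun a => ∀ β ∈ P, IsSingularAt w β → realEval β a ≠ 0) := by
  obtain ⟨k, hk, hgk, a, ha, rfl⟩ := hv
  set N := normalPart (dInv n σ) (tangentPart (dInv n σ) (Ad n g⁻¹)) with hN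
  have haN := mem_normalPart_of_mem hσ.isLieInvolution h𝔞 hP hU a.2
  have hkinv : g * k⁻¹ * g⁻¹ ∈ H := by
    have h1 := inv_mem hgk
    have : (g * k * g⁻¹)⁻¹ = g * k⁻¹ * g⁻¹ := by group
    rwa [this] at h1
  have hKmem : ∀ X : GroupLieAlgebra (𝓡 n) G, dInv n σ X = X → dInv n σ (Ad n g X) = Ad n g X →
      oneParam X 1 ∈ H ∧ g * oneParam X 1 * g⁻¹ ∈ H := by
    intro X hX hX'
    rw [conj_oneParam]
    exact ⟨oneParam_mem hσ hX 1, oneParam_mem hσ hX' 1⟩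
  have hexp : ∀ (X : GroupLieAlgebra (𝓡 n) G) (Y : Eu n),
      NormedSpace.exp (adBilin n G X) Y = Ad n (oneParam X 1) Y := by
    intro X Y
    have h1 := AdE_oneParam X 1
    rw [one_smul] at h1
    exact congrArg (fun T : Eu n →L[ℝ] Eu n => T Y) h1.symm
  have hslice := eventually_mem_slice (E := Eu n)
    (𝔨 := (show Submodule ℝ (Eu n) from LinearMap.ker (dInv n σ - LinearMap.id) ⊓
      (LinearMap.ker (dInv n σ - LinearMap.id)).comap (Ad n g)))
    (𝔞 := (show Submodule ℝ (Eu n) from 𝔞)) (𝔭 := (show Submodule ℝ (Eu n) from N))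
    (ρ := adBilin n G) (a := (a : GroupLieAlgebra (𝓡 n) G))
    (by
      intro X hX b hb
      have h2 := hKmem X (mem_fixSub.1 hX.1) (mem_fixSub.1 hX.2)
      have h3 := hσ.Ad_mem_normalPart h2.1 h2.2
        (add_mem haN (mem_normalPart_of_mem hσ.isLieInvolution h𝔞 hP hU hb))
      exact Eq.mpr (congrArg (fun z : Eu n => z ∈ (show Submodule ℝ (Eu n) from N))
        (hexp X _)) h3)
    (by
      intro Y hY
      obtain ⟨X, hX, hX', b, hb, h⟩ := hU.exists_eq_lie_add hσ.isLieInvolution h𝔞 hP ha hY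
      exact ⟨X, ⟨hX, hX'⟩, b, hb, h⟩)
    (eventually_regular (hP.finite h𝔞) w a ha)
  have hc : Continuous (fun v' : Eu d => (Ad n k⁻¹ (gI n d σ H g v') : Eu n)) :=
    LinearMap.continuous_of_finiteDimensional
      (show Eu d →ₗ[ℝ] Eu n from Ad n k⁻¹ ∘ₗ gI n d σ H g)
  have hca : (Ad n k⁻¹ (gI n d σ H g (gS n d H g (Ad n k a)))) = a := by
    rw [gI_gS hπ hσ, antiPart_of_mem (mem_normalPart.1 (hσ.Ad_mem_normalPart hk hgk haN)).1,
      Ad_inv_Ad]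
  have hct := hc.continuousAt (x := gS n d H g (Ad n k a))
  have hct' : Filter.Tendsto (fun v' : Eu d => (Ad n k⁻¹ (gI n d σ H g v') : Eu n))
      (𝓝 (gS n d H g (Ad n k a))) (𝓝 (show Eu n from (a : GroupLieAlgebra (𝓡 n) G))) := by
    have h1 : (fun v' : Eu d => (Ad n k⁻¹ (gI n d σ H g v') : Eu n)) (gS n d H g (Ad n k a))
      = (show Eu n from (a : GroupLieAlgebra (𝓡 n) G)) := hca
    rw [← h1]
    exact hct
  filter_upwards [hct'.eventually hslice] with v' hv' hvN
  obtain ⟨X, hX, b, hb, hbs, hZ⟩ := hv' (hσ.Ad_mem_normalPart (inv_mem hk) hkinv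
    ((mem_orbitNormal_iff hπ hσ g _).1 hvN))
  have h2 := hKmem X (mem_fixSub.1 hX.1) (mem_fixSub.1 hX.2)
  have h3 : Ad n k⁻¹ (gI n d σ H g v') = Ad n (oneParam X 1) (a + ⟨b, hb⟩ : 𝔞) :=
    hZ.trans (hexp X _)
  refine ⟨k * oneParam X 1, mul_mem hk h2.1, ?_, a + ⟨b, hb⟩, hbs hb, ?_⟩
  · have h4 := mul_mem hgk h2.2
    have : g * k * g⁻¹ * (g * oneParam X 1 * g⁻¹) = g * (k * oneParam X 1) * g⁻¹ := by group
    rwa [this] at h4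
  · rw [Ad_mul_apply, ← h3, Ad_Ad_inv]
    exact (gS_gI hπ hσ g v').symm

lemma exists_isOpen_isotropyImage : ∃ U : Set (Eu d), IsOpen U ∧
    isotropyImage n d H g 𝔞 (fun a => ∀ β ∈ P, IsSingularAt w β → realEval β a ≠ 0)
      = U ∩ {v : Eu d | v ∈ orbitNormal n d σ (g : G ⧸ H)} := by
  -- The interior of the vectors that are in the image as soon as they are normal.
  refine ⟨_, isOpen_interior (s := {v : Eu d | v ∈ orbitNormal n d σ (g : G ⧸ H) →
    v ∈ isotropyImage n d H g 𝔞 (fun a => ∀ β ∈ P, IsSingularAt w β → realEval β a ≠ 0)}), ?_⟩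
  ext v
  refine ⟨fun hv => ⟨mem_interior_iff_mem_nhds.2
    (eventually_mem_isotropyImage hπ hσ h𝔞 hP hU hv), isotropyImage_subset hπ hσ h𝔞 hP hU _ hv⟩,
    fun hv => interior_subset hv.1 hv.2⟩

end IsotropyImage

/-! ### Brackets determined by values at a point, and transport to a single tangent space. -/

section VectorFields

variable {E : Type*} [NormedAddCommGroup E] [NormedSpace ℝ E]
  {N : Type*} [TopologicalSpace N] [ChartedSpace E N] [IsManifold 𝓘(ℝ, E) ∞ N]

/-- If `X, X'` and `Y, Y'` agree at `x`, then `[X - X', Y - Y']` vanishes at `x`. -/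
lemma mlieBracket_eq_of_eq (x : N) {X X' Y Y' : (y : N) → TangentSpace 𝓘(ℝ, E) y}
    (hX : X x = X' x) (hY : Y x = Y' x) :
    (VectorField.mlieBracket 𝓘(ℝ, E) X Y x : E) = VectorField.mlieBracket 𝓘(ℝ, E) X' Y x
      + VectorField.mlieBracket 𝓘(ℝ, E) X Y' x - VectorField.mlieBracket 𝓘(ℝ, E) X' Y' x := by
  have h : ∀ V W : (y : N) → TangentSpace 𝓘(ℝ, E) y,
      (VectorField.mlieBracket 𝓘(ℝ, E) V W x : E)
        = fderiv ℝ (coordField E x W) (extChartAt 𝓘(ℝ, E) x x) (V x)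
          - fderiv ℝ (coordField E x V) (extChartAt 𝓘(ℝ, E) x x) (W x) := by
    intro V W
    rw [mlieBracket_eq_lieBracket_coordField, VectorField.lieBracket, coordField_self,
      coordField_self]
  refine (h X Y).trans ?_
  refine Eq.trans ?_ (congrArg₂ (· - ·) (congrArg₂ (· + ·) (h X' Y) (h X Y')) (h X' Y')).symm
  rw [hX, hY]
  have hsum : ∀ a b c e : E, a - b = (a - c) + (e - b) - (e - c) := fun a b c e => by abel
  exact hsum _ _ _ _

/-- The maps Ψ_y carry y to the fixed point x, so dΨ_y(Y_y) takes values in one vector space. In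
charts it is a partial derivative of a smooth map applied to the coordinates of Y. -/
lemma mdifferentiableAt_dE_apply [CompleteSpace E] {x : N} {Ψ : N → N → N}
    (hΨ : ContMDiffAt (𝓘(ℝ, E).prod 𝓘(ℝ, E)) 𝓘(ℝ, E) ∞ (fun p : N × N => Ψ p.1 p.2) (x, x))
    (hx : ∀ᶠ y in 𝓝 x, Ψ y y = x) {Y : (y : N) → TangentSpace 𝓘(ℝ, E) y}
    (hY : MDifferentiableAt 𝓘(ℝ, E) 𝓘(ℝ, E).tangent
      (fun y => (⟨y, Y y⟩ : TangentBundle 𝓘(ℝ, E) N)) x) :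
    MDifferentiableAt 𝓘(ℝ, E) 𝓘(ℝ, E) (fun y => dE E E (Ψ y) y (Y y)) x := by
  have : IsManifold 𝓘(ℝ, E) 1 N := IsManifold.of_le (n := ∞) (by norm_num)
  set φ := extChartAt 𝓘(ℝ, E) x with hφ
  set z := φ x with hz
  have hxs : x ∈ φ.source := mem_extChartAt_source x
  have hzx : φ.symm z = x := φ.left_inv hxs
  have htgt : φ.target ∈ 𝓝 z := extChartAt_target_mem_nhds x
  have hsrc : φ.source ∈ 𝓝 x := extChartAt_source_mem_nhds x
  have hφd : ∀ y ∈ φ.source, MDifferentiableAt 𝓘(ℝ, E) 𝓘(ℝ, E) φ y := by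
    intro y hy
    apply mdifferentiableAt_extChartAt
    rwa [← extChartAt_source 𝓘(ℝ, E)]
  have hsymm : ContMDiffAt 𝓘(ℝ, E) 𝓘(ℝ, E) ∞ φ.symm z :=
    (contMDiffOn_extChartAt_symm x).contMDiffAt htgt
  set F : E × E → E := fun p => φ (Ψ (φ.symm p.1) (φ.symm p.2)) with hFdef
  have hFsm : ContDiffAt ℝ ∞ F (z, z) := by
    have hφx : ContMDiffAt 𝓘(ℝ, E) 𝓘(ℝ, E) ∞ φ (Ψ x x) := by
      rw [hx.self_of_nhds]
      exact contMDiffAt_extChartAt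
    have h2 : ContMDiffAt (𝓘(ℝ, E).prod 𝓘(ℝ, E)) (𝓘(ℝ, E).prod 𝓘(ℝ, E)) ∞
        (fun p : E × E => (φ.symm p.1, φ.symm p.2)) (z, z) :=
      (hsymm.comp (z, z) contMDiffAt_fst).prodMk (hsymm.comp (z, z) contMDiffAt_snd)
    have hΨ' : ContMDiffAt (𝓘(ℝ, E).prod 𝓘(ℝ, E)) 𝓘(ℝ, E) ∞ (fun p : N × N => φ (Ψ p.1 p.2))
      (x, x) := hφx.comp (x, x) hΨ
    rw [← hzx] at hΨ'
    have h3 := hΨ'.comp (z, z) h2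
    rw [← modelWithCornersSelf_prod, chartedSpaceSelf_prod] at h3
    exact h3.contDiffAt
  have hFsm2 : ContDiffAt ℝ 2 F (z, z) := hFsm.of_le (by exact_mod_cast ENat.LEInfty.out)
  have hD : DifferentiableAt ℝ (fderiv ℝ F) (z, z) :=
    (hFsm2.fderiv_right (m := 1) (by norm_num)).differentiableAt (by norm_num)
  have hFd : ∀ᶠ p in 𝓝 (z, z), DifferentiableAt ℝ F p := by
    filter_upwards [hFsm2.eventually (by norm_num)] with p hp
    exact hp.differentiableAt (by norm_num)
  set q : E → E := fun a => fderiv ℝ F (a, a) (0, coordField E x Y a) with hq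
  have hqd : DifferentiableAt ℝ q z := by
    have h1 : DifferentiableAt ℝ (fun a : E => fderiv ℝ F (a, a)) z :=
      DifferentiableAt.comp (g := fderiv ℝ F) (f := fun a : E => (a, a)) z hD
        (differentiableAt_id.prodMk differentiableAt_id)
    exact h1.clm_apply ((differentiableAt_const 0).prodMk (differentiableAt_coordField hY))
  have hqφ : MDifferentiableAt 𝓘(ℝ, E) 𝓘(ℝ, E) (fun y => q (φ y)) x :=
    hqd.mdifferentiableAt.comp x (hφd x hxs)
  have hdiag : Filter.Tendsto (fun y => (φ y, φ y)) (𝓝 x) (𝓝 (z, z)) :=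
    ((continuousAt_extChartAt x).prodMk (continuousAt_extChartAt x)).tendsto
  have hΨd : ∀ᶠ y in 𝓝 x, MDifferentiableAt 𝓘(ℝ, E) 𝓘(ℝ, E) (Ψ y) y := by
    have hΨ1 : ContMDiffAt (𝓘(ℝ, E).prod 𝓘(ℝ, E)) 𝓘(ℝ, E) 1 (fun p : N × N => Ψ p.1 p.2) (x, x) :=
      hΨ.of_le (by norm_num)
    have h1 := (contMDiffAt_iff_contMDiffAt_nhds (by simp)).1 hΨ1
    filter_upwards [(continuousAt_id.prodMk continuousAt_id).eventually h1] with y hy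
    have h2 : MDifferentiableAt 𝓘(ℝ, E) (𝓘(ℝ, E).prod 𝓘(ℝ, E)) (fun u : N => (y, u)) y :=
      mdifferentiableAt_const.prodMk mdifferentiableAt_id
    exact (hy.mdifferentiableAt (by norm_num)).comp y h2
  refine hqφ.congr_of_eventuallyEq ?_
  filter_upwards [hsrc, hx, hΨd, hdiag.eventually hFd] with y hy hyx hyd hFy
  suffices h : ∀ v : E, v = Y y → dE E E (Ψ y) y v = q (φ y) from h _ rfl
  intro v hv
  have h1 : dE E E (fun u => φ (Ψ y u)) y v = dE E E (Ψ y) y v := by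
    rw [dE_comp_apply (g := φ) (f := Ψ y) y (by rw [hyx]; exact hφd x hxs) hyd, hyx,
      dE_extChartAt_self]
    rfl
  have h2 : HasFDerivAt (fun a : E => F (φ y, a))
      ((fderiv ℝ F (φ y, φ y)).comp (ContinuousLinearMap.inr ℝ E E)) (φ y) :=
    HasFDerivAt.comp (φ y) hFy.hasFDerivAt (hasFDerivAt_prodMk_right (φ y) (φ y))
  have h3 : (fun u : N => φ (Ψ y u)) =ᶠ[𝓝 y] fun u => (fun a : E => F (φ y, a)) (φ u) := by
    filter_upwards [(isOpen_extChartAt_source x).mem_nhds hy] with u hu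
    simp only [hFdef, φ.left_inv hu, φ.left_inv hy]
  have h4 : dE E E (fun u : N => φ (Ψ y u)) y = _ := dE_congr h3
  have h5 : coordField E x Y (φ y) = dE E E φ y v := by rw [hv]; exact coordField_apply Y hy
  rw [← h1, h4, dE_comp_apply (g := fun a : E => F (φ y, a)) (f := φ) y
    h2.differentiableAt.mdifferentiableAt (hφd y hy), dE_eq_fderiv, h2.fderiv, ← h5]
  rfl

end VectorFields

/-! ### Fundamental vector fields of the action. -/

section Fundamental

variable {n d : ℕ} {G : Type*} [TopologicalSpace G] [ChartedSpace (Eu n) G]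
  [Group G] {H : Subgroup G} [ChartedSpace (Eu d) (G ⧸ H)]

/-- The fundamental vector field of the action of `G` on `G ⧸ H`. -/
def fundField (n d : ℕ) {G : Type*} [TopologicalSpace G] [ChartedSpace (Eu n) G]
    [Group G] {H : Subgroup G} [ChartedSpace (Eu d) (G ⧸ H)] (X : GroupLieAlgebra (𝓡 n) G)
    (y : G ⧸ H) : TangentSpace (𝓡 d) y :=
  dE (Eu n) (Eu d) (fun k : G => k • y) (1 : G) X

variable [LieGroup (𝓡 n) ∞ G] [IsManifold (𝓡 d) ∞ (G ⧸ H)]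
  (hπ : Manifold.IsSubmersion (𝓡 n) (𝓡 d) ∞ (fun k : G => (k : G ⧸ H)))

include hπ

lemma fundField_coe (X : GroupLieAlgebra (𝓡 n) G) (g : G) :
    (fundField n d X (g : G ⧸ H) : Eu d) = gS n d H g (Ad n g⁻¹ X) := dE_orbit hπ g X

/-- The field at y is the tangent map of the action G × G/H → G/H at (1,y), applied to (X,0). -/
lemma contMDiff_fundField (X : GroupLieAlgebra (𝓡 n) G) :
    ContMDiff (𝓡 d) (𝓡 d).tangent ∞
      (fun y => (⟨y, fundField n d X y⟩ : TangentBundle (𝓡 d) (G ⧸ H))) := by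
  have h1 := (contMDiff_smul hπ).contMDiff_tangentMap (m := ∞) (by simp)
  have h2 := (contMDiff_equivTangentBundleProd_symm (I := 𝓡 n) (M := G) (I' := 𝓡 d) (M' := G ⧸ H)
    (n := ∞))
  have h3 : ContMDiff (𝓡 d) ((𝓡 n).tangent.prod (𝓡 d).tangent) ∞
      (fun y : G ⧸ H => ((⟨(1 : G), X⟩ : TangentBundle (𝓡 n) G),
        (⟨y, 0⟩ : TangentBundle (𝓡 d) (G ⧸ H)))) :=
    contMDiff_const.prodMk (Bundle.contMDiff_zeroSection ℝ (TangentSpace (𝓡 d) : G ⧸ H → Type _))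
  have h4 := h1.comp (h2.comp h3)
  refine h4.congr fun y => ?_
  have h5 : dE (Eu n) (Eu d) (fun k : G => k • y) (1 : G) X
      = mfderiv ((𝓡 n).prod (𝓡 d)) (𝓡 d) (fun p : G × (G ⧸ H) => p.1 • p.2) ((1 : G), y) (X, 0) := by
    have h6 := mfderiv_comp (I := 𝓡 n) (I' := (𝓡 n).prod (𝓡 d)) (I'' := 𝓡 d)
      (g := fun p : G × (G ⧸ H) => p.1 • p.2) (f := fun k : G => (k, y)) (1 : G)
      ((contMDiff_smul hπ).mdifferentiable (by simp) _)
      (mdifferentiableAt_id.prodMk mdifferentiableAt_const)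
    rw [mfderiv_prod_left] at h6
    exact congrArg (fun T : Eu n →L[ℝ] Eu d => T X) h6
  have h7 : ∀ (z : G ⧸ H) (v : Eu d), z = y →
      (⟨y, v⟩ : TangentBundle (𝓡 d) (G ⧸ H)) = ⟨z, v⟩ := by
    rintro z v rfl
    rfl
  refine (h7 ((1 : G) • y) _ (one_smul G y)).trans ?_
  show (⟨(1 : G) • y, dE (Eu n) (Eu d) (fun k : G => k • y) (1 : G) X⟩ :
    TangentBundle (𝓡 d) (G ⧸ H)) = _
  rw [h5]
  rfl

lemma dE_act_fundField (k : G) (Y : GroupLieAlgebra (𝓡 n) G) (g : G) :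
    dE (Eu d) (Eu d) (fun y : G ⧸ H => k • y) (g : G ⧸ H) (gS n d H g (Ad n g⁻¹ Y))
      = gS n d H (k * g) (Ad n (k * g)⁻¹ (Ad n k Y)) := by
  rw [dE_act_gS hπ, ← Ad_mul_apply]
  congr 3
  group

end Fundamental

/-! ### Flows of fundamental fields and their Lie derivatives. -/

section Flow

variable {n d : ℕ} {G : Type*} [TopologicalSpace G] [ChartedSpace (Eu n) G]
  [Group G] {H : Subgroup G} [ChartedSpace (Eu d) (G ⧸ H)]
variable [LieGroup (𝓡 n) ∞ G] [IsManifold (𝓡 d) ∞ (G ⧸ H)] [T2Space G]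
  (hπ : Manifold.IsSubmersion (𝓡 n) (𝓡 d) ∞ (fun k : G => (k : G ⧸ H)))

include hπ

lemma contMDiff_flow (X : GroupLieAlgebra (𝓡 n) G) :
    ContMDiff (𝓘(ℝ, ℝ).prod (𝓡 d)) (𝓡 d) ∞ (fun p : ℝ × (G ⧸ H) => oneParam X p.1 • p.2) :=
  (contMDiff_smul hπ).comp (((contMDiff_oneParam X).comp contMDiff_fst).prodMk contMDiff_snd)

lemma dE_flow (X : GroupLieAlgebra (𝓡 n) G) (y : G ⧸ H) :
    dE ℝ (Eu d) (fun t : ℝ => oneParam X t • y) (0 : ℝ) (1 : ℝ) = fundField n d X y := by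
  have h := dE_comp_apply (E := ℝ) (E' := Eu n) (E'' := Eu d) (g := fun k : G => k • y)
    (f := oneParam X) (0 : ℝ) (mdiff_orbit hπ y _) (mdiff_oneParam X _) (1 : ℝ)
  rw [dE_oneParam_zero, oneParam_zero] at h
  exact h

/-- The pullback of a vector field by the flow of a fundamental vector field. -/
def flowPullback (n d : ℕ) {G : Type*} [TopologicalSpace G] [ChartedSpace (Eu n) G]
    [Group G] {H : Subgroup G} [ChartedSpace (Eu d) (G ⧸ H)] [LieGroup (𝓡 n) ∞ G] [T2Space G]
    (X : GroupLieAlgebra (𝓡 n) G) (Y : (y : G ⧸ H) → TangentSpace (𝓡 d) y) (x : G ⧸ H) (t : ℝ) :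
    Eu d :=
  dE (Eu d) (Eu d) (fun y : G ⧸ H => (oneParam X t)⁻¹ • y) (oneParam X t • x)
    (Y (oneParam X t • x))

lemma dE_flowPullback (X : GroupLieAlgebra (𝓡 n) G) (Y : (y : G ⧸ H) → TangentSpace (𝓡 d) y)
    (x : G ⧸ H) (t : ℝ) :
    dE (Eu d) (Eu d) (fun y : G ⧸ H => oneParam X t • y) x (flowPullback n d X Y x t)
      = Y (oneParam X t • x) := by
  have h := dE_comp_apply (E := Eu d) (E' := Eu d) (E'' := Eu d)
    (g := fun y : G ⧸ H => oneParam X t • y) (f := fun y : G ⧸ H => (oneParam X t)⁻¹ • y)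
    (oneParam X t • x) (mdiff_act hπ _ _) (mdiff_act hπ _ _) (Y (oneParam X t • x))
  simp only [smul_inv_smul, inv_smul_smul, dE_id] at h
  exact h.symm

/-- The Lie derivative along a fundamental vector field. -/
lemma hasDerivAt_flowPullback (X : GroupLieAlgebra (𝓡 n) G)
    {Y : (y : G ⧸ H) → TangentSpace (𝓡 d) y} {x : G ⧸ H}
    (hY : MDifferentiableAt (𝓡 d) (𝓡 d).tangent
      (fun y => (⟨y, Y y⟩ : TangentBundle (𝓡 d) (G ⧸ H))) x) :
    HasDerivAt (flowPullback n d X Y x)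
      (VectorField.mlieBracket (𝓡 d) (fundField n d X) Y x : Eu d) 0 :=
  hasDerivAt_pullback (E := Eu d) (Φ := fun t y => oneParam X t • y) (contMDiff_flow hπ X)
    (fun y => by rw [oneParam_zero, one_smul]) (dE_flow hπ X) hY
    (Filter.Eventually.of_forall fun t => dE_flowPullback hπ X Y x t)

lemma flowPullback_zero (X : GroupLieAlgebra (𝓡 n) G) (Y : (y : G ⧸ H) → TangentSpace (𝓡 d) y)
    (x : G ⧸ H) : flowPullback n d X Y x 0 = Y x := by
  have h := dE_flowPullback hπ X Y x 0
  rw [oneParam_zero, one_smul] at h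
  simp only [one_smul, dE_id] at h
  exact h

lemma flowPullback_fundField (X Y : GroupLieAlgebra (𝓡 n) G) (g : G) (t : ℝ) :
    flowPullback n d X (fundField n d Y) (g : G ⧸ H) t
      = gS n d H g (Ad n g⁻¹ (Ad n (oneParam X (-t)) Y)) := by
  have h1 : flowPullback n d X (fundField n d Y) (g : G ⧸ H) t
      = dE (Eu d) (Eu d) (fun y : G ⧸ H => (oneParam X t)⁻¹ • y) ((oneParam X t * g : G) : G ⧸ H)
        (gS n d H (oneParam X t * g) (Ad n (oneParam X t * g)⁻¹ Y)) :=
    congrArg (dE (Eu d) (Eu d) (fun y : G ⧸ H => (oneParam X t)⁻¹ • y)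
      ((oneParam X t * g : G) : G ⧸ H)) (fundField_coe hπ Y (oneParam X t * g))
  rw [h1, dE_act_fundField hπ, inv_mul_cancel_left, oneParam_neg]

/-- The pullback of the second field at time t is g_*Ad(g⁻¹)Ad(exp(−tX))Y. The inverse in the
exponent produces the sign: passing to fundamental fields of a left action reverses brackets. -/
lemma mlieBracket_fundField (X Y : GroupLieAlgebra (𝓡 n) G) (g : G) :
    (VectorField.mlieBracket (𝓡 d) (fundField n d X) (fundField n d Y) (g : G ⧸ H) : Eu d)
      = -gS n d H g (Ad n g⁻¹ ⁅X, Y⁆) := by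
  have h1 := hasDerivAt_flowPullback hπ X ((contMDiff_fundField (d := d) hπ Y).mdifferentiable
    (by simp) (g : G ⧸ H))
  let T : Eu n →L[ℝ] Eu d := LinearMap.toContinuousLinearMap
    (show Eu n →ₗ[ℝ] Eu d from gS n d H g ∘ₗ Ad n g⁻¹)
  have h2 : flowPullback n d X (fundField n d Y) (g : G ⧸ H)
      = fun t => T (AdE n (oneParam X (-t)) Y) :=
    funext fun t => flowPullback_fundField hπ X Y g t
  rw [h2] at h1
  have h3 : HasDerivAt (fun t : ℝ => AdE n (oneParam X (-t)) Y) ((-1 : ℝ) • adE X Y) 0 := by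
    have h4 := hasDerivAt_AdE_zero X Y
    rw [← neg_zero] at h4
    exact h4.scomp (0 : ℝ) (hasDerivAt_neg (0 : ℝ))
  have h4 := h1.unique (T.hasFDerivAt.comp_hasDerivAt (0 : ℝ) h3)
  rw [map_smul, neg_one_smul] at h4
  exact h4

end Flow

/-! ### Differentiating the metric along fundamental fields. -/

section Metric

variable {n d : ℕ} {G : Type*} [TopologicalSpace G] [ChartedSpace (Eu n) G]
  [Group G] {H : Subgroup G} [ChartedSpace (Eu d) (G ⧸ H)]
  [LieGroup (𝓡 n) ∞ G] [IsManifold (𝓡 d) ∞ (G ⧸ H)] [T2Space G]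
  (hπ : Manifold.IsSubmersion (𝓡 n) (𝓡 d) ∞ (fun k : G => (k : G ⧸ H)))
  {σ : G →* G} (hσ : IsSymmetricPair n σ H)

/-- The metric at `x`, as a continuous bilinear map on the model space. -/
def metricE (n d : ℕ) {G : Type*} [TopologicalSpace G] [ChartedSpace (Eu n) G]
    [Group G] {H : Subgroup G} [ChartedSpace (Eu d) (G ⧸ H)] [LieGroup (𝓡 n) ∞ G]
    (σ : G →* G) (x : G ⧸ H) : Eu d →L[ℝ] Eu d →L[ℝ] ℝ :=
  LinearMap.toContinuousBilinearMap
    (show Eu d →ₗ[ℝ] Eu d →ₗ[ℝ] ℝ from metric n d σ x)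

include hπ hσ

lemma metric_eq_of_smul_eq (g k : G) {y : G ⧸ H} (hy : k • y = (g : G ⧸ H)) (u v : Eu d) :
    metric n d σ y u v = metricE n d σ (g : G ⧸ H)
      (dE (Eu d) (Eu d) (fun z : G ⧸ H => k • z) y u)
      (dE (Eu d) (Eu d) (fun z : G ⧸ H => k • z) y v) := by
  obtain ⟨l, rfl⟩ := QuotientGroup.mk_surjective y
  rw [← hy]
  exact (metric_act hπ hσ k l u v).symm

/-- With a local section s, the isometry g s(y)⁻¹ moves y to gH, so ⟨Y,Z⟩ near gH is one fixed
bilinear form applied to transported vectors. -/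
lemma mdifferentiableAt_metric {x : G ⧸ H} {Y Z : (y : G ⧸ H) → TangentSpace (𝓡 d) y}
    (hY : MDifferentiableAt (𝓡 d) (𝓡 d).tangent
      (fun y => (⟨y, Y y⟩ : TangentBundle (𝓡 d) (G ⧸ H))) x)
    (hZ : MDifferentiableAt (𝓡 d) (𝓡 d).tangent
      (fun y => (⟨y, Z y⟩ : TangentBundle (𝓡 d) (G ⧸ H))) x) :
    MDifferentiableAt (𝓡 d) 𝓘(ℝ, ℝ) (fun y => metric n d σ y (Y y) (Z y)) x := by
  obtain ⟨g, rfl⟩ := QuotientGroup.mk_surjective x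
  obtain ⟨s, hs, hsg, hsec⟩ := exists_local_section hπ g
  have hΨ : ContMDiffAt ((𝓡 d).prod (𝓡 d)) (𝓡 d) ∞
      (fun p : (G ⧸ H) × (G ⧸ H) => (g * (s p.1)⁻¹) • p.2) ((g : G ⧸ H), (g : G ⧸ H)) := by
    have h1 : ContMDiffAt ((𝓡 d).prod (𝓡 d)) (𝓡 n) ∞
        (fun p : (G ⧸ H) × (G ⧸ H) => g * (s p.1)⁻¹) ((g : G ⧸ H), (g : G ⧸ H)) :=
      contMDiffAt_const.mul (ContMDiffAt.comp ((g : G ⧸ H), (g : G ⧸ H)) hs contMDiffAt_fst).inv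
    exact (contMDiff_smul hπ _).comp ((g : G ⧸ H), (g : G ⧸ H)) (h1.prodMk contMDiffAt_snd)
  have hfix : ∀ᶠ y in 𝓝 (g : G ⧸ H), (g * (s y)⁻¹) • y = (g : G ⧸ H) := by
    filter_upwards [hsec] with y hy
    have h1 : (g * (s y)⁻¹) • ((s y : G) : G ⧸ H) = (g : G ⧸ H) := by
      rw [smul_coe, inv_mul_cancel_right]
    rwa [show ((s y : G) : G ⧸ H) = y from hy] at h1
  have h1 := mdifferentiableAt_dE_apply (Ψ := fun y z => (g * (s y)⁻¹) • z) hΨ hfix hY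
  have h2 := mdifferentiableAt_dE_apply (Ψ := fun y z => (g * (s y)⁻¹) • z) hΨ hfix hZ
  have h3 := ((metricE n d σ (g : G ⧸ H)).differentiableAt.mdifferentiableAt.comp _ h1).clm_apply h2
  refine h3.congr_of_eventuallyEq ?_
  filter_upwards [hfix] with y hy
  exact metric_eq_of_smul_eq hπ hσ g _ hy (Y y) (Z y)

/-- The derivative of `⟨Y, Z⟩` along a fundamental vector field, which is a Killing field. -/
theorem dMetric_fundField (X : GroupLieAlgebra (𝓡 n) G) {x : G ⧸ H}
    {Y Z : (y : G ⧸ H) → TangentSpace (𝓡 d) y}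
    (hY : MDifferentiableAt (𝓡 d) (𝓡 d).tangent
      (fun y => (⟨y, Y y⟩ : TangentBundle (𝓡 d) (G ⧸ H))) x)
    (hZ : MDifferentiableAt (𝓡 d) (𝓡 d).tangent
      (fun y => (⟨y, Z y⟩ : TangentBundle (𝓡 d) (G ⧸ H))) x) :
    dMetric n d σ Y Z x (fundField n d X x)
      = metric n d σ x (VectorField.mlieBracket (𝓡 d) (fundField n d X) Y x) (Z x)
        + metric n d σ x (Y x) (VectorField.mlieBracket (𝓡 d) (fundField n d X) Z x) := by
  set f : G ⧸ H → ℝ := fun y => metric n d σ y (Y y) (Z y) with hf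
  have hfd : MDifferentiableAt (𝓡 d) 𝓘(ℝ, ℝ) f (oneParam X 0 • x) := by
    rw [oneParam_zero, one_smul]
    exact mdifferentiableAt_metric hπ hσ hY hZ
  have hflow : MDifferentiableAt 𝓘(ℝ, ℝ) (𝓡 d) (fun t : ℝ => oneParam X t • x) 0 :=
    (mdiff_orbit hπ x _).comp (0 : ℝ) (mdiff_oneParam X _)
  have h1 := dE_comp_apply (E := ℝ) (E' := Eu d) (E'' := ℝ) (g := f)
    (f := fun t : ℝ => oneParam X t • x) (0 : ℝ) hfd hflow (1 : ℝ)
  rw [dE_flow hπ, oneParam_zero, one_smul] at h1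
  -- The flow acts by isometries, so along it ⟨Y,Z⟩ equals the form at x on the pulled-back fields,
  -- and the product rule applies.
  have h2 : (fun t : ℝ => f (oneParam X t • x)) = fun t => metricE n d σ x
      (flowPullback n d X Y x t) (flowPullback n d X Z x t) := by
    ext1 t
    obtain ⟨g, rfl⟩ := QuotientGroup.mk_surjective x
    exact metric_eq_of_smul_eq hπ hσ g (oneParam X t)⁻¹ (inv_smul_smul _ _) _ _
  have h3 := ((metricE n d σ x).hasFDerivAt.comp_hasDerivAt (0 : ℝ)
    (hasDerivAt_flowPullback hπ X hY)).clm_apply (hasDerivAt_flowPullback hπ X hZ)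
  rw [dE_eq_fderiv, h2] at h1
  refine h1.symm.trans (Eq.trans h3.deriv ?_)
  exact congrArg₂ (· + ·)
    (congrArg (metricE n d σ x (VectorField.mlieBracket (𝓡 d) (fundField n d X) Y x))
      (flowPullback_zero hπ X Z x))
    (congrArg (fun u : Eu d =>
      metricE n d σ x u (VectorField.mlieBracket (𝓡 d) (fundField n d X) Z x))
      (flowPullback_zero hπ X Y x))

/-- The Lie derivative of a field tangent to `M = H • x` along a fundamental field of `𝔥` is
tangent to `M`. -/
lemma metric_mlieBracket_eq_zero {X : GroupLieAlgebra (𝓡 n) G} (hX : dInv n σ X = X) {x : G ⧸ H}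
    {Y : (y : G ⧸ H) → TangentSpace (𝓡 d) y}
    (hY : MDifferentiableAt (𝓡 d) (𝓡 d).tangent
      (fun y => (⟨y, Y y⟩ : TangentBundle (𝓡 d) (G ⧸ H))) x)
    (hM : ∀ᶠ y in 𝓝 x, y ∈ MulAction.orbit H x → Y y ∈ orbitTangent n d σ y)
    {v : TangentSpace (𝓡 d) x} (hv : v ∈ orbitNormal n d σ x) :
    metric n d σ x (VectorField.mlieBracket (𝓡 d) (fundField n d X) Y x) v = 0 := by
  have h1 := ((metricE n d σ x).hasFDerivAt.comp_hasDerivAt (0 : ℝ)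
    (hasDerivAt_flowPullback hπ X hY)).clm_apply (hasDerivAt_const (0 : ℝ) (show Eu d from v))
  have hcont : Filter.Tendsto (fun t : ℝ => oneParam X t • x) (𝓝 0) (𝓝 x) := by
    have h2 := ((mdiff_orbit hπ x _).comp (0 : ℝ) (mdiff_oneParam X _)).continuousAt.tendsto
    simp only [Function.comp_apply, oneParam_zero, one_smul] at h2
    exact h2
  -- The flow of X ∈ 𝔥 stays in H and preserves M, so the pullback of a tangent field remains in
  -- T_xM, orthogonal to v.
  have h2 : (fun t => metricE n d σ x (flowPullback n d X Y x t) (show Eu d from v))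
      =ᶠ[𝓝 0] fun _ => 0 := by
    filter_upwards [hcont.eventually hM] with t ht
    have h3 := ht ⟨⟨oneParam X t, oneParam_mem hσ hX t⟩, rfl⟩
    obtain ⟨g, rfl⟩ := QuotientGroup.mk_surjective x
    obtain ⟨F, hF, hFY⟩ := (mem_orbitTangent hπ hσ (oneParam X t * g) _).1 h3
    refine LinearMap.BilinForm.mem_orthogonal_iff.1 hv _ ((mem_orbitTangent hπ hσ g _).2
      ⟨Ad n (oneParam X t)⁻¹ F, ?_, ?_⟩)
    · rw [hσ.dInv_Ad (inv_mem (oneParam_mem hσ hX t)), hF]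
    · have h4 := dE_act_fundField (d := d) hπ (oneParam X t)⁻¹ F (oneParam X t * g)
      rw [inv_mul_cancel_left] at h4
      refine h4.symm.trans ?_
      exact congrArg (dE (Eu d) (Eu d) (fun y : G ⧸ H => (oneParam X t)⁻¹ • y)
        ((oneParam X t * g : G) : G ⧸ H)) hFY
  have h3 := (h1.congr_of_eventuallyEq h2.symm).unique (hasDerivAt_const (0 : ℝ) (0 : ℝ))
  rw [map_zero, add_zero] at h3
  exact h3

end Metric

/-! ### Lie algebra identities for the second fundamental form. -/

section Algebra

variable {L : Type*} [LieRing L] [LieAlgebra ℝ L] {θ : L →ₗ[ℝ] L}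

lemma antiPart_lie_of_anti (hθ : IsLieInvolution θ) (x : L) {z : L} (hz : θ z = -z) :
    antiPart θ ⁅x, z⁆ = ⁅fixPart θ x, z⁆ := by
  rw [antiPart_apply, fixPart_apply, hθ.lie, hz, lie_neg, sub_neg_eq_add, smul_lie, add_lie]

lemma antiPart_lie (hθ : IsLieInvolution θ) (x y : L) :
    antiPart θ ⁅x, y⁆ = ⁅fixPart θ x, antiPart θ y⁆ - ⁅fixPart θ y, antiPart θ x⁆ := by
  have h1 : antiPart θ ⁅x, fixPart θ y⁆ = -⁅fixPart θ y, antiPart θ x⁆ := by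
    have h2 := mem_fixSub.1 (hθ.fixPart_mem y)
    rw [antiPart_apply, hθ.lie, h2, antiPart_apply, ← sub_lie, ← lie_skew, lie_smul, smul_neg]
  have h2 := antiPart_lie_of_anti hθ x (mem_antiSub.1 (hθ.antiPart_mem y))
  rw [sub_eq_add_neg, ← h1, ← h2, ← map_add, ← lie_add, add_comm, fixPart_add_antiPart]

lemma killingForm_antiPart_lie (x y z : L) :
    killingForm ℝ L (antiPart θ x) ⁅z, fixPart θ y⁆
      = killingForm ℝ L z ⁅fixPart θ y, antiPart θ x⁆ := by
  rw [killingForm_comm, ← lie_skew, map_neg, LinearMap.neg_apply, killingForm_lie, neg_neg]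

/-- The second fundamental form is symmetric. -/
lemma killingForm_antiPart_lie_symm (hθ : IsLieInvolution θ) {x y z : L}
    (h : killingForm ℝ L z (antiPart θ ⁅x, y⁆) = 0) :
    killingForm ℝ L (antiPart θ x) ⁅z, fixPart θ y⁆
      = killingForm ℝ L (antiPart θ y) ⁅z, fixPart θ x⁆ := by
  rw [killingForm_antiPart_lie, killingForm_antiPart_lie]
  rw [antiPart_lie hθ, map_sub, sub_eq_zero] at h
  exact h.symm

/-- The two brackets with the normal vector z that survive in the Koszul formula are equal by
symmetry of the second fundamental form, whence the factor 2. -/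
lemma killingForm_antiPart_lie_add (hθ : IsLieInvolution θ) {x y z : L} (hz : θ z = -z)
    (h : killingForm ℝ L z (antiPart θ ⁅x, y⁆) = 0) :
    killingForm ℝ L (antiPart θ ⁅x, z⁆) (antiPart θ y)
      + killingForm ℝ L (antiPart θ ⁅y, z⁆) (antiPart θ x)
      = -2 * killingForm ℝ L (antiPart θ x) ⁅z, fixPart θ y⁆ := by
  have h1 := killingForm_antiPart_lie_symm hθ h
  rw [killingForm_antiPart_lie, killingForm_antiPart_lie] at h1
  rw [killingForm_antiPart_lie, antiPart_lie_of_anti hθ x hz, antiPart_lie_of_anti hθ y hz,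
    killingForm_lie, killingForm_lie, ← h1]
  ring

end Algebra

/-- Bookkeeping for the Koszul formula. For fields X, Y, V with values e, f, v, the a's are brackets
of fundamental fields with the given fields, the b's brackets of fundamental fields among
themselves, and the c's brackets of the given fields. -/
lemma koszul_eq {E : Type*} [NormedAddCommGroup E] [NormedSpace ℝ E] (m : E →L[ℝ] E →L[ℝ] ℝ)
    (hm : ∀ u v, m u v = m v u) (e f v : E) {a₁ a₂ a₃ a₄ a₅ a₆ b₁ b₂ b₃ c₁ c₂ c₃ : E}
    (h₁ : c₁ = a₁ - a₃ - b₁) (h₂ : c₂ = a₂ - a₅ - b₂) (h₃ : c₃ = a₄ - a₆ - b₃) :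
    (1 / 2 : ℝ) * ((m a₁ v + m f a₂) + (m a₃ v + m e a₄) - (m a₅ f + m e a₆)
      + m c₁ v - m c₂ f - m c₃ e)
      = m a₁ v - (1 / 2) * m b₁ v + (1 / 2) * (m b₂ f + m b₃ e) := by
  simp only [h₁, h₂, h₃, map_sub, sub_apply, hm f a₂, hm e a₄, hm e a₆]
  ring

/-! ### The Levi-Civita connection on fields tangent to the orbit. -/

section LeviCivita

variable {n d : ℕ} {G : Type*} [TopologicalSpace G] [ChartedSpace (Eu n) G]
  [Group G] {H : Subgroup G} [ChartedSpace (Eu d) (G ⧸ H)]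
  [LieGroup (𝓡 n) ∞ G] [IsManifold (𝓡 d) ∞ (G ⧸ H)] [T2Space G]
  (hπ : Manifold.IsSubmersion (𝓡 n) (𝓡 d) ∞ (fun k : G => (k : G ⧸ H)))
  {σ : G →* G} (hσ : IsSymmetricPair n σ H)

include hπ hσ

lemma metric_comm (x : G ⧸ H) (u v : TangentSpace (𝓡 d) x) :
    metric n d σ x u v = metric n d σ x v u := by
  obtain ⟨g, rfl⟩ := QuotientGroup.mk_surjective x
  refine (metric_eq hπ hσ g u v).trans (Eq.trans ?_ (metric_eq hπ hσ g v u).symm)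
  exact killingForm_comm _ _

lemma killingForm_antiPart_eq_zero {g : G} {v : Eu d} (hv : v ∈ orbitNormal n d σ (g : G ⧸ H))
    {X : GroupLieAlgebra (𝓡 n) G} (hX : dInv n σ X = X) :
    killingForm ℝ (GroupLieAlgebra (𝓡 n) G) (gI n d σ H g v)
      (antiPart (dInv n σ) (Ad n g⁻¹ X)) = 0 :=
  (mem_normalPart.1 ((mem_orbitNormal_iff hπ hσ g v).1 hv)).2 _ ⟨X, mem_fixSub.2 hX, rfl⟩

/-- The Koszul formula for three fields, in terms of fundamental fields with the same values. -/
lemma leviCivita_eq_of_fundField {x : G ⧸ H} {X Y V : (y : G ⧸ H) → TangentSpace (𝓡 d) y}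
    (hX : MDifferentiableAt (𝓡 d) (𝓡 d).tangent
      (fun y => (⟨y, X y⟩ : TangentBundle (𝓡 d) (G ⧸ H))) x)
    (hY : MDifferentiableAt (𝓡 d) (𝓡 d).tangent
      (fun y => (⟨y, Y y⟩ : TangentBundle (𝓡 d) (G ⧸ H))) x)
    (hV : MDifferentiableAt (𝓡 d) (𝓡 d).tangent
      (fun y => (⟨y, V y⟩ : TangentBundle (𝓡 d) (G ⧸ H))) x)
    {E F Z : GroupLieAlgebra (𝓡 n) G} (hE : X x = fundField n d E x) (hF : Y x = fundField n d F x)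
    (hZ : V x = fundField n d Z x) :
    leviCivita n d σ X Y V x
      = metricE n d σ x (VectorField.mlieBracket (𝓡 d) (fundField n d E) Y x) (V x)
        - (1 / 2) * metricE n d σ x
          (VectorField.mlieBracket (𝓡 d) (fundField n d E) (fundField n d F) x) (V x)
        + (1 / 2) * (metricE n d σ x
          (VectorField.mlieBracket (𝓡 d) (fundField n d E) (fundField n d Z) x) (Y x)
          + metricE n d σ x
          (VectorField.mlieBracket (𝓡 d) (fundField n d F) (fundField n d Z) x) (X x)) := by
  have hbr : ∀ (X' Y' : (y : G ⧸ H) → TangentSpace (𝓡 d) y) (A B : GroupLieAlgebra (𝓡 n) G),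
      X' x = fundField n d A x → Y' x = fundField n d B x →
      (VectorField.mlieBracket (𝓡 d) X' Y' x : Eu d)
        = (VectorField.mlieBracket (𝓡 d) (fundField n d A) Y' x : Eu d)
          - (VectorField.mlieBracket (𝓡 d) (fundField n d B) X' x : Eu d)
          - (VectorField.mlieBracket (𝓡 d) (fundField n d A) (fundField n d B) x : Eu d) := by
    intro X' Y' A B hA hB
    refine (mlieBracket_eq_of_eq (E := Eu d) x hA hB).trans ?_
    have h1 : (VectorField.mlieBracket (𝓡 d) X' (fundField n d B) x : Eu d)
        = -(VectorField.mlieBracket (𝓡 d) (fundField n d B) X' x : Eu d) :=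
      VectorField.mlieBracket_swap_apply
    have h2 : ∀ p q r q' : Eu d, q = -q' → p + q - r = p - q' - r := by
      rintro p q r q' rfl
      rw [← sub_eq_add_neg]
    exact h2 _ _ _ _ h1
  refine Eq.trans ?_ (koszul_eq (metricE n d σ x) (metric_comm hπ hσ x) (X x) (Y x) (V x)
    (hbr X Y E F hE hF) (hbr X V E Z hE hZ) (hbr Y V F Z hF hZ))
  have d1 := dMetric_fundField hπ hσ E hY hV
  have d2 := dMetric_fundField hπ hσ F hX hV
  have d3 := dMetric_fundField hπ hσ Z hX hY
  rw [← hE] at d1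
  rw [← hF] at d2
  rw [← hZ] at d3
  rw [leviCivita, d1, d2, d3]
  rfl

/-- The second fundamental form of `M = H • x` in the direction of a normal vector `v`. -/
theorem leviCivita_eq {g : G} {X Y V : (y : G ⧸ H) → TangentSpace (𝓡 d) y}
    (hX : MDifferentiableAt (𝓡 d) (𝓡 d).tangent
      (fun y => (⟨y, X y⟩ : TangentBundle (𝓡 d) (G ⧸ H))) (g : G ⧸ H))
    (hY : MDifferentiableAt (𝓡 d) (𝓡 d).tangent
      (fun y => (⟨y, Y y⟩ : TangentBundle (𝓡 d) (G ⧸ H))) (g : G ⧸ H))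
    (hV : MDifferentiableAt (𝓡 d) (𝓡 d).tangent
      (fun y => (⟨y, V y⟩ : TangentBundle (𝓡 d) (G ⧸ H))) (g : G ⧸ H))
    (hM : ∀ᶠ y in 𝓝 (g : G ⧸ H), y ∈ MulAction.orbit H (g : G ⧸ H) → Y y ∈ orbitTangent n d σ y)
    {v : Eu d} (hv : v ∈ orbitNormal n d σ (g : G ⧸ H)) (hVv : V (g : G ⧸ H) = v)
    {E F : GroupLieAlgebra (𝓡 n) G} (hE : dInv n σ E = E) (hF : dInv n σ F = F)
    (hEX : X (g : G ⧸ H) = gS n d H g (Ad n g⁻¹ E))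
    (hFY : Y (g : G ⧸ H) = gS n d H g (Ad n g⁻¹ F)) :
    leviCivita n d σ X Y V (g : G ⧸ H)
      = killingForm ℝ (GroupLieAlgebra (𝓡 n) G) (antiPart (dInv n σ) (Ad n g⁻¹ E))
          ⁅gI n d σ H g v, fixPart (dInv n σ) (Ad n g⁻¹ F)⁆ := by
  set z := gI n d σ H g v with hz
  -- Chosen so that the fundamental field of Z takes the value v at gH.
  set Z := Ad n g z with hZ
  have hAdZ : Ad n g⁻¹ Z = z := Ad_inv_Ad g z
  have hθz : dInv n σ z = -z := mem_antiSub.1 (gI_mem hπ hσ g v)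
  have h1 := leviCivita_eq_of_fundField hπ hσ hX hY hV (E := E) (F := F) (Z := Z)
    (hEX.trans (fundField_coe hπ E g).symm) (hFY.trans (fundField_coe hπ F g).symm)
    (hVv.trans (Eq.trans (by rw [hAdZ, hz, gS_gI hπ hσ]) (fundField_coe hπ Z g).symm))
  have hF' := ((contMDiff_fundField (d := d) hπ F).mdifferentiable (by simp) (g : G ⧸ H))
  -- The terms [E*,Y] and [E*,F*] are tangent to M and drop out against v, leaving only the brackets
  -- with Z*.
  have h2 := metric_mlieBracket_eq_zero hπ hσ hE hY hM hv
  have h3 := metric_mlieBracket_eq_zero hπ hσ hE hF'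
    (Filter.Eventually.of_forall fun y _ => ⟨F, mem_fixSub.2 hF, rfl⟩) hv
  have hm : ∀ A B : GroupLieAlgebra (𝓡 n) G, metricE n d σ (g : G ⧸ H) (-gS n d H g A)
      (gS n d H g B) = -killingForm ℝ (GroupLieAlgebra (𝓡 n) G) (antiPart (dInv n σ) A)
        (antiPart (dInv n σ) B) := by
    intro A B
    rw [map_neg, neg_apply]
    exact congrArg Neg.neg (metric_gS hπ hσ g A B)
  have h4 : metricE n d σ (g : G ⧸ H) (VectorField.mlieBracket (𝓡 d) (fundField n d E)
      (fundField n d Z) (g : G ⧸ H)) (Y (g : G ⧸ H)) = _ :=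
    (congrArg₂ (fun u v : Eu d => metricE n d σ (g : G ⧸ H) u v)
      (mlieBracket_fundField hπ E Z g) hFY).trans (hm _ _)
  have h5 : metricE n d σ (g : G ⧸ H) (VectorField.mlieBracket (𝓡 d) (fundField n d F)
      (fundField n d Z) (g : G ⧸ H)) (X (g : G ⧸ H)) = _ :=
    (congrArg₂ (fun u v : Eu d => metricE n d σ (g : G ⧸ H) u v)
      (mlieBracket_fundField hπ F Z g) hEX).trans (hm _ _)
  have h6 := killingForm_antiPart_eq_zero hπ hσ hv (X := ⁅E, F⁆)
    (by rw [hσ.isLieInvolution.lie, hE, hF])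
  rw [Ad_lie] at h6
  have h7 := killingForm_antiPart_lie_add hσ.isLieInvolution hθz h6
  rw [Ad_lie, hAdZ] at h4 h5
  have h2' : metricE n d σ (g : G ⧸ H) (VectorField.mlieBracket (𝓡 d) (fundField n d E) Y
      (g : G ⧸ H)) (V (g : G ⧸ H)) = 0 := (congrArg _ hVv).trans h2
  have h3' : metricE n d σ (g : G ⧸ H) (VectorField.mlieBracket (𝓡 d) (fundField n d E)
      (fundField n d F) (g : G ⧸ H)) (V (g : G ⧸ H)) = 0 := (congrArg _ hVv).trans h3
  linarith

end LeviCivita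

lemma IsSymmetricPair.fixPart_Ad {n : ℕ} {G : Type*} [TopologicalSpace G] [ChartedSpace (Eu n) G]
    [Group G] [LieGroup (𝓡 n) ∞ G] {H : Subgroup G} {σ : G →* G} (hσ : IsSymmetricPair n σ H) {h : G}
    (hh : h ∈ H) (X : GroupLieAlgebra (𝓡 n) G) :
    fixPart (dInv n σ) (Ad n h X) = Ad n h (fixPart (dInv n σ) X) := by
  rw [fixPart_apply, fixPart_apply, hσ.dInv_Ad hh, map_smul, map_add]

/-! ### Existence, uniqueness and eigenvalues of the shape operator. -/

section ShapeOperator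

variable {n d : ℕ} {G : Type*} [TopologicalSpace G] [ChartedSpace (Eu n) G]
  [Group G] {H : Subgroup G} [ChartedSpace (Eu d) (G ⧸ H)]
  [LieGroup (𝓡 n) ∞ G] [IsManifold (𝓡 d) ∞ (G ⧸ H)] [T2Space G]
  (hπ : Manifold.IsSubmersion (𝓡 n) (𝓡 d) ∞ (fun k : G => (k : G ⧸ H)))
  {σ : G →* G} (hσ : IsSymmetricPair n σ H)

/-- The algebraic characterization of the shape operator for the normal vector `v`. -/
def IsAlgShape (n d : ℕ) {G : Type*} [TopologicalSpace G] [ChartedSpace (Eu n) G]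
    [Group G] {H : Subgroup G} [ChartedSpace (Eu d) (G ⧸ H)] [LieGroup (𝓡 n) ∞ G]
    (σ : G →* G) (g : G) (v : Eu d)
    (A : orbitTangent n d σ (g : G ⧸ H) →ₗ[ℝ] orbitTangent n d σ (g : G ⧸ H)) : Prop :=
  ∀ (u w : orbitTangent n d σ (g : G ⧸ H)) (F : GroupLieAlgebra (𝓡 n) G), dInv n σ F = F →
    (w : TangentSpace (𝓡 d) (g : G ⧸ H)) = gS n d H g (Ad n g⁻¹ F) →
    metric n d σ (g : G ⧸ H) (A u : TangentSpace (𝓡 d) (g : G ⧸ H))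
        (w : TangentSpace (𝓡 d) (g : G ⧸ H))
      = killingForm ℝ (GroupLieAlgebra (𝓡 n) G)
        (gI n d σ H g (u : TangentSpace (𝓡 d) (g : G ⧸ H)))
          ⁅gI n d σ H g v, fixPart (dInv n σ) (Ad n g⁻¹ F)⁆

include hπ hσ

/-- Testing on fundamental fields gives the algebraic condition. Conversely `leviCivita_eq` holds
for arbitrary admissible fields and depends only on their values at gH. -/
lemma isShapeOperator_iff {g : G} {v : Eu d} (hv : v ∈ orbitNormal n d σ (g : G ⧸ H))
    (A : orbitTangent n d σ (g : G ⧸ H) →ₗ[ℝ] orbitTangent n d σ (g : G ⧸ H)) :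
    IsShapeOperator n d σ (g : G ⧸ H) v A ↔ IsAlgShape n d σ g v A := by
  constructor
  · intro h u w F hF hw
    obtain ⟨E, hE, hEu⟩ := (mem_orbitTangent hπ hσ g _).1 u.2
    have hsm := fun X : GroupLieAlgebra (𝓡 n) G => contMDiff_fundField (d := d) hπ X (g : G ⧸ H)
    have hmd := fun X : GroupLieAlgebra (𝓡 n) G => (hsm X).mdifferentiableAt (by simp)
    have hM : ∀ X : GroupLieAlgebra (𝓡 n) G, dInv n σ X = X → ∀ y : G ⧸ H,
        fundField n d X y ∈ orbitTangent n d σ y := fun X hX y => ⟨X, mem_fixSub.2 hX, rfl⟩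
    have hV : (fundField n d (Ad n g (gI n d σ H g v)) (g : G ⧸ H) : Eu d) = v :=
      (fundField_coe hπ _ g).trans (by rw [Ad_inv_Ad, gS_gI hπ hσ])
    have hE' : (fundField n d E (g : G ⧸ H) : Eu d) = gS n d H g (Ad n g⁻¹ E) :=
      fundField_coe hπ E g
    have hF' : (fundField n d F (g : G ⧸ H) : Eu d) = gS n d H g (Ad n g⁻¹ F) :=
      fundField_coe hπ F g
    refine (h _ _ _ (hsm E) (hsm F) (hsm (Ad n g (gI n d σ H g v)))
      (Filter.Eventually.of_forall fun y _ => ⟨hM E hE y, hM F hF y⟩) hV u w (hE'.trans hEu)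
      (hF'.trans hw.symm)).trans ?_
    refine (leviCivita_eq hπ hσ (hmd E) (hmd F) (hmd _)
      (Filter.Eventually.of_forall fun y _ => hM F hF y) hv hV hE hF hE' hF').trans ?_
    rw [← gI_gS hπ hσ, hEu]
  · intro h X Y V hX hY hV hM hVv u w hu hw
    obtain ⟨E, hE, hEu⟩ := (mem_orbitTangent hπ hσ g _).1 u.2
    obtain ⟨F, hF, hFw⟩ := (mem_orbitTangent hπ hσ g _).1 w.2
    refine (h u w F hF hFw.symm).trans ?_
    refine Eq.trans ?_ (leviCivita_eq hπ hσ (hX.mdifferentiableAt (by simp))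
      (hY.mdifferentiableAt (by simp)) (hV.mdifferentiableAt (by simp))
      (hM.mono fun y hy hyM => (hy hyM).2) hv hVv hE hF (hu.trans hEu.symm)
      (hw.trans hFw.symm)).symm
    rw [← gI_gS hπ hσ, hEu]

/-- The second fundamental form does not depend on the choice of the element of `𝔥`. -/
lemma killingForm_lie_fixPart_eq_zero {g : G} {v u : Eu d}
    (hv : v ∈ orbitNormal n d σ (g : G ⧸ H)) (hu : u ∈ orbitTangent n d σ (g : G ⧸ H))
    {F : GroupLieAlgebra (𝓡 n) G} (hF : dInv n σ F = F) (h0 : gS n d H g (Ad n g⁻¹ F) = 0) :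
    killingForm ℝ (GroupLieAlgebra (𝓡 n) G) (gI n d σ H g u)
      ⁅gI n d σ H g v, fixPart (dInv n σ) (Ad n g⁻¹ F)⁆ = 0 := by
  obtain ⟨E, hE, rfl⟩ := (mem_orbitTangent hπ hσ g _).1 hu
  have h1 := killingForm_antiPart_eq_zero hπ hσ hv (X := ⁅E, F⁆)
    (by rw [hσ.isLieInvolution.lie, hE, hF])
  rw [Ad_lie] at h1
  rw [gI_gS hπ hσ, killingForm_antiPart_lie_symm hσ.isLieInvolution h1, ← gI_gS hπ hσ g, h0,
    map_zero, map_zero, LinearMap.zero_apply]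

/-- T stands for h_*g_* with h = gkg⁻¹. Applied to the 𝔮-component of Ad(g⁻¹)F it gives the orbit
direction of Ad(h)F, which is again in 𝔥. -/
lemma map_rootSpace_le {𝔞 : Submodule ℝ (GroupLieAlgebra (𝓡 n) G)}
    (h𝔞 : IsCartanSubspace (LinearMap.ker (dInv n σ + LinearMap.id)) 𝔞) {g : G} {w : 𝔞}
    (hU : IsExpPair (dInv n σ) w (Ad n g⁻¹) (Ad n g)) {k : G} (hk : k ∈ H) (hgk : g * k * g⁻¹ ∈ H)
    {α : Module.Dual ℂ (𝔞.baseChange ℂ)} (hα : ¬ IsSingularAt w α)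
    {T : GroupLieAlgebra (𝓡 n) G →ₗ[ℝ] TangentSpace (𝓡 d) (g : G ⧸ H)}
    (hT : ∀ X, dInv n σ X = -X → T X = gS n d H g (Ad n k X)) :
    (rootSpace (LinearMap.ker (dInv n σ + LinearMap.id)) 𝔞 α).map (T.baseChange ℂ)
      ≤ (orbitTangent n d σ (g : G ⧸ H)).baseChange ℂ := by
  refine (Submodule.map_mono (hU.rootSpace_le_tangentPart hσ.isLieInvolution h𝔞 hα)).trans ?_
  rw [← map_baseChange, baseChange_le_iff]
  rintro _ ⟨_, ⟨F, hF, rfl⟩, rfl⟩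
  have hF := mem_fixSub.1 hF
  have h1 := hT (antiPart (dInv n σ) (Ad n g⁻¹ F))
    (mem_antiSub.1 (hσ.isLieInvolution.antiPart_mem _))
  refine Eq.mpr (congrArg (fun v => v ∈ orbitTangent n d σ (g : G ⧸ H)) h1)
    ((mem_orbitTangent hπ hσ g _).2 ⟨Ad n (g * k * g⁻¹) F, by rw [hσ.dInv_Ad hgk, hF], ?_⟩)
  rw [← hσ.antiPart_Ad hk, gS_antiPart hπ hσ, ← Ad_mul_apply, ← Ad_mul_apply]
  congr 3
  group

variable [LieAlgebra.IsKilling ℝ (GroupLieAlgebra (𝓡 n) G)]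
  {𝔞 : Submodule ℝ (GroupLieAlgebra (𝓡 n) G)}
  (h𝔞 : IsCartanSubspace (LinearMap.ker (dInv n σ + LinearMap.id)) 𝔞)
  {P : Set (Module.Dual ℂ (𝔞.baseChange ℂ))}
  (hP : IsPositiveSystem (LinearMap.ker (dInv n σ + LinearMap.id)) 𝔞 P)
  {g : G} {w : 𝔞} (hU : IsExpPair (dInv n σ) w (Ad n g⁻¹) (Ad n g))

include h𝔞 hP hU

/-- The orbit is a nondegenerate submanifold. -/
lemma nondegenerate_restrict :
    ((metric n d σ (g : G ⧸ H)).restrict (orbitTangent n d σ (g : G ⧸ H))).Nondegenerate := by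
  have hleft : ∀ u : orbitTangent n d σ (g : G ⧸ H),
      (∀ v : orbitTangent n d σ (g : G ⧸ H), metric n d σ (g : G ⧸ H) u v = 0) → u = 0 := by
    intro u hu
    have h1 : gI n d σ H g (u : TangentSpace (𝓡 d) (g : G ⧸ H)) = 0 := by
      refine hU.eq_zero_of_mem_tangentPart hσ.isLieInvolution h𝔞 hP
        ((mem_orbitTangent_iff hπ hσ g _).1 u.2) fun y hy => ?_
      have hy' : gI n d σ H g (gS n d H g y) = y := by
        rw [gI_gS hπ hσ, antiPart_of_mem (tangentPart_le hσ.isLieInvolution hy)]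
      have h2 := hu ⟨gS n d H g y, (mem_orbitTangent_iff hπ hσ g _).2 (hy'.symm ▸ hy)⟩
      have h3 := (metric_eq hπ hσ g (u : TangentSpace (𝓡 d) (g : G ⧸ H)) (gS n d H g y)).symm.trans h2
      rwa [hy'] at h3
    refine Subtype.ext ((gS_gI hπ hσ g _).symm.trans ?_)
    exact (congrArg (gS n d H g) h1).trans (map_zero _)
  refine ⟨fun u hu => hleft u hu, fun u hu => hleft u fun v => ?_⟩
  exact (metric_comm hπ hσ _ _ _).trans (hu v)

/-- A linear choice of preimages in 𝔥 turns the right-hand side into a bilinear form on T_xM,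
independent of that choice by `killingForm_lie_fixPart_eq_zero`. Nondegeneracy of the metric on T_xM
represents it by a unique A. -/
lemma existsUnique_isAlgShape {v : Eu d} (hv : v ∈ orbitNormal n d σ (g : G ⧸ H)) :
    ∃! A : orbitTangent n d σ (g : G ⧸ H) →ₗ[ℝ] orbitTangent n d σ (g : G ⧸ H),
      IsAlgShape n d σ g v A := by
  have hnd := nondegenerate_restrict hπ hσ h𝔞 hP hU
  set T := orbitTangent n d σ (g : G ⧸ H) with hT
  let θ := dInv n σ
  let q : LinearMap.ker (θ - LinearMap.id) →ₗ[ℝ] T := LinearMap.codRestrict T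
    (show LinearMap.ker (θ - LinearMap.id) →ₗ[ℝ] TangentSpace (𝓡 d) (g : G ⧸ H) from
      gS n d H g ∘ₗ Ad n g⁻¹ ∘ₗ Submodule.subtype _)
    fun F => (mem_orbitTangent hπ hσ g _).2 ⟨F, mem_fixSub.1 F.2, rfl⟩
  have hq : LinearMap.range q = ⊤ := by
    rw [LinearMap.range_eq_top]
    intro u
    obtain ⟨F, hF, hFu⟩ := (mem_orbitTangent hπ hσ g _).1 u.2
    exact ⟨⟨F, mem_fixSub.2 hF⟩, Subtype.ext hFu⟩
  obtain ⟨s, hs⟩ := q.exists_rightInverse_of_surjective hq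
  have hs' : ∀ u : T, (u : TangentSpace (𝓡 d) (g : G ⧸ H))
      = gS n d H g (Ad n g⁻¹ (s u : GroupLieAlgebra (𝓡 n) G)) := fun u =>
    (congrArg Subtype.val (LinearMap.congr_fun hs u)).symm
  let b : T →ₗ[ℝ] T →ₗ[ℝ] ℝ := (killingForm ℝ (GroupLieAlgebra (𝓡 n) G)).compl₁₂
    ((show TangentSpace (𝓡 d) (g : G ⧸ H) →ₗ[ℝ] GroupLieAlgebra (𝓡 n) G from gI n d σ H g) ∘ₗ
      T.subtype)
    (LieAlgebra.ad ℝ _ (gI n d σ H g v) ∘ₗ fixPart θ ∘ₗ Ad n g⁻¹ ∘ₗ Submodule.subtype _ ∘ₗ s)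
  have hb : ∀ (u w : T) (F : GroupLieAlgebra (𝓡 n) G), dInv n σ F = F →
      (w : TangentSpace (𝓡 d) (g : G ⧸ H)) = gS n d H g (Ad n g⁻¹ F) →
      b u w = killingForm ℝ (GroupLieAlgebra (𝓡 n) G)
        (gI n d σ H g (u : TangentSpace (𝓡 d) (g : G ⧸ H)))
          ⁅gI n d σ H g v, fixPart (dInv n σ) (Ad n g⁻¹ F)⁆ := by
    intro u w F hF hw
    have h1 := killingForm_lie_fixPart_eq_zero hπ hσ hv u.2 (F := (s w : _) - F)
      (by rw [map_sub, hF, mem_fixSub.1 (s w).2]) (by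
        rw [map_sub, map_sub, sub_eq_zero]
        exact (hs' w).symm.trans hw)
    rw [map_sub, map_sub, lie_sub, map_sub, sub_eq_zero] at h1
    exact h1
  let A : T →ₗ[ℝ] T := (LinearMap.BilinForm.toDual _ hnd).symm.toLinearMap ∘ₗ b
  have hA : ∀ u w : T, metric n d σ (g : G ⧸ H) (A u : TangentSpace (𝓡 d) (g : G ⧸ H))
        (w : TangentSpace (𝓡 d) (g : G ⧸ H)) = b u w := by
    intro u w
    exact LinearMap.BilinForm.apply_toDual_symm_apply (hB := hnd) (b u) w
  refine ⟨A, fun u w F hF hw => (hA u w).trans (hb u w F hF hw), fun A' hA' => ?_⟩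
  refine LinearMap.ext fun u => sub_eq_zero.1 (hnd.1 _ fun w => ?_)
  rw [map_sub, LinearMap.sub_apply, sub_eq_zero]
  exact (hA' u w _ (mem_fixSub.1 (s w).2) (hs' w)).trans
    ((hb u w _ (mem_fixSub.1 (s w).2) (hs' w)).symm.trans (hA u w).symm)

/-- By nondegeneracy it suffices to pair both sides with tangent vectors. Invariance of the Killing
form under Ad(k) reduces to k = 1, where `IsExpPair.killC_lie_fixPart` gives the factor. -/
lemma IsAlgShape.apply_eq_smul {k : G} (hk : k ∈ H) (hgk : g * k * g⁻¹ ∈ H) {a : 𝔞}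
    {A : orbitTangent n d σ (g : G ⧸ H) →ₗ[ℝ] orbitTangent n d σ (g : G ⧸ H)}
    (hA : IsAlgShape n d σ g (gS n d H g (Ad n k a)) A) {α : Module.Dual ℂ (𝔞.baseChange ℂ)}
    (hα : ¬ IsSingularAt w α)
    {T : GroupLieAlgebra (𝓡 n) G →ₗ[ℝ] TangentSpace (𝓡 d) (g : G ⧸ H)}
    (hT : ∀ X, dInv n σ X = -X → T X = gS n d H g (Ad n k X))
    {u : ℂ ⊗[ℝ] (orbitTangent n d σ (g : G ⧸ H))}
    (hu : (orbitTangent n d σ (g : G ⧸ H)).subtype.baseChange ℂ u ∈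
      (rootSpace (LinearMap.ker (dInv n σ + LinearMap.id)) 𝔞 α).map (T.baseChange ℂ)) :
    A.baseChange ℂ u = (-(Complex.I * realEval α a) * Complex.cot (Complex.I * realEval α w)) • u := by
  obtain ⟨X, hX, hXu⟩ := hu
  set c := -(Complex.I * realEval α a) * Complex.cot (Complex.I * realEval α w)
  let φ : orbitTangent n d σ (g : G ⧸ H) →ₗ[ℝ] GroupLieAlgebra (𝓡 n) G :=
    (show TangentSpace (𝓡 d) (g : G ⧸ H) →ₗ[ℝ] GroupLieAlgebra (𝓡 n) G from gI n d σ H g) ∘ₗ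
      (orbitTangent n d σ (g : G ⧸ H)).subtype
  have hφmem : ∀ u, φ u ∈ tangentPart (dInv n σ) (Ad n g⁻¹) := fun u =>
    (mem_orbitTangent_iff hπ hσ g _).1 u.2
  have hφinj : ∀ u, φ u = 0 → u = 0 := fun u hu => Subtype.ext
    ((gS_gI hπ hσ g (u : TangentSpace (𝓡 d) (g : G ⧸ H))).symm.trans
      ((congrArg (gS n d H g) hu).trans (map_zero _)))
  have hka : gI n d σ H g (gS n d H g (Ad n k a)) = Ad n k a := by
    have h1 := hσ.Ad_mem_normalPart hk hgk (mem_normalPart_of_mem hσ.isLieInvolution h𝔞 hP hU a.2)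
    rw [gI_gS hπ hσ, antiPart_of_mem (mem_normalPart.1 h1).1]
  have hφX : φ.baseChange ℂ u = (Ad n k).baseChange ℂ X := by
    have h1 : φ.baseChange ℂ u
        = ((show TangentSpace (𝓡 d) (g : G ⧸ H) →ₗ[ℝ] GroupLieAlgebra (𝓡 n) G from
          gI n d σ H g) ∘ₗ T).baseChange ℂ X := by
      rw [LinearMap.baseChange_comp, LinearMap.baseChange_comp, LinearMap.comp_apply,
        LinearMap.comp_apply, hXu]
    have h2 : ∀ Y, Y ∈ LinearMap.ker (dInv n σ + LinearMap.id) →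
        gI n d σ H g (T Y) = Ad n k Y := by
      intro Y hY
      have hY' := mem_antiSub.1 hY
      refine (congrArg (gI n d σ H g) (hT Y hY')).trans ?_
      rw [gI_gS hπ hσ, hσ.antiPart_Ad hk, antiPart_of_mem hY]
    have h3 := mem_baseChange_iff.1 hX.1
    rw [h1]
    refine tensor_ext ?_ ?_
    · rw [tensorRe_baseChange, tensorRe_baseChange]
      exact h2 _ h3.1
    · rw [tensorIm_baseChange, tensorIm_baseChange]
      exact h2 _ h3.2
  have hAd : ∀ (ξ : ℂ ⊗[ℝ] GroupLieAlgebra (𝓡 n) G) (y : GroupLieAlgebra (𝓡 n) G),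
      killC _ ((Ad n k).baseChange ℂ ξ) ((1 : ℂ) ⊗ₜ Ad n k y) = killC _ ξ ((1 : ℂ) ⊗ₜ y) := by
    intro ξ y
    induction ξ with
    | zero => simp
    | tmul z x => rw [LinearMap.baseChange_tmul, killC_tmul, killC_tmul, killingForm_Ad]
    | add x y hx hy => rw [map_add, map_add, map_add, LinearMap.add_apply, LinearMap.add_apply,
        hx, hy]
  have key : ∀ y ∈ tangentPart (dInv n σ) (Ad n g⁻¹),
      killC _ (φ.baseChange ℂ (A.baseChange ℂ u - c • u)) ((1 : ℂ) ⊗ₜ y) = 0 := by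
    rintro _ ⟨F, hF, rfl⟩
    have hF := mem_fixSub.1 hF
    set y := antiPart (dInv n σ) (Ad n g⁻¹ F) with hy
    have h1 : ∀ ξ : ℂ ⊗[ℝ] (orbitTangent n d σ (g : G ⧸ H)),
        killC _ (φ.baseChange ℂ (A.baseChange ℂ ξ)) ((1 : ℂ) ⊗ₜ y)
          = killC _ (φ.baseChange ℂ ξ)
            ((1 : ℂ) ⊗ₜ ⁅Ad n k a, fixPart (dInv n σ) (Ad n g⁻¹ F)⁆) := by
      intro ξ
      induction ξ with
      | zero => simp
      | tmul z x =>
        have h2 := hA x ⟨gS n d H g (Ad n g⁻¹ F), (mem_orbitTangent hπ hσ g _).2 ⟨F, hF, rfl⟩⟩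
          F hF rfl
        have h3 := (metric_eq hπ hσ g (A x : TangentSpace (𝓡 d) (g : G ⧸ H))
          (gS n d H g (Ad n g⁻¹ F))).symm.trans h2
        rw [gI_gS hπ hσ, hka] at h3
        rw [LinearMap.baseChange_tmul, LinearMap.baseChange_tmul, LinearMap.baseChange_tmul,
          killC_tmul, killC_tmul]
        exact congrArg (fun r : ℝ => z * 1 * (r : ℂ)) h3
      | add x y hx hy => rw [map_add, map_add, map_add, LinearMap.add_apply, hx, hy, map_add,
          map_add, LinearMap.add_apply]
    -- Translating F by h⁻¹ keeps it in 𝔥 and gives Ad(g⁻¹)F = Ad(k)Ad(g⁻¹)F', so that Ad(k) factors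
    -- out of every term.
    set F' := Ad n (g * k⁻¹ * g⁻¹) F with hF'
    have hkinv : g * k⁻¹ * g⁻¹ ∈ H := by
      have h2 := inv_mem hgk
      have : (g * k * g⁻¹)⁻¹ = g * k⁻¹ * g⁻¹ := by group
      rwa [this] at h2
    have hF'fix : F' ∈ LinearMap.ker (dInv n σ - LinearMap.id) := by
      rw [mem_fixSub, hF', hσ.dInv_Ad hkinv, hF]
    have hFF' : Ad n g⁻¹ F = Ad n k (Ad n g⁻¹ F') := by
      rw [hF', ← Ad_mul_apply, ← Ad_mul_apply]
      congr 2
      group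
    have h2 := hU.killC_lie_fixPart hσ.isLieInvolution h𝔞 hα hX a hF'fix
    rw [show (antiPart (dInv n σ) ∘ₗ Ad n g⁻¹) F = y from rfl, map_sub, map_sub,
      LinearMap.sub_apply, h1, map_smul, map_smul, LinearMap.smul_apply, hφX,
      hy, hFF', hσ.antiPart_Ad hk, hσ.fixPart_Ad hk, ← Ad_lie, hAd, hAd, h2, smul_eq_mul, sub_self]
  have hzero : ∀ D : ℂ ⊗[ℝ] (orbitTangent n d σ (g : G ⧸ H)),
      (∀ y ∈ tangentPart (dInv n σ) (Ad n g⁻¹),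
        killC _ (φ.baseChange ℂ D) ((1 : ℂ) ⊗ₜ y) = 0) → D = 0 := by
    intro D hD
    refine tensor_ext ?_ ?_
    · rw [map_zero]
      refine hφinj _ (hU.eq_zero_of_mem_tangentPart hσ.isLieInvolution h𝔞 hP (hφmem _)
        fun y hy => ?_)
      rw [← tensorRe_baseChange]
      exact ((killC_one_tmul_eq_zero_iff _ _).1 (hD y hy)).1
    · rw [map_zero]
      refine hφinj _ (hU.eq_zero_of_mem_tangentPart hσ.isLieInvolution h𝔞 hP (hφmem _)
        fun y hy => ?_)
      rw [← tensorIm_baseChange]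
      exact ((killC_one_tmul_eq_zero_iff _ _).1 (hD y hy)).2
  exact sub_eq_zero.1 (hzero _ key)

/-- The shape operators of the orbit through `gH` and their eigenvalues. -/
theorem exists_shapeOperator {x : G ⧸ H} (hx : x = g) {k : G} (hk : k ∈ H) (hgk : g * k * g⁻¹ ∈ H)
    (a : 𝔞) {T : GroupLieAlgebra (𝓡 n) G →ₗ[ℝ] TangentSpace (𝓡 d) x}
    (hT : ∀ X, dInv n σ X = -X → T X = gS n d H g (Ad n k X)) :
    ∃ A : orbitTangent n d σ x →ₗ[ℝ] orbitTangent n d σ x,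
      (∀ A', IsShapeOperator n d σ x (T a) A' ↔ A' = A) ∧
      ∀ α, ¬ IsSingularAt w α →
        (rootSpace (LinearMap.ker (dInv n σ + LinearMap.id)) 𝔞 α).map (T.baseChange ℂ)
          ≤ (orbitTangent n d σ x).baseChange ℂ ∧
        ∀ u : ℂ ⊗[ℝ] (orbitTangent n d σ x),
          (orbitTangent n d σ x).subtype.baseChange ℂ u ∈
            (rootSpace (LinearMap.ker (dInv n σ + LinearMap.id)) 𝔞 α).map (T.baseChange ℂ) →
          A.baseChange ℂ u =
            (-(Complex.I * realEval α a) * Complex.cot (Complex.I * realEval α w)) • u := by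
  -- Keeping x a variable up to here allows x = g • eH, which equals gH only after simplifying g ·
  -- 1.
  subst hx
  have hTa : T a = gS n d H g (Ad n k a) := hT a (mem_antiSub.1 (h𝔞.le a.2))
  have hv : gS n d H g (Ad n k a) ∈ orbitNormal n d σ (g : G ⧸ H) :=
    isotropyImage_subset hπ hσ h𝔞 hP hU (fun _ => True) ⟨k, hk, hgk, a, trivial, rfl⟩
  obtain ⟨A, hA, huniq⟩ := existsUnique_isAlgShape hπ hσ h𝔞 hP hU hv
  refine ⟨A, fun A' => ?_, fun α hα => ⟨map_rootSpace_le hπ hσ h𝔞 hU hk hgk hα hT,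
    fun u hu => hA.apply_eq_smul hπ hσ h𝔞 hP hU hk hgk hα hT hu⟩⟩
  have h1 : IsShapeOperator n d σ (g : G ⧸ H) (T a) A' ↔ IsAlgShape n d σ g (T a) A' :=
    isShapeOperator_iff hπ hσ (hTa ▸ hv) A'
  rw [h1, hTa]
  exact ⟨huniq A', fun h => h ▸ hA⟩

end ShapeOperator

end SymSpace

end

/-! ### Assembly at the point x = gH. -/

theorem proposition3p2 {n d : ℕ} {G : Type*} [TopologicalSpace G] [T2Space G]
    [ChartedSpace (EuclideanSpace ℝ (Fin n)) G] [Group G] [LieGroup (𝓡 n) ∞ G]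
    -- `G` is semisimple, that is, its Killing form is nondegenerate
    [LieAlgebra.IsKilling ℝ (GroupLieAlgebra (𝓡 n) G)]
    (σ : G →* G) (H : Subgroup G) (hσ : SymSpace.IsSymmetricPair n σ H)
    -- `G ⧸ H` carries its manifold structure, the unique one for which `G → G ⧸ H` is a submersion
    [ChartedSpace (EuclideanSpace ℝ (Fin d)) (G ⧸ H)] [IsManifold (𝓡 d) ∞ (G ⧸ H)]
    (hπ : Manifold.IsSubmersion (𝓡 n) (𝓡 d) ∞ (fun k : G => (k : G ⧸ H)))
    (𝔞 : Submodule ℝ (GroupLieAlgebra (𝓡 n) G))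
    (h𝔞 : SymSpace.IsCartanSubspace (SymSpace.qSub n σ) 𝔞)
    (P : Set (Module.Dual ℂ (𝔞.baseChange ℂ)))
    (hP : SymSpace.IsPositiveSystem (SymSpace.qSub n σ) 𝔞 P)
    (w : 𝔞) :
    let g : G := SymSpace.lieExp (w : GroupLieAlgebra (𝓡 n) G)
    let x : G ⧸ H := g • SymSpace.base H
    -- the complexified tangent and normal spaces of `M = H • x` at `x`
    let TM := (SymSpace.orbitTangent n d σ x).baseChange ℂ
    let NM := (SymSpace.orbitNormal n d σ x).baseChange ℂ
    let gInv := (SymSpace.gStarInv n d σ H g).baseChange ℂ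
    let Q := SymSpace.rootSpace (SymSpace.qSub n σ) 𝔞
    -- the set of all `h_* g_* a` with `h ∈ H_x` and `a ∈ 𝔞` such that `p a`
    let S : (𝔞 → Prop) → Set (TangentSpace (𝓡 d) x) := fun p =>
      {v | ∃ h ∈ H, h • x = x ∧ ∃ a : 𝔞, p a ∧ v = SymSpace.dIso d h x (SymSpace.gStar n d H g a)}
    -- `a` lies on none of the hyperplanes `β = 0` with `β(w) ∈ √-1 π ℤ`
    let reg : 𝔞 → Prop := fun a =>
      ∀ β ∈ P, SymSpace.IsSingularAt w β → SymSpace.realEval β a ≠ 0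
    -- (i)
    (TM.map gInv = ⨆ α ∈ {α ∈ P | ¬ SymSpace.IsSingularAt w α}, Q α) ∧
    (NM.map gInv = 𝔞.baseChange ℂ ⊔ ⨆ α ∈ {α ∈ P | SymSpace.IsSingularAt w α}, Q α) ∧
    (SymSpace.IsPrincipalOrbit H x →
      TM.map gInv = ⨆ α ∈ P, Q α ∧ NM.map gInv = 𝔞.baseChange ℂ) ∧
    -- (ii)
    (S (fun _ => True) ⊆ SymSpace.orbitNormal n d σ x ∧
      (∃ U : Set (TangentSpace (𝓡 d) x), IsOpen U ∧
        S reg = U ∩ (SymSpace.orbitNormal n d σ x : Set (TangentSpace (𝓡 d) x))) ∧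
      S (fun _ => True) ⊆ closure (S reg)) ∧
    (∀ h ∈ H, h • x = x → ∀ a : 𝔞,
      ∃ A : SymSpace.orbitTangent n d σ x →ₗ[ℝ] SymSpace.orbitTangent n d σ x,
        (∀ A', SymSpace.IsShapeOperator n d σ x
          (SymSpace.dIso d h x (SymSpace.gStar n d H g a)) A' ↔ A' = A) ∧
        ∀ α ∈ P, ¬ SymSpace.IsSingularAt w α →
          -- `h_* g_* 𝔮_α`, a subspace of `ℂ ⊗ T_x (G ⧸ H)`
          let W : Submodule ℂ (ℂ ⊗[ℝ] TangentSpace (𝓡 d) x) := (Q α).map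
            (((SymSpace.dIso d h x).comp (SymSpace.gStar n d H g)).toLinearMap.baseChange ℂ)
          W ≤ TM ∧
          ∀ u : ℂ ⊗[ℝ] (SymSpace.orbitTangent n d σ x),
            (SymSpace.orbitTangent n d σ x).subtype.baseChange ℂ u ∈ W →
            A.baseChange ℂ u =
              (-(Complex.I * SymSpace.realEval α a) *
                Complex.cot (Complex.I * SymSpace.realEval α w)) • u) := by
  intro g x TM NM gInv Q S reg
  have hx : x = (g : G ⧸ H) := SymSpace.smul_base g
  have hU := SymSpace.isExpPair_of_eq_exp hσ
    (SymSpace.AdE_lieExp (w : GroupLieAlgebra (𝓡 n) G))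
  have hθ := hσ.isLieInvolution
  have hT : TM.map gInv = _ := SymSpace.map_orbitTangent hπ hσ g
  have hN : NM.map gInv = _ := SymSpace.map_orbitNormal hπ hσ g
  have hS : ∀ p : 𝔞 → Prop, S p = SymSpace.isotropyImage n d H g 𝔞 p := fun p =>
    SymSpace.setOf_dIso_gStar hπ g 𝔞 p
  have hNx : {v : SymSpace.Eu d | v ∈ SymSpace.orbitNormal n d σ x}
      = {v : SymSpace.Eu d | v ∈ SymSpace.orbitNormal n d σ (g : G ⧸ H)} := by rw [hx]
  refine ⟨hT.trans (hU.tangentPart_baseChange hθ h𝔞 hP),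
    hN.trans (hU.normalPart_baseChange hθ h𝔞 hP), fun hprin => ?_, ⟨?_, ?_, ?_⟩,
    fun h hh hhx a => ?_⟩
  · rw [hx] at hprin
    have h1 := SymSpace.tangentPart_of_isPrincipalOrbit hσ h𝔞 hP hπ w hprin
    exact ⟨hT.trans h1.1, hN.trans h1.2⟩
  · rw [hS]
    exact (SymSpace.isotropyImage_subset hπ hσ h𝔞 hP hU _).trans hNx.ge
  · obtain ⟨U, hUo, hUe⟩ := SymSpace.exists_isOpen_isotropyImage hπ hσ h𝔞 hP hU
    refine ⟨U, hUo, (hS _).trans (hUe.trans ?_)⟩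
    rw [← hNx]
    rfl
  · rw [hS, hS]
    exact SymSpace.isotropyImage_subset_closure h𝔞 hP g w
  -- An element h of H fixes gH exactly when k = g⁻¹hg lies in H, and then h_*g_* = g_*Ad(k) on 𝔮.
  · have hk : g⁻¹ * h * g ∈ H := by
      rw [hx] at hhx
      exact (SymSpace.smul_coe_eq_iff h g).1 hhx
    have hgk : g * (g⁻¹ * h * g) * g⁻¹ ∈ H := by
      have h1 : g * (g⁻¹ * h * g) * g⁻¹ = h := by group
      rwa [h1]
    obtain ⟨A, hA, hA'⟩ := SymSpace.exists_shapeOperator hπ hσ h𝔞 hP hU hx hk hgk a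
      (T := ((SymSpace.dIso d h x).comp (SymSpace.gStar n d H g)).toLinearMap)
      fun X _ => SymSpace.dIso_gStar hπ hk X
    exact ⟨A, hA, fun α _ hα => hA' α hα⟩
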